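/- Consider a $\gamma$-discounted infinite-horizon MDP, $\gamma\in(0,1)$, with finite state space $\mathcal S$ and finite action space $\mathcal A$, $D=|\mathcal S\times\mathcal A|$, transition kernel $P(\cdot\mid s,a)$ (also viewed as a $D\times|\mathcal S|$ matrix $P$) and random rewards $R(s,a)$ with mean $r(s,a)$. For a stationary policy $\pi$ let $Q^\pi(s,a)=\mathbb E_\pi[\sum_{t\ge0}\gamma^t r(s_t,a_t)\mid s_0=s,a_0=a]$ and $V^\pi(s)=\sum_a\pi(a|s)Q^\pi(s,a)$, let $Q^*=\max_\pi Q^\pi$, $V^*=\max_\pi V^\pi$, and let $P^\pi$ be the $D\times D$ matrix with entries $P^\pi\big((s,a),(s',a')\big)=P(s'|s,a)\,\pi(a'|s')$. In each iteration $t\ge1$ one observes, independently over $t$ and $(s,a)$, a reward $r_t(s,a)\sim R(s,a)$ and, independently of it, a next state $s_t(s,a)\sim P(\cdot\mid s,a)$. Synchronous Q-learning with step sizes $\eta_t$ is $$Q_t(s,a)=(1-\eta_t)Q_{t-1}(s,a)+\eta_t\Big(r_t(s,a)+\gamma\max_{a'}Q_{t-1}(s_t(s,a),a')\Big),$$ and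 $\bar Q_T=\frac1T\sum_{t=1}^TQ_t$. The initial $Q_0$ is deterministic with $\|Q_0-Q^*\|_\infty\le\frac1{1-\gamma}$ (for example $Q_0=0$). The Bellman noise is $Z_t(s,a)=r_t(s,a)-r(s,a)+\gamma\big(V^*(s_t(s,a))-(PV^*)(s,a)\big)$, and $\mathrm{Var}(Z)=\mathbb E Z_tZ_t^\top$. Assume that $0\le R(s,a)\le1$ for all $(s,a)$, and that there are an optimal policy $\pi^*$ (that is, $V^{\pi^*}=V^*$) and a constant $L$ such that for every $Q\in\mathbb R^D$ and a policy $\pi_Q$ greedy for $Q$ (ties in $\arg\max_aQ(s,a)$ broken in some way), $$\|(P^{\pi_Q}-P^{\pi^*})(Q-Q^*)\|_\infty\le L\|Q-Q^*\|_\infty^2 .$$ Put $\mathrm{Var}_Q=(I-\gamma P^{\pi^*})^{-1}\,\mathrm{Var}(Z)\,(I-\gamma P^{\pi^*})^{-\top}$. Then, whenever $D$ is larger than a universal constant, the following holds. (a) If $\eta_t=t^{-\alpha}$ for $t\ge1$ and $\eta_0=1$, with $\alpha\in(0.5,1)$, then for all $T\ge1$ $$\mathbb E\|\bar Q_T-Q^*\|_\infty=\mathcal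 O\left(\sqrt{\|\mathrm{diag}(\mathrm{Var}_Q)\|_\infty}\sqrt{\frac{\ln D}{T}}+\frac{\sqrt{\ln D}}{(1-\gamma)^3}\frac1{T^{1-\alpha/2}}\right)+\widetilde{\mathcal O}\left(\frac{1+L}{(1-\gamma)^{3+\frac2{1-\alpha}}}\frac1T+\frac{\gamma L}{(1-\gamma)^{4+\frac1{1-\alpha}}}\frac1{T^\alpha}\right).$$ (b) If $\eta_t=\frac1{1+(1-\gamma)t}$, then for all $T\ge1$ $$\mathbb E\|\bar Q_T-Q^*\|_\infty=\mathcal O\left(\sqrt{\frac{\|\mathrm{Var}(Z)\|_\infty}{(1-\gamma)^2}}\sqrt{\frac{\ln D}{T}}\right)+\widetilde{\mathcal O}\left(\frac{1+L}{(1-\gamma)^6}\frac1T\right).$$ Here $\|\cdot\|_\infty$ is the maximum norm of vectors and the maximal absolute row sum of matrices; $\mathcal O(\cdot)$ hides a universal constant; and $\widetilde{\mathcal O}(\cdot)$ hides a factor $C\,(1+\ln D+\ln T)^k$, where $C$ and $k$ depend only on $\alpha$ in (a) and are universal in (b). -/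

import Mathlib

universe u v w

/-- A discounted infinite-horizon Markov decision process with state space `S` and action space `A`:
a discount factor in `(0, 1)`, a transition kernel, and for every state-action pair the law of the
random immediate reward. -/
structure DiscountedMDP (S A : Type*) where
  /-- the discount factor -/
  γ : ℝ
  γ_pos : 0 < γ
  γ_lt_one : γ < 1
  /-- `P (s, a) s'` is the probability of moving from `s` to `s'` under the action `a` -/
  P : S × A → PMF S
  /-- `R (s, a)` is the law of the random reward collected at `(s, a)` -/
  R : S × A → MeasureTheory.ProbabilityMeasure ℝ

/-- `π` is a greedy policy for `Q`: it only uses actions in `argmax_a Q(s, a)`. -/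
def IsGreedyPolicy {S A : Type*} (Q : S × A → ℝ) (π : S → PMF A) : Prop :=
  ∀ s a, π s a ≠ 0 → ∀ b, Q (s, b) ≤ Q (s, a)

namespace DiscountedMDP

variable {S A : Type*} (M : DiscountedMDP S A)

/-- All rewards take values in `[0, 1]`. -/
def RewardsInUnitInterval : Prop :=
  ∀ i : S × A, ∀ᵐ x ∂(M.R i : MeasureTheory.Measure ℝ), x ∈ Set.Icc (0 : ℝ) 1

/-- The expected reward `r = 𝔼 R`. -/
noncomputable def r (i : S × A) : ℝ := ∫ x, x ∂(M.R i : MeasureTheory.Measure ℝ)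

/-- The square transition matrix `P^π` over state-action pairs induced by the (possibly randomized)
stationary policy `π`: its entry at `((s, a), (s', a'))` is `P(s' | s, a) π(a' | s')`. -/
noncomputable def transition (π : S → PMF A) : Matrix (S × A) (S × A) ℝ :=
  Matrix.of fun i j => (M.P i j.1).toReal * (π j.1 j.2).toReal

variable [Fintype S] [Fintype A] [DecidableEq S] [DecidableEq A]

/-- The Q-function of the policy `π`, i.e. `Q^π(s, a) = 𝔼_π [∑ₜ γ^t r(sₜ, aₜ) | s₀ = s, a₀ = a]`:
the `(s, a)`-th row of `(P^π)^t` is the law of `(sₜ, aₜ)` for the trajectory that starts at `(s, a)`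
and follows `π`. -/
noncomputable def qValue (π : S → PMF A) (i : S × A) : ℝ :=
  ∑' t : ℕ, M.γ ^ t * ((M.transition π ^ t).mulVec M.r) i

/-- The value function `V^π(s) = ∑ₐ π(a | s) Q^π(s, a)`. -/
noncomputable def vValue (π : S → PMF A) (s : S) : ℝ :=
  ∑ a, (π s a).toReal * M.qValue π (s, a)

/-- The optimal Q-function `Q^*(s, a) = max_π Q^π(s, a)`. -/
noncomputable def optQ (i : S × A) : ℝ := ⨆ π : S → PMF A, M.qValue π i

/-- The optimal value function `V^*(s) = max_π V^π(s)`. -/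
noncomputable def optV (s : S) : ℝ := ⨆ π : S → PMF A, M.vValue π s

/-- `π` is an optimal policy. -/
def IsOptimal (π : S → PMF A) : Prop := ∀ s, M.vValue π s = M.optV s

/-- The Lipschitz condition with constant `L` at the policy `πs`: for every `Q`, with `π_Q` a greedy
policy for `Q` (the condition is only required for some way of breaking ties in the argmax),
`‖(P^{π_Q} - P^{πs}) (Q - Q^*)‖_∞ ≤ L ‖Q - Q^*‖_∞ ^ 2`.
The norm on `S × A → ℝ` is the sup norm. -/
def LipschitzCondition (πs : S → PMF A) (L : ℝ) : Prop :=
  ∀ Q : S × A → ℝ, ∃ πQ : S → PMF A, IsGreedyPolicy Q πQ ∧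
    ‖(M.transition πQ - M.transition πs).mulVec (Q - M.optQ)‖ ≤ L * ‖Q - M.optQ‖ ^ 2

variable {Ω : Type*}

/-- Synchronous Q-learning started at `Q₀`, with step sizes `η`, rewards `rew t (s, a)` and next
states `nxt t (s, a)` observed in the iterations `t = 1, 2, …`:
`Q_t(s, a) = (1 - η_t) Q_{t-1}(s, a) + η_t (r_t(s, a) + γ max_{a'} Q_{t-1}(s_t(s, a), a'))`. -/
noncomputable def qLearning (η : ℕ → ℝ) (Q₀ : S × A → ℝ)
    (rew : ℕ → S × A → Ω → ℝ) (nxt : ℕ → S × A → Ω → S) : ℕ → Ω → S × A → ℝ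
  | 0, _ => Q₀
  | t + 1, ω => fun i =>
      (1 - η (t + 1)) * qLearning η Q₀ rew nxt t ω i
        + η (t + 1) * (rew (t + 1) i ω
            + M.γ * ⨆ a : A, qLearning η Q₀ rew nxt t ω (nxt (t + 1) i ω, a))

/-- The averaged iterate `Q̄_T = T⁻¹ ∑_{t=1}^T Q_t`. -/
noncomputable def avgQLearning (η : ℕ → ℝ) (Q₀ : S × A → ℝ)
    (rew : ℕ → S × A → Ω → ℝ) (nxt : ℕ → S × A → Ω → S) (T : ℕ) (ω : Ω) : S × A → ℝ :=
  (T : ℝ)⁻¹ • ∑ t ∈ Finset.Icc 1 T, M.qLearning η Q₀ rew nxt t ω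

/-- The Bellman noise `Z_t = (r_t - r) + γ (P_t - P) V^*`. -/
noncomputable def bellmanNoise (rew : ℕ → S × A → Ω → ℝ) (nxt : ℕ → S × A → Ω → S)
    (t : ℕ) (ω : Ω) (i : S × A) : ℝ :=
  (rew t i ω - M.r i)
    + M.γ * (M.optV (nxt t i ω) - ∑ s, (M.P i s).toReal * M.optV s)

variable [MeasurableSpace Ω]

/-- The generative model on the probability space `(Ω, μ)`: the observations (reward, next state)
are independent over all iterations and all state-action pairs, and at `(s, a)` the reward has law
`R(s, a)`, the next state has law `P(· | s, a)`, and these two are independent. -/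
structure IsGenerativeModel [MeasurableSpace S] (μ : MeasureTheory.Measure Ω)
    (rew : ℕ → S × A → Ω → ℝ) (nxt : ℕ → S × A → Ω → S) : Prop where
  law : ∀ t i, ProbabilityTheory.HasLaw (fun ω => (rew t i ω, nxt t i ω))
    ((M.R i : MeasureTheory.Measure ℝ).prod (M.P i).toMeasure) μ
  indep : ProbabilityTheory.iIndepFun
    (fun (p : ℕ × (S × A)) ω => (rew p.1 p.2 ω, nxt p.1 p.2 ω)) μ

/-- The covariance matrix `Var(Z) = 𝔼 Z Zᵀ` of the Bellman noise (the `Z_t` are i.i.d.). -/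
noncomputable def varZ (μ : MeasureTheory.Measure Ω)
    (rew : ℕ → S × A → Ω → ℝ) (nxt : ℕ → S × A → Ω → S) : Matrix (S × A) (S × A) ℝ :=
  Matrix.of fun i j => ∫ ω, M.bellmanNoise rew nxt 1 ω i * M.bellmanNoise rew nxt 1 ω j ∂μ

/-- The matrix `Var_Q = (I - γ P^π)⁻¹ Var(Z) (I - γ P^π)⁻ᵀ`. -/
noncomputable def varQ (μ : MeasureTheory.Measure Ω)
    (rew : ℕ → S × A → Ω → ℝ) (nxt : ℕ → S × A → Ω → S) (π : S → PMF A) :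
    Matrix (S × A) (S × A) ℝ :=
  (1 - M.γ • M.transition π)⁻¹ * M.varZ μ rew nxt * ((1 - M.γ • M.transition π)⁻¹).transpose

end DiscountedMDP

/-- The `ℓ_∞` operator norm of a matrix: the maximal absolute row sum. -/
noncomputable def matrixInftyNorm {ι : Type*} [Fintype ι] (B : Matrix ι ι ℝ) : ℝ :=
  ‖fun i => ∑ j, |B i j|‖

/-- The polynomial step size `η_t = t^{-α}` for `t ≥ 1`, with `η_0 = 1`. -/
noncomputable def polyStep (α : ℝ) (t : ℕ) : ℝ := if t = 0 then 1 else (t : ℝ) ^ (-α)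

/-- The linearly rescaled step size `η_t = 1 / (1 + (1 - γ) t)`. -/
noncomputable def linearStep (γ : ℝ) (t : ℕ) : ℝ := 1 / (1 + (1 - γ) * t)

set_option linter.unusedSectionVars false

/-! Write `Δ_t = Q_t - Q^*`, `h = 1/(1-γ)` and `ℓ = ln(2D)`. With `η = η_{t+1}`, the error obeys
`Δ_{t+1} = (1-η) Δ_t + η (Z_{t+1} + γ W_t + γ P(V_t - V^*))`, where `W_t = (P_{t+1} - P)(V_t - V^*)`
is a martingale difference of size at most `2‖Δ_t‖`. The Lipschitz condition replaces `P(V_t - V^*)`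
by `P^{π^*} Δ_t` up to an error `L‖Δ_t‖²` (`IsOptimal.abs_next_greedyValue_sub_le`). So the
recursion is linear, driven by `Z`, up to two perturbations that are controlled by `E‖Δ_t‖²`.

Second moments: the averaged noise `N_t`, which follows the recursion without the drift, is
sub-Gaussian in each coordinate with variance proxy of order `h² η_t`, and `Δ_t - N_t` contracts at
rate `(1-γ) η_t` with forcing `‖N_t‖`. Hence `E‖Δ_t‖²` is of order `ℓ h⁴ η_t`, up to a transient
(polynomial steps) or a factor `ln T` (linear steps).

Part (a): applying `G = (I - γ P^{π^*})⁻¹` expresses `Δ_t` as `G` applied to `η⁻¹(Δ_t - Δ_{t+1})`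
plus the noises and the linearization error. In the sum over `t` (`norm_sum_qError_le`), Abel
summation bounds the first part by order `√ℓ h³ T^{α/2}`; the independent terms `G Z_t` obey
Bernstein's inequality with the variances `T diag(Var_Q)`; the sum of the `G W_t` and the quadratic
error are bounded through `∑ E‖Δ_t‖²`.

Part (b): the linear step equals the product of its own contraction factors. In the unrolled
linearized recursion every past noise therefore carries a nonnegative matrix weight with row sums at
most `η_t ≤ h/(t+1)`. Each single iterate has leading error of order `h √(‖Var(Z)‖ ℓ / t)`, and the
triangle inequality over `t` costs a constant.

A maximum over `D` coordinates costs only logarithms: exponential moments with a union bound serve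
the independent noise, and the potential `log ∑ exp` serves the martingale, for which it needs only
the expected squares of random increment bounds (`integral_log_sum_exp_le`). -/

/-! ### Averages over a finite distribution -/

theorem PMF.sum_toReal {α : Type*} [Fintype α] (p : PMF α) : ∑ a, (p a).toReal = 1 := by
  have h := p.tsum_coe
  rw [tsum_fintype] at h
  rw [← ENNReal.toReal_sum (fun a _ => p.apply_ne_top a), h, ENNReal.toReal_one]

theorem PMF.sum_toReal_mul_le {α : Type*} [Fintype α] (p : PMF α) {f : α → ℝ} {c : ℝ}
    (h : ∀ a, p a ≠ 0 → f a ≤ c) : ∑ a, (p a).toReal * f a ≤ c := by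
  calc ∑ a, (p a).toReal * f a ≤ ∑ a, (p a).toReal * c := by
        refine Finset.sum_le_sum fun a _ => ?_
        by_cases ha : p a = 0
        · simp [ha]
        · exact mul_le_mul_of_nonneg_left (h a ha) ENNReal.toReal_nonneg
    _ = c := by rw [← Finset.sum_mul, p.sum_toReal, one_mul]

theorem PMF.le_sum_toReal_mul {α : Type*} [Fintype α] (p : PMF α) {f : α → ℝ} {c : ℝ}
    (h : ∀ a, p a ≠ 0 → c ≤ f a) : c ≤ ∑ a, (p a).toReal * f a := by
  have := p.sum_toReal_mul_le (f := fun a => -f a) (c := -c) fun a ha => neg_le_neg (h a ha)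
  simp only [mul_neg, Finset.sum_neg_distrib] at this
  linarith

theorem PMF.sum_toReal_mul_mono {α : Type*} [Fintype α] (p : PMF α) {f g : α → ℝ}
    (h : ∀ a, f a ≤ g a) : ∑ a, (p a).toReal * f a ≤ ∑ a, (p a).toReal * g a :=
  Finset.sum_le_sum fun a _ => mul_le_mul_of_nonneg_left (h a) ENNReal.toReal_nonneg

theorem PMF.abs_sum_toReal_mul_le {α : Type*} [Fintype α] (p : PMF α) {f : α → ℝ} {c : ℝ}
    (h : ∀ a, |f a| ≤ c) : |∑ a, (p a).toReal * f a| ≤ c :=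
  abs_le.2 ⟨p.le_sum_toReal_mul fun a _ => (abs_le.1 (h a)).1,
    p.sum_toReal_mul_le fun a _ => (abs_le.1 (h a)).2⟩

/-! ### Effective horizon, one-step expectations, greedy and policy values -/

namespace DiscountedMDP

variable {S A : Type*} (M : DiscountedMDP S A)

theorem one_sub_γ_pos : 0 < 1 - M.γ := sub_pos.2 M.γ_lt_one

/-- The effective horizon `1 / (1 - γ)`. -/
noncomputable def horizon : ℝ := 1 / (1 - M.γ)

theorem horizon_mul : M.horizon * (1 - M.γ) = 1 := by
  have := M.one_sub_γ_pos
  unfold horizon; field_simp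

theorem one_le_horizon : 1 ≤ M.horizon := by
  have := M.one_sub_γ_pos
  unfold horizon
  rw [le_div_iff₀ this]; linarith [M.γ_pos]

theorem horizon_pos : 0 < M.horizon := lt_of_lt_of_le one_pos M.one_le_horizon

theorem one_add_γ_mul_horizon : 1 + M.γ * M.horizon = M.horizon := by
  linarith [M.horizon_mul]

variable [Fintype S] [Fintype A]

/-- The expectation of `f` at the next state, `(P f)(s, a) = ∑ P(s' | s, a) f(s')`. -/
noncomputable def next (f : S → ℝ) (i : S × A) : ℝ := ∑ s, (M.P i s).toReal * f s

theorem next_mono {f g : S → ℝ} (h : ∀ s, f s ≤ g s) (i : S × A) : M.next f i ≤ M.next g i :=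
  (M.P i).sum_toReal_mul_mono h

theorem abs_next_le {f : S → ℝ} {c : ℝ} (h : ∀ s, |f s| ≤ c) (i : S × A) : |M.next f i| ≤ c :=
  (M.P i).abs_sum_toReal_mul_le h

end DiscountedMDP

/-- The value `s ↦ max_a Q(s, a)` of a `Q`-function. -/
noncomputable def greedyValue {S A : Type*} (Q : S × A → ℝ) (s : S) : ℝ := ⨆ a, Q (s, a)

/-- The value `s ↦ ∑ₐ π(a | s) Q(s, a)` of a `Q`-function under the policy `π`. -/
noncomputable def policyValue {S A : Type*} [Fintype A] (π : S → PMF A) (Q : S × A → ℝ) (s : S) :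
    ℝ := ∑ a, (π s a).toReal * Q (s, a)

section Values

variable {S A : Type*} [Fintype S] [Fintype A]

theorem le_greedyValue (Q : S × A → ℝ) (s : S) (a : A) : Q (s, a) ≤ greedyValue Q s :=
  le_ciSup (f := fun a => Q (s, a)) (Finite.bddAbove_range _) a

theorem policyValue_le_greedyValue (π : S → PMF A) (Q : S × A → ℝ) (s : S) :
    policyValue π Q s ≤ greedyValue Q s :=
  (π s).sum_toReal_mul_le fun a _ => le_greedyValue Q s a

theorem IsGreedyPolicy.policyValue_eq {π : S → PMF A} {Q : S × A → ℝ} (h : IsGreedyPolicy Q π)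
    (s : S) : policyValue π Q s = greedyValue Q s := by
  refine le_antisymm (policyValue_le_greedyValue π Q s) ?_
  refine (π s).le_sum_toReal_mul fun a ha => ?_
  have : Nonempty A := ⟨a⟩
  exact ciSup_le fun b => h s a ha b

theorem exists_isGreedyPolicy [Nonempty A] (Q : S × A → ℝ) :
    ∃ π : S → PMF A, IsGreedyPolicy Q π := by
  have h : ∀ s, ∃ a, ∀ b, Q (s, b) ≤ Q (s, a) := fun s => Finite.exists_max fun a => Q (s, a)
  choose f hf using h
  refine ⟨fun s => PMF.pure (f s), fun s a ha b => ?_⟩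
  have : a = f s := by
    by_contra hne
    exact ha (by simp [PMF.pure_apply, hne])
  rw [this]; exact hf s b

theorem policyValue_sub (π : S → PMF A) (Q Q' : S × A → ℝ) :
    policyValue π (Q - Q') = policyValue π Q - policyValue π Q' := by
  ext s; simp [policyValue, mul_sub]

theorem abs_policyValue_le (π : S → PMF A) {Q : S × A → ℝ} {c : ℝ} (h : ∀ i, |Q i| ≤ c) (s : S) :
    |policyValue π Q s| ≤ c :=
  (π s).abs_sum_toReal_mul_le fun a => h (s, a)

theorem abs_greedyValue_sub_le [Nonempty A] {Q Q' : S × A → ℝ} {c : ℝ} (h : ∀ i, |Q i - Q' i| ≤ c)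
    (s : S) : |greedyValue Q s - greedyValue Q' s| ≤ c := by
  rw [abs_le]
  constructor
  · have : greedyValue Q' s ≤ greedyValue Q s + c := ciSup_le fun a => by
      have := (abs_le.1 (h (s, a))).1
      linarith [le_greedyValue Q s a]
    linarith
  · have : greedyValue Q s ≤ greedyValue Q' s + c := ciSup_le fun a => by
      have := (abs_le.1 (h (s, a))).2
      linarith [le_greedyValue Q' s a]
    linarith

end Values

/-! ### Bellman equations, optimality and linearization at `Q^*` -/

namespace DiscountedMDP

variable {S A : Type*} (M : DiscountedMDP S A) [Fintype S] [Fintype A]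

theorem transition_mulVec (π : S → PMF A) (Q : S × A → ℝ) :
    (M.transition π).mulVec Q = M.next (policyValue π Q) := by
  ext i
  simp only [transition, Matrix.mulVec, dotProduct, Matrix.of_apply, next, policyValue,
    Fintype.sum_prod_type, Finset.mul_sum, mul_assoc]

theorem abs_transition_mulVec_le (π : S → PMF A) {Q : S × A → ℝ} {c : ℝ} (h : ∀ i, |Q i| ≤ c)
    (i : S × A) : |(M.transition π).mulVec Q i| ≤ c := by
  rw [transition_mulVec]
  exact M.abs_next_le (abs_policyValue_le π h) i

/-- Minimum principle: at a minimizer `j` the `P^π`-average of `d` is at least `d j`, so `γ d j ≤ d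
j`, which forces `d j ≥ 0`. All comparisons between solutions of Bellman equations rest on it. -/
theorem nonneg_of_le (π : S → PMF A) {d : S × A → ℝ}
    (h : ∀ i, M.γ * (M.transition π).mulVec d i ≤ d i) (i : S × A) : 0 ≤ d i := by
  have : Nonempty (S × A) := ⟨i⟩
  obtain ⟨j, hj⟩ := Finite.exists_min d
  have h1 : d j ≤ (M.transition π).mulVec d j := by
    rw [transition_mulVec]
    exact (M.P j).le_sum_toReal_mul fun s _ => (π s).le_sum_toReal_mul fun a _ => hj (s, a)
  have h2 : M.γ * d j ≤ d j := (mul_le_mul_of_nonneg_left h1 M.γ_pos.le).trans (h j)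
  have h3 : 0 ≤ d j := by
    have := M.one_sub_γ_pos
    by_contra! hneg
    nlinarith
  exact h3.trans (hj i)

section Bellman

variable [DecidableEq S] [DecidableEq A]

theorem r_mem (hR : M.RewardsInUnitInterval) (i : S × A) : 0 ≤ M.r i ∧ M.r i ≤ 1 := by
  constructor
  · exact MeasureTheory.integral_nonneg_of_ae ((hR i).mono fun x hx => hx.1)
  · have hint : MeasureTheory.Integrable (fun x : ℝ => x) (M.R i : MeasureTheory.Measure ℝ) :=
      MeasureTheory.Integrable.of_bound (by fun_prop) 1 ((hR i).mono fun x hx => by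
        rw [Real.norm_eq_abs, abs_le]; exact ⟨by linarith [hx.1], hx.2⟩)
    calc M.r i ≤ ∫ _, (1 : ℝ) ∂(M.R i : MeasureTheory.Measure ℝ) :=
          MeasureTheory.integral_mono_ae hint (MeasureTheory.integrable_const _)
            ((hR i).mono fun x hx => hx.2)
      _ = 1 := by simp

theorem abs_pow_transition_mulVec_r_le (hR : M.RewardsInUnitInterval) (π : S → PMF A) (t : ℕ) :
    ∀ i, |(M.transition π ^ t).mulVec M.r i| ≤ 1 := by
  induction t with
  | zero =>
    intro i
    have := M.r_mem hR i
    simp only [pow_zero, Matrix.one_mulVec]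
    rw [abs_le]; constructor <;> linarith
  | succ t ih =>
    intro i
    rw [pow_succ', ← Matrix.mulVec_mulVec]
    exact M.abs_transition_mulVec_le π ih i

theorem hasSum_qValue (hR : M.RewardsInUnitInterval) (π : S → PMF A) (i : S × A) :
    HasSum (fun t : ℕ => M.γ ^ t * ((M.transition π ^ t).mulVec M.r) i) (M.qValue π i) := by
  refine Summable.hasSum (Summable.of_norm_bounded (g := fun t : ℕ => M.γ ^ t)
    (summable_geometric_of_lt_one M.γ_pos.le M.γ_lt_one) fun t => ?_)
  rw [norm_mul, Real.norm_eq_abs, Real.norm_eq_abs, abs_of_nonneg (pow_nonneg M.γ_pos.le t)]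
  exact mul_le_of_le_one_right (pow_nonneg M.γ_pos.le t)
    (M.abs_pow_transition_mulVec_r_le hR π t i)

/-- Splits off the term `t = 0` of the discounted series and pulls one factor `P^π` out of the
others. -/
theorem qValue_eq (hR : M.RewardsInUnitInterval) (π : S → PMF A) (i : S × A) :
    M.qValue π i = M.r i + M.γ * (M.transition π).mulVec (M.qValue π) i := by
  have h1 := M.hasSum_qValue hR π i
  have h2 : HasSum (fun t : ℕ => M.γ ^ (t + 1) * ((M.transition π ^ (t + 1)).mulVec M.r) i)
      (M.γ * (M.transition π).mulVec (M.qValue π) i) := by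
    have h3 : HasSum (fun t : ℕ => ∑ j, M.transition π i j *
        (M.γ ^ t * ((M.transition π ^ t).mulVec M.r) j))
        (∑ j, M.transition π i j * M.qValue π j) :=
      hasSum_sum fun j _ => (M.hasSum_qValue hR π j).mul_left _
    have h4 := h3.mul_left M.γ
    have e : (fun t : ℕ => M.γ ^ (t + 1) * ((M.transition π ^ (t + 1)).mulVec M.r) i)
        = fun t => M.γ * ∑ j, M.transition π i j *
        (M.γ ^ t * ((M.transition π ^ t).mulVec M.r) j) := by
      funext t
      rw [pow_succ' (M.transition π), ← Matrix.mulVec_mulVec]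
      simp only [Matrix.mulVec, dotProduct, Finset.mul_sum]
      refine Finset.sum_congr rfl fun j _ => Finset.sum_congr rfl fun k _ => ?_
      ring
    rw [e]; exact h4
  have h4 := (hasSum_nat_add_iff' 1).2 h1
  have h5 := h4.unique h2
  simp at h5
  linarith

/-- The minimum principle applied to `Q^π` and to `h - Q^π`; the constant `h = 1 + γ h` solves the
Bellman equation for the maximal reward `1`. -/
theorem qValue_mem (hR : M.RewardsInUnitInterval) (π : S → PMF A) (i : S × A) :
    0 ≤ M.qValue π i ∧ M.qValue π i ≤ M.horizon := by
  constructor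
  · refine M.nonneg_of_le π (fun i => ?_) i
    have := M.qValue_eq hR π i
    linarith [(M.r_mem hR i).1]
  · have := M.nonneg_of_le π (d := fun i => M.horizon - M.qValue π i) (fun i => ?_) i
    · linarith
    · have h1 := M.qValue_eq hR π i
      have h2 := (M.r_mem hR i).2
      have h3 : (M.transition π).mulVec (fun i => M.horizon - M.qValue π i) i
          = M.horizon - (M.transition π).mulVec (M.qValue π) i := by
        have : (fun i => M.horizon - M.qValue π i) = (fun _ => M.horizon) - M.qValue π := rfl
        rw [this, Matrix.mulVec_sub, Pi.sub_apply]
        congr 1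
        simp [transition_mulVec, next, policyValue, ← Finset.sum_mul, PMF.sum_toReal]
      rw [h3]
      linarith [M.one_add_γ_mul_horizon]

/-- The bound by the horizon is what gives the supremum its meaning: over an unbounded family it
would be `0` by convention. -/
theorem qValue_le_optQ (hR : M.RewardsInUnitInterval) (π : S → PMF A) (i : S × A) :
    M.qValue π i ≤ M.optQ i :=
  le_ciSup (f := fun π => M.qValue π i)
    ⟨M.horizon, by rintro _ ⟨π, rfl⟩; exact (M.qValue_mem hR π i).2⟩ π

theorem vValue_le_optV (hR : M.RewardsInUnitInterval) (π : S → PMF A) (s : S) :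
    M.vValue π s ≤ M.optV s :=
  le_ciSup (f := fun π => M.vValue π s)
    ⟨M.horizon, by
      rintro _ ⟨π, rfl⟩
      exact (π s).sum_toReal_mul_le fun a _ => (M.qValue_mem hR π _).2⟩ π

variable {M} {πs : S → PMF A}

/-- Optimality concerns state values only, but `Q^π = r + γ P V^π` is monotone in `V^π`, so
maximizing `V^π` in every state maximizes `Q^π` at every pair. -/
theorem IsOptimal.optQ_eq (hπ : M.IsOptimal πs) (hR : M.RewardsInUnitInterval) :
    M.optQ = M.qValue πs := by
  ext i
  refine le_antisymm ?_ (M.qValue_le_optQ hR πs i)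
  have : Nonempty (S → PMF A) := ⟨πs⟩
  refine ciSup_le fun π => ?_
  rw [M.qValue_eq hR π, M.qValue_eq hR πs, transition_mulVec, transition_mulVec]
  have : M.next (policyValue π (M.qValue π)) i ≤ M.next (policyValue πs (M.qValue πs)) i :=
    M.next_mono (fun s => (M.vValue_le_optV hR π s).trans (hπ s).ge) i
  have := mul_le_mul_of_nonneg_left this M.γ_pos.le
  linarith

theorem IsOptimal.policyValue_eq (hπ : M.IsOptimal πs) (hR : M.RewardsInUnitInterval) :
    policyValue πs M.optQ = M.optV := by
  ext s; rw [hπ.optQ_eq hR]; exact hπ s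

theorem IsOptimal.optQ_bellman (hπ : M.IsOptimal πs) (hR : M.RewardsInUnitInterval) (i : S × A) :
    M.optQ i = M.r i + M.γ * M.next M.optV i := by
  rw [← hπ.policyValue_eq hR, ← transition_mulVec, hπ.optQ_eq hR, ← M.qValue_eq hR]

/-- Policy improvement. For `π` greedy with respect to `Q^*`, the difference `d = Q^π - Q^*`
satisfies `d - γ P^π d = γ P (max_a Q^* - V^*) ≥ 0`, so `d ≥ 0` by the minimum principle. Thus
`max_a Q^*` is at most `V^π`, hence at most `V^*`. -/
theorem IsOptimal.greedyValue_eq (hπ : M.IsOptimal πs) (hR : M.RewardsInUnitInterval) :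
    greedyValue M.optQ = M.optV := by
  ext s
  refine le_antisymm ?_ ?_
  · have : Nonempty A := (πs s).support_nonempty.to_type
    obtain ⟨π, hg⟩ := exists_isGreedyPolicy M.optQ
    have key : ∀ i, M.optQ i ≤ M.qValue π i := by
      intro i
      have := M.nonneg_of_le π (d := M.qValue π - M.optQ) (fun i => ?_) i
      · simpa using this
      · rw [Matrix.mulVec_sub, Pi.sub_apply, Pi.sub_apply, M.qValue_eq hR π i,
          hπ.optQ_bellman hR i, M.transition_mulVec π M.optQ]
        have : M.next M.optV i ≤ M.next (policyValue π M.optQ) i :=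
          M.next_mono (fun s => by
            rw [hg.policyValue_eq, ← hπ.policyValue_eq hR]
            exact policyValue_le_greedyValue _ _ _) i
        have := mul_le_mul_of_nonneg_left this M.γ_pos.le
        linarith
    rw [← hg.policyValue_eq]
    exact ((π s).sum_toReal_mul_mono fun a => key (s, a)).trans (M.vValue_le_optV hR π s)
  · rw [← hπ.policyValue_eq hR]
    exact policyValue_le_greedyValue _ _ _

theorem IsOptimal.optQ_mem (hπ : M.IsOptimal πs) (hR : M.RewardsInUnitInterval) (i : S × A) :
    0 ≤ M.optQ i ∧ M.optQ i ≤ M.horizon := by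
  rw [hπ.optQ_eq hR]; exact M.qValue_mem hR πs i

theorem IsOptimal.optV_mem (hπ : M.IsOptimal πs) (hR : M.RewardsInUnitInterval) (s : S) :
    0 ≤ M.optV s ∧ M.optV s ≤ M.horizon := by
  rw [← hπ.policyValue_eq hR]
  exact ⟨(πs s).le_sum_toReal_mul fun a _ => (hπ.optQ_mem hR _).1,
    (πs s).sum_toReal_mul_le fun a _ => (hπ.optQ_mem hR _).2⟩

/-- For `Q = Q^* + 1` the right-hand side of the condition is `L` itself. -/
theorem LipschitzCondition.nonneg [Nonempty (S × A)] {L : ℝ} (hL : M.LipschitzCondition πs L) :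
    0 ≤ L := by
  obtain ⟨π, -, h⟩ := hL (M.optQ + 1)
  have h1 : ‖(1 : S × A → ℝ)‖ = 1 := norm_one
  rw [add_sub_cancel_left, h1] at h
  have := (norm_nonneg _).trans h
  linarith

/-- The linearization error of the Bellman operator at `Q^*` is quadratic. -/
theorem IsOptimal.abs_next_greedyValue_sub_le (hπ : M.IsOptimal πs)
    (hR : M.RewardsInUnitInterval) {L : ℝ} (hL : M.LipschitzCondition πs L) (Q : S × A → ℝ)
    (i : S × A) :
    |M.next (greedyValue Q - M.optV) i - (M.transition πs).mulVec (Q - M.optQ) i|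
      ≤ L * ‖Q - M.optQ‖ ^ 2 := by
  obtain ⟨π, hg, h⟩ := hL Q
  refine le_trans ?_ ((norm_le_pi_norm _ i).trans h)
  -- `V^*` is the `π^*`-average of `Q^*`, and the greedy value of `Q` dominates the `π^*`-average of
  -- `Q`.
  have lower : (M.transition πs).mulVec (Q - M.optQ) i ≤ M.next (greedyValue Q - M.optV) i := by
    rw [transition_mulVec, policyValue_sub, hπ.policyValue_eq hR]
    exact M.next_mono (fun s => sub_le_sub_right (policyValue_le_greedyValue πs Q s) _) i
  -- Conversely, the greedy value of `Q` is its `π_Q`-average, and `V^*` dominates the `π_Q`-average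
  -- of `Q^*`. The linearization error is thus squeezed between `0` and the quantity in the
  -- Lipschitz condition.
  have upper : M.next (greedyValue Q - M.optV) i ≤ (M.transition π).mulVec (Q - M.optQ) i := by
    rw [transition_mulVec, policyValue_sub, ← hπ.greedyValue_eq hR]
    refine M.next_mono (fun s => ?_) i
    rw [Pi.sub_apply, Pi.sub_apply, hg.policyValue_eq]
    exact sub_le_sub_left (policyValue_le_greedyValue π _ s) _
  rw [abs_of_nonneg (sub_nonneg.2 lower), Matrix.sub_mulVec, Pi.sub_apply]
  exact (sub_le_sub_right upper _).trans (le_abs_self _)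

end Bellman

end DiscountedMDP

/-! ### Exponential inequalities and expected maxima -/

open MeasureTheory ProbabilityTheory

/-- Under a centered variable the linear term integrates to zero and a sub-Gaussian bound remains.
Unlike `e^x ≤ 1 + x + x²`, it holds for all `x`. -/
theorem Real.exp_le_add_exp_sq (x : ℝ) : Real.exp x ≤ x + Real.exp (x ^ 2) := by
  have h2 := Real.add_one_le_exp (x ^ 2)
  rcases le_or_gt |x| 1 with h | h
  · have := (abs_le.1 (Real.abs_exp_sub_one_sub_id_le h)).2
    linarith
  · rcases lt_abs.1 h with h | h
    · have : Real.exp x ≤ Real.exp (x ^ 2) := Real.exp_le_exp.2 (by nlinarith)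
      linarith
    · have : Real.exp x ≤ 1 := Real.exp_le_one_iff.2 (by linarith)
      nlinarith

/-- Turns an exponential moment into a second moment: for `y = m + u` with `u ≥ 0`, both `u` and `1
+ u + u²/2` are at most `e^u`. -/
theorem Real.sq_le_add_mul_exp_sub {m y : ℝ} (hm : 0 ≤ m) (hy : 0 ≤ y) :
    y ^ 2 ≤ m ^ 2 + (2 * m + 2) * Real.exp (y - m) := by
  rcases le_or_gt y m with h | h
  · have := Real.exp_pos (y - m)
    nlinarith
  · have h1 : 0 ≤ y - m := by linarith
    have h2 := Real.quadratic_le_exp_of_nonneg h1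
    nlinarith

/-- One step of the soft-max potential. Each `y k` differs from the weighted mean `m` by at most
`2c`, so `e^{y-m} ≤ (y-m) + e^{4c²}`, and the weighted sum of the linear parts vanishes. -/
theorem Real.log_sum_mul_exp_le {κ : Type*} [Fintype κ] [Nonempty κ] {w y : κ → ℝ} {c : ℝ}
    (hw : ∀ k, 0 < w k) (hy : ∀ k, |y k| ≤ c) :
    Real.log (∑ k, w k * Real.exp (y k))
      ≤ Real.log (∑ k, w k) + (∑ k, w k * y k) / (∑ k, w k) + 4 * c ^ 2 := by
  have hW : 0 < ∑ k, w k := Finset.sum_pos (fun k _ => hw k) Finset.univ_nonempty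
  set m := (∑ k, w k * y k) / ∑ k, w k with hm
  have hmW : (∑ k, w k * y k) = m * ∑ k, w k := by rw [hm]; field_simp
  have hmc : |m| ≤ c := by
    rw [hm, abs_div, abs_of_pos hW, div_le_iff₀ hW, Finset.mul_sum]
    refine (Finset.abs_sum_le_sum_abs _ _).trans (Finset.sum_le_sum fun k _ => ?_)
    rw [abs_mul, abs_of_pos (hw k), mul_comm]
    exact mul_le_mul_of_nonneg_right (hy k) (hw k).le
  have h1 : ∑ k, w k * Real.exp (y k)
      ≤ Real.exp m * (Real.exp (4 * c ^ 2) * ∑ k, w k) := by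
    calc ∑ k, w k * Real.exp (y k)
        ≤ ∑ k, w k * (Real.exp m * ((y k - m) + Real.exp (4 * c ^ 2))) := by
          refine Finset.sum_le_sum fun k _ => mul_le_mul_of_nonneg_left ?_ (hw k).le
          have e : y k = m + (y k - m) := by ring
          conv_lhs => rw [e, Real.exp_add]
          refine mul_le_mul_of_nonneg_left ?_ (Real.exp_pos _).le
          refine (Real.exp_le_add_exp_sq _).trans (add_le_add_right (Real.exp_le_exp.2 ?_) _)
          have hk := abs_le.1 (hy k)
          have hm' := abs_le.1 hmc
          nlinarith
      _ = Real.exp m * (((∑ k, w k * y k) - m * ∑ k, w k)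
            + Real.exp (4 * c ^ 2) * ∑ k, w k) := by
          simp only [Finset.mul_sum, ← Finset.sum_sub_distrib, ← Finset.sum_add_distrib]
          refine Finset.sum_congr rfl fun k _ => ?_
          ring
      _ = _ := by rw [hmW, sub_self, zero_add]
  have hpos : 0 < ∑ k, w k * Real.exp (y k) :=
    Finset.sum_pos (fun k _ => mul_pos (hw k) (Real.exp_pos _)) Finset.univ_nonempty
  calc Real.log (∑ k, w k * Real.exp (y k))
      ≤ Real.log (Real.exp m * (Real.exp (4 * c ^ 2) * ∑ k, w k)) := Real.log_le_log hpos h1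
    _ = m + (4 * c ^ 2 + Real.log (∑ k, w k)) := by
        rw [Real.log_mul (Real.exp_ne_zero _) (mul_pos (Real.exp_pos _) hW).ne',
          Real.log_mul (Real.exp_ne_zero _) hW.ne', Real.log_exp, Real.log_exp]
    _ = _ := by ring

section Probability

variable {Ω : Type*} {mΩ : MeasurableSpace Ω} {μ : Measure Ω} [IsProbabilityMeasure μ]

theorem MeasureTheory.integrable_of_abs_le {f : Ω → ℝ} (hf : Measurable f) {c : ℝ}
    (h : ∀ ω, |f ω| ≤ c) : Integrable f μ :=
  Integrable.of_bound hf.aestronglyMeasurable c (Filter.Eventually.of_forall h)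

/-- `X` is orthogonal to all bounded `F`-measurable functions, i.e. its conditional expectation
given `F` vanishes. -/
def IsCentered (F : MeasurableSpace Ω) (μ : @Measure Ω mΩ) (X : Ω → ℝ) : Prop :=
  ∀ g : Ω → ℝ, Measurable[F] g → (∃ c, ∀ ω, |g ω| ≤ c) → ∫ ω, g ω * X ω ∂μ = 0

theorem IsCentered.sum {F : MeasurableSpace Ω} {κ : Type*} [Fintype κ] {X : κ → Ω → ℝ}
    (hF : F ≤ mΩ) (hX : ∀ k, IsCentered F μ (X k)) (hi : ∀ k, Integrable (X k) μ) :
    IsCentered F μ (fun ω => ∑ k, X k ω) := by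
  rintro g hg ⟨c, hc⟩
  simp only [Finset.mul_sum]
  rw [integral_finsetSum]
  · exact Finset.sum_eq_zero fun k _ => hX k g hg ⟨c, hc⟩
  · intro k _
    exact (hi k).bdd_mul (hg.mono hF le_rfl).aestronglyMeasurable (Filter.Eventually.of_forall hc)

theorem IsCentered.mul {F : MeasurableSpace Ω} {X f : Ω → ℝ} (hX : IsCentered F μ X)
    (hf : Measurable[F] f) (hb : ∃ c, ∀ ω, |f ω| ≤ c) : IsCentered F μ (fun ω => f ω * X ω) := by
  rintro g hg ⟨c, hc⟩
  obtain ⟨b, hb⟩ := hb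
  have := hX (fun ω => g ω * f ω) (hg.mul hf) ⟨c * b, fun ω => by
    rw [abs_mul]
    exact mul_le_mul (hc ω) (hb ω) (abs_nonneg _) ((abs_nonneg _).trans (hc ω))⟩
  simpa [mul_assoc] using this

theorem IsCentered.const_mul {F : MeasurableSpace Ω} {X : Ω → ℝ} (hX : IsCentered F μ X) (a : ℝ) :
    IsCentered F μ (fun ω => a * X ω) :=
  hX.mul measurable_const ⟨|a|, fun _ => le_rfl⟩

/-- Adding a bounded centered increment multiplies a moment generating function by at most
`exp c²`. -/
theorem IsCentered.integral_mul_exp_le {F : MeasurableSpace Ω} {X g : Ω → ℝ} (hF : F ≤ mΩ)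
    (hX : IsCentered F μ X) (hXm : Measurable[mΩ] X) {c : ℝ} (hXc : ∀ ω, |X ω| ≤ c)
    (hg : Measurable[F] g) {b : ℝ} (hgb : ∀ ω, |g ω| ≤ b) (hg0 : ∀ ω, 0 ≤ g ω) :
    ∫ ω, g ω * Real.exp (X ω) ∂μ ≤ Real.exp (c ^ 2) * ∫ ω, g ω ∂μ := by
  have hgm : Measurable[mΩ] g := hg.mono hF le_rfl
  have hgi : Integrable g μ := integrable_of_abs_le hgm hgb
  have hmul : ∀ {Y : Ω → ℝ}, Integrable Y μ → Integrable (fun ω => g ω * Y ω) μ := fun hY =>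
    hY.bdd_mul hgm.aestronglyMeasurable (Filter.Eventually.of_forall hgb)
  have hXi : Integrable X μ := integrable_of_abs_le hXm hXc
  have hei : Integrable (fun ω => Real.exp (X ω)) μ :=
    integrable_of_abs_le hXm.exp (c := Real.exp c) fun ω => by
      rw [abs_of_pos (Real.exp_pos _)]
      exact Real.exp_le_exp.2 ((le_abs_self _).trans (hXc ω))
  calc ∫ ω, g ω * Real.exp (X ω) ∂μ
      ≤ ∫ ω, (g ω * X ω + Real.exp (c ^ 2) * g ω) ∂μ := by
        refine integral_mono (hmul hei) ((hmul hXi).add (hgi.const_mul _)) fun ω => ?_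
        have h1 := Real.exp_le_add_exp_sq (X ω)
        have h2 : Real.exp (X ω ^ 2) ≤ Real.exp (c ^ 2) := by
          refine Real.exp_le_exp.2 ?_
          rw [← sq_abs]
          exact pow_le_pow_left₀ (abs_nonneg _) (hXc ω) 2
        have := mul_le_mul_of_nonneg_left (h1.trans (add_le_add_right h2 _)) (hg0 ω)
        simp only
        linarith
    _ = _ := by
        rw [integral_add (hmul hXi) (hgi.const_mul _), hX g hg ⟨b, hgb⟩, zero_add,
          integral_const_mul]

/-- Soft-max bound for a vector valued martingale. -/
theorem integral_log_sum_exp_le {κ : Type*} [Fintype κ] [Nonempty κ] {F : ℕ → MeasurableSpace Ω}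
    (hF : Monotone F) (hFm : ∀ n, F n ≤ mΩ) {X : ℕ → Ω → κ → ℝ}
    (hX : ∀ j k, Measurable[F (j + 1)] fun ω => X j ω k)
    (hc : ∀ j k, IsCentered (F j) μ fun ω => X j ω k)
    {c : ℕ → Ω → ℝ} (hcm : ∀ j, Measurable (c j)) (hXc : ∀ j ω k, |X j ω k| ≤ c j ω)
    {b : ℕ → ℝ} (hcb : ∀ j ω, c j ω ≤ b j) (n : ℕ) :
    ∫ ω, Real.log (∑ k, Real.exp (∑ j ∈ Finset.range n, X j ω k)) ∂μ
      ≤ Real.log (Fintype.card κ) + 4 * ∑ j ∈ Finset.range n, ∫ ω, c j ω ^ 2 ∂μ := by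
  have hc0 : ∀ j ω, 0 ≤ c j ω := fun j ω =>
    (abs_nonneg _).trans (hXc j ω (Classical.arbitrary κ))
  have hsm : ∀ n k, Measurable[F n] fun ω => ∑ j ∈ Finset.range n, X j ω k := by
    intro n k
    refine Finset.measurable_fun_sum _ fun j hj => ?_
    exact (hX j k).mono (hF (by have := Finset.mem_range.1 hj; omega)) le_rfl
  have hsb : ∀ n ω k, |∑ j ∈ Finset.range n, X j ω k| ≤ ∑ j ∈ Finset.range n, b j := by
    intro n ω k
    exact (Finset.abs_sum_le_sum_abs _ _).trans
      (Finset.sum_le_sum fun j _ => (hXc j ω k).trans (hcb j ω))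
  have hpos : ∀ n ω, 0 < ∑ k, Real.exp (∑ j ∈ Finset.range n, X j ω k) := fun n ω =>
    Finset.sum_pos (fun k _ => Real.exp_pos _) Finset.univ_nonempty
  have hlogm : ∀ n, Measurable fun ω =>
      Real.log (∑ k, Real.exp (∑ j ∈ Finset.range n, X j ω k)) := fun n =>
    (Finset.measurable_fun_sum _ fun k _ => ((hsm n k).mono (hFm n) le_rfl).exp).log
  have hlogi : ∀ n, Integrable (fun ω =>
      Real.log (∑ k, Real.exp (∑ j ∈ Finset.range n, X j ω k))) μ := by
    intro n
    set B := ∑ j ∈ Finset.range n, b j with hB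
    have hD : (0 : ℝ) < Fintype.card κ := by exact_mod_cast Fintype.card_pos
    refine integrable_of_abs_le (hlogm n) (c := Real.log (Fintype.card κ) + B) fun ω => ?_
    have hDl : 0 ≤ Real.log (Fintype.card κ) :=
      Real.log_nonneg (by exact_mod_cast Nat.one_le_iff_ne_zero.2 Fintype.card_ne_zero)
    rw [abs_le]
    constructor
    · have h1 : Real.exp (-B) ≤ ∑ k, Real.exp (∑ j ∈ Finset.range n, X j ω k) := by
        refine le_trans ?_ (Finset.single_le_sum (f := fun k =>
          Real.exp (∑ j ∈ Finset.range n, X j ω k)) (fun k _ => (Real.exp_pos _).le)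
          (Finset.mem_univ (Classical.arbitrary κ)))
        exact Real.exp_le_exp.2 (abs_le.1 (hsb n ω _)).1
      have h2 := Real.log_le_log (Real.exp_pos _) h1
      rw [Real.log_exp] at h2
      linarith
    · have h1 : ∑ k, Real.exp (∑ j ∈ Finset.range n, X j ω k)
          ≤ Fintype.card κ * Real.exp B := by
        calc _ ≤ ∑ _k : κ, Real.exp B :=
              Finset.sum_le_sum fun k _ => Real.exp_le_exp.2 (abs_le.1 (hsb n ω k)).2
          _ = _ := by simp
      have h2 := Real.log_le_log (hpos n ω) h1
      rwa [Real.log_mul hD.ne' (Real.exp_ne_zero _), Real.log_exp] at h2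
  have hXi : ∀ j k, Integrable (fun ω => X j ω k) μ := fun j k =>
    integrable_of_abs_le ((hX j k).mono (hFm _) le_rfl) fun ω => (hXc j ω k).trans (hcb j ω)
  have hci : ∀ j, Integrable (fun ω => c j ω ^ 2) μ := fun j =>
    integrable_of_abs_le ((hcm j).pow_const 2) (c := b j ^ 2) fun ω => by
      rw [abs_of_nonneg (sq_nonneg _)]
      exact pow_le_pow_left₀ (hc0 j ω) (hcb j ω) 2
  induction n with
  | zero => simp
  | succ n ih =>
    -- These soft-max weights are bounded and `F n`-measurable, so the linear term of the one-step
    -- bound has mean zero. The remaining loss `4 c²` is pointwise in `ω`, so `c n` may be random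
    -- and need not be predictable.
    set p : κ → Ω → ℝ := fun k ω => Real.exp (∑ j ∈ Finset.range n, X j ω k)
      / ∑ l, Real.exp (∑ j ∈ Finset.range n, X j ω l) with hp
    have hpm : ∀ k, Measurable[F n] (p k) := fun k =>
      (hsm n k).exp.div (Finset.measurable_fun_sum _ fun l _ => (hsm n l).exp)
    have hp1 : ∀ k, ∃ c, ∀ ω, |p k ω| ≤ c := fun k => ⟨1, fun ω => by
      rw [hp]
      simp only
      rw [abs_of_nonneg (div_nonneg (Real.exp_pos _).le (hpos n ω).le), div_le_one (hpos n ω)]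
      exact Finset.single_le_sum (f := fun k => Real.exp (∑ j ∈ Finset.range n, X j ω k))
        (fun k _ => (Real.exp_pos _).le) (Finset.mem_univ k)⟩
    have hpXi : ∀ k, Integrable (fun ω => p k ω * X n ω k) μ := fun k => by
      obtain ⟨c, hc⟩ := hp1 k
      exact (hXi n k).bdd_mul ((hpm k).mono (hFm n) le_rfl).aestronglyMeasurable
        (Filter.Eventually.of_forall hc)
    have hsumi : Integrable (fun ω => ∑ k, p k ω * X n ω k) μ :=
      integrable_finsetSum _ fun k _ => hpXi k
    have hzero : ∫ ω, ∑ k, p k ω * X n ω k ∂μ = 0 := by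
      rw [integral_finsetSum _ fun k _ => hpXi k]
      exact Finset.sum_eq_zero fun k _ => hc n k _ (hpm k) (hp1 k)
    calc ∫ ω, Real.log (∑ k, Real.exp (∑ j ∈ Finset.range (n + 1), X j ω k)) ∂μ
        ≤ ∫ ω, ((Real.log (∑ k, Real.exp (∑ j ∈ Finset.range n, X j ω k))
            + ∑ k, p k ω * X n ω k) + 4 * c n ω ^ 2) ∂μ := by
          refine integral_mono (hlogi _) (((hlogi n).add hsumi).add ((hci n).const_mul 4))
            fun ω => ?_
          simp only [Finset.sum_range_succ, Real.exp_add]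
          refine (Real.log_sum_mul_exp_le (fun k => Real.exp_pos _) (hXc n ω)).trans_eq ?_
          rw [Finset.sum_div]
          congr 2
          refine Finset.sum_congr rfl fun k _ => ?_
          rw [hp]
          ring
      _ = ∫ ω, Real.log (∑ k, Real.exp (∑ j ∈ Finset.range n, X j ω k)) ∂μ
            + 4 * ∫ ω, c n ω ^ 2 ∂μ := by
          have e1 := integral_add ((hlogi n).add hsumi) ((hci n).const_mul 4)
          have e2 := integral_add (hlogi n) hsumi
          simp only [Pi.add_apply] at e1
          rw [e1, e2, hzero, add_zero, integral_const_mul]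
      _ ≤ _ := by
          rw [Finset.sum_range_succ]
          linarith

theorem measurable_norm_pi {ι : Type*} [Fintype ι] {Y : Ω → ι → ℝ} (hY : ∀ i, Measurable fun ω => Y ω i) :
    Measurable fun ω => ‖Y ω‖ :=
  (measurable_pi_iff.2 hY).norm

variable {ι : Type*} [Fintype ι] [Nonempty ι]

theorem Real.exp_norm_le_sum (x : ι → ℝ) (l : ℝ) :
    Real.exp (l * ‖x‖) ≤ ∑ i, (Real.exp (l * x i) + Real.exp (-l * x i)) := by
  obtain ⟨i, hi⟩ := Finite.exists_max fun i => ‖x i‖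
  have h : ‖x‖ = |x i| := le_antisymm ((pi_norm_le_iff_of_nonneg (norm_nonneg _)).2 hi)
    (norm_le_pi_norm x i)
  refine le_trans ?_ (Finset.single_le_sum
    (f := fun i => Real.exp (l * x i) + Real.exp (-l * x i))
    (fun i _ => (add_pos (Real.exp_pos _) (Real.exp_pos _)).le) (Finset.mem_univ i))
  rw [h]
  rcases abs_choice (x i) with e | e
  · rw [e]; linarith [Real.exp_pos (-l * x i)]
  · rw [e, mul_neg, ← neg_mul]; linarith [Real.exp_pos (l * x i)]

/-- A martingale in `ℝ^ι` with the maximum norm satisfies an `L²` bound with a factor that is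
logarithmic in the dimension. -/
theorem integral_norm_sum_le {F : ℕ → MeasurableSpace Ω}
    (hF : Monotone F) (hFm : ∀ n, F n ≤ mΩ) {X : ℕ → Ω → ι → ℝ}
    (hX : ∀ j k, Measurable[F (j + 1)] fun ω => X j ω k)
    (hc : ∀ j k, IsCentered (F j) μ fun ω => X j ω k)
    {c : ℕ → Ω → ℝ} (hcm : ∀ j, Measurable (c j)) (hXc : ∀ j ω k, |X j ω k| ≤ c j ω)
    {b : ℕ → ℝ} (hcb : ∀ j ω, c j ω ≤ b j) (n : ℕ) {s : ℝ} (hs : 0 < s)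
    (hcs : ∑ j ∈ Finset.range n, ∫ ω, c j ω ^ 2 ∂μ ≤ s) :
    ∫ ω, ‖∑ j ∈ Finset.range n, X j ω‖ ∂μ ≤ 4 * √(s * Real.log (2 * Fintype.card ι)) := by
  have hD : (1 : ℝ) ≤ Fintype.card ι := by
    exact_mod_cast Nat.one_le_iff_ne_zero.2 Fintype.card_ne_zero
  set ℓ := Real.log (2 * Fintype.card ι) with hℓ
  have hℓ0 : 0 < ℓ := Real.log_pos (by linarith)
  -- The scale at which the two terms `ℓ` and `4 l² s` of the potential bound are equal.
  set l := √(ℓ / (4 * s)) with hl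
  have hl0 : 0 < l := Real.sqrt_pos.2 (by positivity)
  have hl2 : l ^ 2 = ℓ / (4 * s) := Real.sq_sqrt (by positivity)
  -- Doubling the index set by a sign makes the potential dominate `l` times the maximum norm.
  have key := integral_log_sum_exp_le (κ := ι ⊕ ι) (μ := μ) hF hFm
    (X := fun j ω => Sum.elim (fun i => l * X j ω i) (fun i => -l * X j ω i))
    (c := fun j ω => l * c j ω) (b := fun j => l * b j)
    (by rintro j (k | k)
        · exact (hX j k).const_mul l
        · exact (hX j k).const_mul (-l))
    (by rintro j (k | k)
        · exact (hc j k).const_mul l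
        · exact (hc j k).const_mul (-l))
    (fun j => (hcm j).const_mul l)
    (by rintro j ω (k | k)
        · simp only [Sum.elim_inl]
          rw [abs_mul, abs_of_pos hl0]
          exact mul_le_mul_of_nonneg_left (hXc j ω k) hl0.le
        · simp only [Sum.elim_inr]
          rw [abs_mul, abs_neg, abs_of_pos hl0]
          exact mul_le_mul_of_nonneg_left (hXc j ω k) hl0.le)
    (fun j ω => mul_le_mul_of_nonneg_left (hcb j ω) hl0.le) n
  have hsb : ∀ ω k, |∑ j ∈ Finset.range n, X j ω k| ≤ ∑ j ∈ Finset.range n, b j := by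
    intro ω k
    exact (Finset.abs_sum_le_sum_abs _ _).trans
      (Finset.sum_le_sum fun j _ => (hXc j ω k).trans (hcb j ω))
  have hsm : ∀ k, Measurable fun ω => (∑ j ∈ Finset.range n, X j ω) k := by
    intro k
    simp only [Finset.sum_apply]
    exact Finset.measurable_fun_sum _ fun j _ => (hX j k).mono (hFm _) le_rfl
  have hni : Integrable (fun ω => ‖∑ j ∈ Finset.range n, X j ω‖) μ := by
    refine integrable_of_abs_le (measurable_norm_pi hsm) (c := ∑ j ∈ Finset.range n, b j)
      fun ω => ?_
    rw [abs_norm, pi_norm_le_iff_of_nonempty]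
    intro k
    rw [Finset.sum_apply]
    exact hsb ω k
  have hlog : ∀ ω, l * ‖∑ j ∈ Finset.range n, X j ω‖ ≤ Real.log (∑ k : ι ⊕ ι,
      Real.exp (∑ j ∈ Finset.range n,
        Sum.elim (fun i => l * X j ω i) (fun i => -l * X j ω i) k)) := by
    intro ω
    rw [Real.le_log_iff_exp_le (Finset.sum_pos (fun k _ => Real.exp_pos _)
      Finset.univ_nonempty)]
    refine (Real.exp_norm_le_sum _ l).trans_eq ?_
    rw [Fintype.sum_sum_type, Finset.sum_add_distrib]
    simp only [Sum.elim_inl, Sum.elim_inr, Finset.sum_apply, Finset.mul_sum]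
  have hlogi : Integrable (fun ω => Real.log (∑ k : ι ⊕ ι,
      Real.exp (∑ j ∈ Finset.range n,
        Sum.elim (fun i => l * X j ω i) (fun i => -l * X j ω i) k))) μ := by
    set B := ∑ j ∈ Finset.range n, b j with hB
    refine integrable_of_abs_le ?_ (c := Real.log (Fintype.card (ι ⊕ ι)) + l * B) fun ω => ?_
    · refine (Finset.measurable_fun_sum _ fun k _ => (Finset.measurable_fun_sum _
        fun j _ => ?_).exp).log
      rcases k with k | k
      · exact ((hX j k).mono (hFm _) le_rfl).const_mul l
      · exact ((hX j k).mono (hFm _) le_rfl).const_mul (-l)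
    · rw [abs_of_nonneg ((mul_nonneg hl0.le (norm_nonneg _)).trans (hlog ω))]
      have hcard : (0 : ℝ) < Fintype.card (ι ⊕ ι) := by exact_mod_cast Fintype.card_pos
      rw [Real.log_le_iff_le_exp (Finset.sum_pos (fun k _ => Real.exp_pos _)
        Finset.univ_nonempty), Real.exp_add, Real.exp_log hcard]
      calc _ ≤ ∑ _k : ι ⊕ ι, Real.exp (l * B) := by
            refine Finset.sum_le_sum fun k _ => Real.exp_le_exp.2 ?_
            rcases k with k | k
            · simp only [Sum.elim_inl, ← Finset.mul_sum]
              exact mul_le_mul_of_nonneg_left (abs_le.1 (hsb ω k)).2 hl0.le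
            · simp only [Sum.elim_inr, neg_mul, Finset.sum_neg_distrib, ← Finset.mul_sum, ← mul_neg]
              exact mul_le_mul_of_nonneg_left (neg_le.2 (abs_le.1 (hsb ω k)).1) hl0.le
        _ = _ := by simp
  have h1 : l * ∫ ω, ‖∑ j ∈ Finset.range n, X j ω‖ ∂μ ≤ ℓ + 4 * (l ^ 2 * s) := by
    rw [← integral_const_mul]
    refine (integral_mono (hni.const_mul l) hlogi hlog).trans (key.trans ?_)
    have e : Real.log (Fintype.card (ι ⊕ ι)) = ℓ := by
      rw [hℓ, Fintype.card_sum]; push_cast; ring_nf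
    rw [e]
    simp only [mul_pow, integral_const_mul, ← Finset.mul_sum]
    have := mul_le_mul_of_nonneg_left hcs (sq_nonneg l)
    linarith
  have h2 : ℓ + 4 * (l ^ 2 * s) = 2 * ℓ := by rw [hl2]; field_simp; ring
  have h3 : l * (4 * √(s * ℓ)) = 2 * ℓ := by
    rw [hl, mul_left_comm, ← Real.sqrt_mul (by positivity)]
    have : ℓ / (4 * s) * (s * ℓ) = (ℓ / 2) ^ 2 := by field_simp; norm_num
    rw [this, Real.sqrt_sq (by positivity)]; ring
  refine le_of_mul_le_mul_left ?_ hl0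
  rw [h3, ← h2]
  exact h1

theorem integral_exp_norm_le {Y : Ω → ι → ℝ} (hY : ∀ i, Measurable fun ω => Y ω i) {B : ℝ}
    (hB : ∀ ω i, |Y ω i| ≤ B) {l E : ℝ} (hl : 0 ≤ l)
    (h₁ : ∀ i, ∫ ω, Real.exp (l * Y ω i) ∂μ ≤ E) (h₂ : ∀ i, ∫ ω, Real.exp (-l * Y ω i) ∂μ ≤ E) :
    Integrable (fun ω => Real.exp (l * ‖Y ω‖)) μ ∧
      ∫ ω, Real.exp (l * ‖Y ω‖) ∂μ ≤ 2 * Fintype.card ι * E := by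
  have hn : ∀ ω, ‖Y ω‖ ≤ B := fun ω => by
    rw [pi_norm_le_iff_of_nonempty]; exact hB ω
  have hi : ∀ a : ℝ, ∀ i, Integrable (fun ω => Real.exp (a * Y ω i)) μ := fun a i =>
    integrable_of_abs_le ((hY i).const_mul a).exp (c := Real.exp (|a| * B)) fun ω => by
      rw [abs_of_pos (Real.exp_pos _)]
      refine Real.exp_le_exp.2 ((le_abs_self _).trans ?_)
      rw [abs_mul]
      exact mul_le_mul_of_nonneg_left (hB ω i) (abs_nonneg a)
  have hint : Integrable (fun ω => Real.exp (l * ‖Y ω‖)) μ :=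
    integrable_of_abs_le ((measurable_norm_pi hY).const_mul l).exp (c := Real.exp (l * B))
      fun ω => by
        rw [abs_of_pos (Real.exp_pos _)]
        exact Real.exp_le_exp.2 (mul_le_mul_of_nonneg_left (hn ω) hl)
  refine ⟨hint, ?_⟩
  calc ∫ ω, Real.exp (l * ‖Y ω‖) ∂μ
      ≤ ∫ ω, ∑ i, (Real.exp (l * Y ω i) + Real.exp (-l * Y ω i)) ∂μ :=
        integral_mono hint (integrable_finsetSum _ fun i _ => (hi _ i).add (hi _ i))
          fun ω => Real.exp_norm_le_sum _ l
    _ = ∑ i, (∫ ω, Real.exp (l * Y ω i) ∂μ + ∫ ω, Real.exp (-l * Y ω i) ∂μ) := by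
        have e := integral_finsetSum (Finset.univ : Finset ι)
          fun i _ => (hi l i).add (hi (-l) i)
        simp only [Pi.add_apply] at e
        rw [e]
        exact Finset.sum_congr rfl fun i _ => integral_add (hi _ i) (hi _ i)
    _ ≤ ∑ _i : ι, (E + E) := Finset.sum_le_sum fun i _ => add_le_add (h₁ i) (h₂ i)
    _ = _ := by simp; ring

/-- Second moment of the maximum of sub-Gaussian variables. -/
theorem integral_norm_sq_le_of_subgaussian (hι : 2 ≤ Fintype.card ι) {Y : Ω → ι → ℝ}
    (hY : ∀ i, Measurable fun ω => Y ω i) {B : ℝ} (hB : ∀ ω i, |Y ω i| ≤ B) {v : ℝ} (hv : 0 < v)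
    (h : ∀ l : ℝ, ∀ i, ∫ ω, Real.exp (l * Y ω i) ∂μ ≤ Real.exp (l ^ 2 * v)) :
    ∫ ω, ‖Y ω‖ ^ 2 ∂μ ≤ 10 * Real.log (2 * Fintype.card ι) * v := by
  have hD : (2 : ℝ) ≤ Fintype.card ι := by exact_mod_cast hι
  set ℓ := Real.log (2 * Fintype.card ι) with hℓ
  have hℓ1 : 1 ≤ ℓ := by
    rw [hℓ, Real.le_log_iff_exp_le (by linarith)]
    linarith [Real.exp_one_lt_d9]
  -- At this scale the exponential moment of `l‖Y‖` is at most `2D e^{l² v} = e^{2ℓ}`, so cutting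
  -- `l‖Y‖` at the level `2ℓ` leaves a remainder with exponential moment at most `1`.
  set l := √(ℓ / v) with hl
  have hl0 : 0 < l := Real.sqrt_pos.2 (by positivity)
  have hl2 : l ^ 2 = ℓ / v := Real.sq_sqrt (by positivity)
  have hlv : l ^ 2 * v = ℓ := by rw [hl2]; field_simp
  obtain ⟨hi, hle⟩ := integral_exp_norm_le (μ := μ) hY hB hl0.le (h l)
    (fun i => by simpa using h (-l) i)
  have hexp : 2 * Fintype.card ι * Real.exp (l ^ 2 * v) = Real.exp (2 * ℓ) := by
    rw [hlv, two_mul ℓ, Real.exp_add]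
    congr 1
    rw [hℓ, Real.exp_log (by linarith)]
  rw [hexp] at hle
  have hn : ∀ ω, ‖Y ω‖ ≤ B := fun ω => by
    rw [pi_norm_le_iff_of_nonempty]; exact hB ω
  have hsqi : Integrable (fun ω => ‖Y ω‖ ^ 2) μ :=
    integrable_of_abs_le ((measurable_norm_pi hY).pow_const 2) (c := B ^ 2) fun ω => by
      rw [abs_of_nonneg (sq_nonneg _)]
      exact pow_le_pow_left₀ (norm_nonneg _) (hn ω) 2
  have h1 : l ^ 2 * ∫ ω, ‖Y ω‖ ^ 2 ∂μ ≤ (2 * ℓ) ^ 2 + (2 * (2 * ℓ) + 2) := by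
    rw [← integral_const_mul]
    calc ∫ ω, l ^ 2 * ‖Y ω‖ ^ 2 ∂μ
        ≤ ∫ ω, ((2 * ℓ) ^ 2 + (2 * (2 * ℓ) + 2) * Real.exp (-(2 * ℓ))
            * Real.exp (l * ‖Y ω‖)) ∂μ := by
          refine integral_mono (hsqi.const_mul _)
            ((integrable_const _).add (hi.const_mul _)) fun ω => ?_
          have := Real.sq_le_add_mul_exp_sub (m := 2 * ℓ) (y := l * ‖Y ω‖) (by linarith)
            (by positivity)
          rw [sub_eq_add_neg, Real.exp_add, mul_pow] at this
          simp only
          linarith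
      _ = (2 * ℓ) ^ 2 + (2 * (2 * ℓ) + 2) * Real.exp (-(2 * ℓ))
            * ∫ ω, Real.exp (l * ‖Y ω‖) ∂μ := by
          rw [integral_add (integrable_const _) (hi.const_mul _), integral_const_mul]
          simp
      _ ≤ (2 * ℓ) ^ 2 + (2 * (2 * ℓ) + 2) * Real.exp (-(2 * ℓ)) * Real.exp (2 * ℓ) := by
          gcongr
      _ = _ := by
          rw [mul_assoc, ← Real.exp_add, neg_add_cancel, Real.exp_zero, mul_one]
  have h2 : (2 * ℓ) ^ 2 + (2 * (2 * ℓ) + 2) ≤ l ^ 2 * (10 * ℓ * v) := by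
    have : l ^ 2 * (10 * ℓ * v) = 10 * ℓ * (l ^ 2 * v) := by ring
    rw [this, hlv]
    nlinarith
  exact le_of_mul_le_mul_left (h1.trans h2) (by positivity)

/-- Bernstein's bound for the expected maximum. -/
theorem integral_norm_le_of_subexponential (hι : 2 ≤ Fintype.card ι) {Y : Ω → ι → ℝ}
    (hY : ∀ i, Measurable fun ω => Y ω i) {B : ℝ} (hB : ∀ ω i, |Y ω i| ≤ B) {v b : ℝ}
    (hv : 0 ≤ v) (hb : 0 < b)
    (h : ∀ l : ℝ, |l| * b ≤ 1 → ∀ i, ∫ ω, Real.exp (l * Y ω i) ∂μ ≤ Real.exp (l ^ 2 * v)) :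
    ∫ ω, ‖Y ω‖ ∂μ ≤ 3 * √(v * Real.log (2 * Fintype.card ι))
      + 2 * b * Real.log (2 * Fintype.card ι) := by
  have hD : (2 : ℝ) ≤ Fintype.card ι := by exact_mod_cast hι
  set ℓ := Real.log (2 * Fintype.card ι) with hℓ
  have hℓ1 : 1 ≤ ℓ := by
    rw [hℓ, Real.le_log_iff_exp_le (by linarith)]
    linarith [Real.exp_one_lt_d9]
  have hℓ0 : 0 < ℓ := by linarith
  set q := √(v / ℓ) with hq
  have hq0 : 0 ≤ q := Real.sqrt_nonneg _
  have hq2 : q * q = v / ℓ := Real.mul_self_sqrt (by positivity)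
  -- Adding `b` and `q` keeps `l` below the admissible `1/b` and, if `v > 0`, below the sub-Gaussian
  -- optimum `1/q = √(ℓ/v)`; the choice stays meaningful for `v = 0`.
  set l := 1 / (b + q) with hl
  have hbq : 0 < b + q := by linarith
  have hl0 : 0 < l := by positivity
  have hlb : |l| * b ≤ 1 := by
    rw [abs_of_pos hl0, hl, one_div, inv_mul_le_iff₀ hbq]; linarith
  obtain ⟨hi, hle⟩ := integral_exp_norm_le (μ := μ) hY hB hl0.le (h l hlb)
    (fun i => by simpa using h (-l) (by simpa using hlb) i)
  set m := ℓ + l ^ 2 * v with hm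
  have hexp : 2 * Fintype.card ι * Real.exp (l ^ 2 * v) = Real.exp m := by
    rw [hm, Real.exp_add]
    congr 1
    rw [hℓ, Real.exp_log (by linarith)]
  rw [hexp] at hle
  have hn : ∀ ω, ‖Y ω‖ ≤ B := fun ω => by
    rw [pi_norm_le_iff_of_nonempty]; exact hB ω
  have hni : Integrable (fun ω => ‖Y ω‖) μ :=
    integrable_of_abs_le (measurable_norm_pi hY) fun ω => by rw [abs_norm]; exact hn ω
  have h1 : l * ∫ ω, ‖Y ω‖ ∂μ ≤ m := by
    rw [← integral_const_mul]
    calc ∫ ω, l * ‖Y ω‖ ∂μ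
        ≤ ∫ ω, ((m - 1) + Real.exp (-m) * Real.exp (l * ‖Y ω‖)) ∂μ := by
          refine integral_mono (hni.const_mul _)
            ((integrable_const _).add (hi.const_mul _)) fun ω => ?_
          -- The tangent line of `exp` replaces Jensen's inequality; `m` is the logarithm of the
          -- bound on the exponential moment.
          have := Real.add_one_le_exp (-m + l * ‖Y ω‖)
          rw [Real.exp_add] at this
          simp only
          linarith
      _ = (m - 1) + Real.exp (-m) * ∫ ω, Real.exp (l * ‖Y ω‖) ∂μ := by
          rw [integral_add (integrable_const _) (hi.const_mul _), integral_const_mul]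
          simp
      _ ≤ (m - 1) + Real.exp (-m) * Real.exp m := by gcongr
      _ = _ := by rw [← Real.exp_add, neg_add_cancel, Real.exp_zero]; ring
  have hqℓ : q * ℓ = √(v * ℓ) := by
    rw [hq]
    nth_rewrite 2 [← Real.sqrt_sq hℓ0.le]
    rw [← Real.sqrt_mul (by positivity)]
    congr 1; field_simp
  have hlv : l * v ≤ √(v * ℓ) := by
    rw [← hqℓ, hl, one_div, inv_mul_le_iff₀ hbq]
    have : v = q * q * ℓ := by rw [hq2]; field_simp
    nlinarith [mul_nonneg (mul_nonneg hb.le hq0) hℓ0.le]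
  have h2 : ∫ ω, ‖Y ω‖ ∂μ ≤ (b + q) * m := by
    have : (b + q) * (l * ∫ ω, ‖Y ω‖ ∂μ) ≤ (b + q) * m := mul_le_mul_of_nonneg_left h1 hbq.le
    rwa [← mul_assoc, hl, mul_one_div_cancel hbq.ne', one_mul] at this
  have h3 : (b + q) * m = b * ℓ + q * ℓ + l * v := by
    have : (b + q) * l = 1 := by rw [hl]; field_simp
    rw [hm]
    linear_combination (l * v) * this
  rw [h3, hqℓ] at h2
  have := Real.sqrt_nonneg (v * ℓ)
  have := mul_pos hb hℓ0
  linarith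

end Probability

/-! ### Observations of the generative model and the Bellman noise -/

/-- Needed because value functions are evaluated at the random next state; finitely many states
reduce this to a sum of indicators. -/
theorem Measurable.eval_of_finite {Ω S : Type*} {_ : MeasurableSpace Ω} [Fintype S] [DecidableEq S]
    [MeasurableSpace S] [MeasurableSingletonClass S] {f : S → Ω → ℝ} {N : Ω → S}
    (hf : ∀ s, Measurable (f s)) (hN : Measurable N) : Measurable fun ω => f (N ω) ω := by
  have : (fun ω => f (N ω) ω) = fun ω => ∑ s, if N ω = s then f s ω else 0 := by
    ext ω; simp
  rw [this]
  exact Finset.measurable_fun_sum _ fun s _ =>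
    Measurable.ite (hN (measurableSet_singleton s)) (hf s) measurable_const

/-- The `σ`-algebra generated by the observations of the iterations `0, …, n`. -/
abbrev history {S A Ω : Type*} [MeasurableSpace S] (rew : ℕ → S × A → Ω → ℝ)
    (nxt : ℕ → S × A → Ω → S) (n : ℕ) : MeasurableSpace Ω :=
  ⨆ p ∈ {p : ℕ × (S × A) | p.1 ≤ n},
    MeasurableSpace.comap (fun ω => (rew p.1 p.2 ω, nxt p.1 p.2 ω)) inferInstance

namespace DiscountedMDP

variable {S A : Type*} [Fintype S] [Fintype A] [DecidableEq S] [DecidableEq A]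
  [MeasurableSpace S] [MeasurableSingletonClass S] {M : DiscountedMDP S A}
  {Ω : Type*} [mΩ : MeasurableSpace Ω] {μ : Measure Ω} [IsProbabilityMeasure μ]
  {rew : ℕ → S × A → Ω → ℝ} {nxt : ℕ → S × A → Ω → S}

/-- A generative model all of whose observations are measurable, with rewards in `[0, 1]`
everywhere. -/
structure IsBoundedModel (M : DiscountedMDP S A) (μ : Measure Ω) (rew : ℕ → S × A → Ω → ℝ)
    (nxt : ℕ → S × A → Ω → S) : Prop where
  model : M.IsGenerativeModel μ rew nxt
  measurable_rew : ∀ t i, Measurable (rew t i)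
  measurable_nxt : ∀ t i, Measurable (nxt t i)
  rew_mem : ∀ t i ω, 0 ≤ rew t i ω ∧ rew t i ω ≤ 1

theorem history_mono : Monotone (history rew nxt) := fun _ _ h =>
  biSup_mono fun _ hp => le_trans hp h

theorem measurable_history_pair {t n : ℕ} (h : t ≤ n) (i : S × A) :
    Measurable[history rew nxt n] fun ω => (rew t i ω, nxt t i ω) :=
  Measurable.mono (comap_measurable _)
    (le_biSup (fun p : ℕ × (S × A) =>
      MeasurableSpace.comap (fun ω => (rew p.1 p.2 ω, nxt p.1 p.2 ω)) inferInstance)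
      (show (t, i) ∈ {p : ℕ × (S × A) | p.1 ≤ n} from h)) le_rfl

theorem measurable_history_rew {t n : ℕ} (h : t ≤ n) (i : S × A) :
    Measurable[history rew nxt n] (rew t i) :=
  measurable_fst.comp (measurable_history_pair (rew := rew) (nxt := nxt) h i)

theorem measurable_history_nxt {t n : ℕ} (h : t ≤ n) (i : S × A) :
    Measurable[history rew nxt n] (nxt t i) :=
  measurable_snd.comp (measurable_history_pair (rew := rew) (nxt := nxt) h i)

theorem measurable_greedyValue {m : MeasurableSpace Ω} {Q : Ω → S × A → ℝ}
    (hQ : ∀ i, Measurable[m] fun ω => Q ω i) (s : S) :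
    Measurable[m] fun ω => greedyValue (Q ω) s :=
  Measurable.iSup fun a => hQ (s, a)

theorem measurable_next {m : MeasurableSpace Ω} {f : Ω → S → ℝ}
    (hf : ∀ s, Measurable[m] fun ω => f ω s) (i : S × A) :
    Measurable[m] fun ω => M.next (f ω) i :=
  Finset.measurable_fun_sum _ fun s _ => (hf s).const_mul _

theorem measurable_qLearning (η : ℕ → ℝ) (Q₀ : S × A → ℝ) (n : ℕ) :
    ∀ i, Measurable[history rew nxt n] fun ω => M.qLearning η Q₀ rew nxt n ω i := by
  induction n with
  | zero => intro i; exact measurable_const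
  | succ n ih =>
    intro i
    have h : ∀ i, Measurable[history rew nxt (n + 1)] fun ω => M.qLearning η Q₀ rew nxt n ω i :=
      fun i => (ih i).mono (history_mono n.le_succ) le_rfl
    refine ((h i).const_mul _).add (((measurable_history_rew le_rfl i).add
      (Measurable.const_mul ?_ _)).const_mul _)
    exact Measurable.eval_of_finite (f := fun s ω => greedyValue (M.qLearning η Q₀ rew nxt n ω) s)
      (measurable_greedyValue (m := history rew nxt (n + 1)) h) (measurable_history_nxt le_rfl i)

namespace IsBoundedModel

variable (hM : M.IsBoundedModel μ rew nxt)
include hM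

theorem history_le (n : ℕ) : history rew nxt n ≤ mΩ :=
  iSup₂_le fun p _ => ((hM.measurable_rew p.1 p.2).prodMk (hM.measurable_nxt p.1 p.2)).comap_le

theorem integral_comp (t : ℕ) (i : S × A) {φ : ℝ × S → ℝ} (hφ : Measurable φ) :
    ∫ ω, φ (rew t i ω, nxt t i ω) ∂μ
      = ∫ x, φ x ∂((M.R i : Measure ℝ).prod (M.P i).toMeasure) := by
  rw [← (hM.model.law t i).map_eq, integral_map (hM.model.law t i).aemeasurable
    hφ.aestronglyMeasurable]

theorem integral_rew (t : ℕ) (i : S × A) : ∫ ω, rew t i ω ∂μ = M.r i := by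
  rw [hM.integral_comp t i (φ := Prod.fst) measurable_fst]
  have := integral_fun_fst (μ := (M.R i : Measure ℝ)) (ν := (M.P i).toMeasure) (fun x : ℝ => x)
  simpa [r] using this

theorem integral_nxt (t : ℕ) (i : S × A) (s : S) :
    ∫ ω, (if nxt t i ω = s then (1 : ℝ) else 0) ∂μ = (M.P i s).toReal := by
  have hm : Measurable fun s' : S => if s' = s then (1 : ℝ) else 0 :=
    Measurable.ite (measurableSet_singleton s) measurable_const measurable_const
  rw [hM.integral_comp t i (φ := fun x => if x.2 = s then (1 : ℝ) else 0)
    (hm.comp measurable_snd)]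
  have := integral_fun_snd (μ := (M.R i : Measure ℝ)) (ν := (M.P i).toMeasure)
    (fun s' : S => if s' = s then (1 : ℝ) else 0)
  rw [this]
  have e : (fun s' : S => if s' = s then (1 : ℝ) else 0) = Set.indicator {s} 1 := by
    ext s'; simp [Set.indicator_apply]
  rw [e, integral_indicator_one (measurableSet_singleton s)]
  simp [Measure.real]

/-- Mean zero functions of the next observation are orthogonal to the past. -/
theorem isCentered_comp (n : ℕ) (i : S × A) {φ : ℝ × S → ℝ} (hφ : Measurable φ)
    (h0 : ∫ ω, φ (rew (n + 1) i ω, nxt (n + 1) i ω) ∂μ = 0) :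
    IsCentered (history rew nxt n) μ fun ω => φ (rew (n + 1) i ω, nxt (n + 1) i ω) := by
  rintro g hg -
  have hmeas : ∀ p : ℕ × (S × A), Measurable fun ω => (rew p.1 p.2 ω, nxt p.1 p.2 ω) := fun p =>
    (hM.measurable_rew p.1 p.2).prodMk (hM.measurable_nxt p.1 p.2)
  -- The past comes from the indices with `t ≤ n`, the new observation from `(n + 1, i)`; disjoint
  -- blocks of an independent family are independent.
  have hind := indep_iSup_of_disjoint (fun p => (hmeas p).comap_le) hM.model.indep.iIndep
    (S := {p : ℕ × (S × A) | p.1 ≤ n}) (T := {(n + 1, i)})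
    (Set.disjoint_singleton_right.2 (by simp))
  have hle : MeasurableSpace.comap (fun ω => φ (rew (n + 1) i ω, nxt (n + 1) i ω)) inferInstance
      ≤ ⨆ p ∈ ({(n + 1, i)} : Set (ℕ × (S × A))), MeasurableSpace.comap
        (fun ω => (rew p.1 p.2 ω, nxt p.1 p.2 ω)) inferInstance := by
    rw [iSup_singleton]
    exact (hφ.comp (comap_measurable _)).comap_le
  have hI : IndepFun g (fun ω => φ (rew (n + 1) i ω, nxt (n + 1) i ω)) μ := by
    rw [IndepFun_iff_Indep]
    exact indep_of_indep_of_le_left (indep_of_indep_of_le_right hind hle) hg.comap_le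
  have := hI.integral_mul_eq_mul_integral (hg.mono (hM.history_le n) le_rfl).aestronglyMeasurable
    (hφ.comp (hmeas (n + 1, i))).aestronglyMeasurable
  simp only [Pi.mul_apply] at this
  rw [this, h0, mul_zero]

theorem isCentered_rew (n : ℕ) (i : S × A) :
    IsCentered (history rew nxt n) μ fun ω => rew (n + 1) i ω - M.r i := by
  refine hM.isCentered_comp n i (φ := fun x => x.1 - M.r i) (by fun_prop) ?_
  simp only
  rw [integral_sub _ (integrable_const _), hM.integral_rew]
  · simp
  · exact integrable_of_abs_le (hM.measurable_rew _ _) (c := 1) fun ω => by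
      have := hM.rew_mem (n + 1) i ω
      rw [abs_of_nonneg this.1]; exact this.2

/-- Since `f` depends on the past, its value at the next state is not a fixed function of the
observation. Expanding over the possible next states leaves centered indicators with past-measurable
coefficients. -/
theorem isCentered_nxt (n : ℕ) (i : S × A) {f : Ω → S → ℝ}
    (hf : ∀ s, Measurable[history rew nxt n] fun ω => f ω s) {c : ℝ} (hc : ∀ ω s, |f ω s| ≤ c) :
    IsCentered (history rew nxt n) μ
      fun ω => f ω (nxt (n + 1) i ω) - M.next (f ω) i := by
  have hm : ∀ s, Measurable fun s' : S => if s' = s then (1 : ℝ) else 0 := fun s =>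
    Measurable.ite (measurableSet_singleton s) measurable_const measurable_const
  have hφm : ∀ s, Measurable fun x : ℝ × S =>
      (if x.2 = s then (1 : ℝ) else 0) - (M.P i s).toReal := fun s =>
    ((hm s).comp measurable_snd).sub_const _
  have hpm : Measurable fun ω => (rew (n + 1) i ω, nxt (n + 1) i ω) :=
    (hM.measurable_rew _ _).prodMk (hM.measurable_nxt _ _)
  have hbase : ∀ s, IsCentered (history rew nxt n) μ
      fun ω => (if nxt (n + 1) i ω = s then (1 : ℝ) else 0) - (M.P i s).toReal := by
    intro s
    refine hM.isCentered_comp n i (φ := fun x => (if x.2 = s then (1 : ℝ) else 0)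
      - (M.P i s).toReal) (hφm s) ?_
    simp only
    rw [integral_sub _ (integrable_const _), hM.integral_nxt]
    · simp
    · refine integrable_of_abs_le ((hm s).comp (hM.measurable_nxt _ _)) (c := 1) fun ω => ?_
      split_ifs <;> simp
  have hb : ∀ s ω, |(if nxt (n + 1) i ω = s then (1 : ℝ) else 0) - (M.P i s).toReal| ≤ 1 := by
    intro s ω
    have h0 : 0 ≤ (M.P i s).toReal := ENNReal.toReal_nonneg
    have h1 : (M.P i s).toReal ≤ 1 :=
      ENNReal.toReal_le_of_le_ofReal zero_le_one (by simpa using (M.P i).coe_le_one s)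
    rw [abs_le]
    split_ifs <;> constructor <;> linarith
  have e : (fun ω => f ω (nxt (n + 1) i ω) - M.next (f ω) i)
      = fun ω => ∑ s, f ω s * ((if nxt (n + 1) i ω = s then (1 : ℝ) else 0)
          - (M.P i s).toReal) := by
    ext ω
    simp only [mul_sub, Finset.sum_sub_distrib, next]
    congr 1
    · simp
    · exact Finset.sum_congr rfl fun s _ => mul_comm _ _
  rw [e]
  refine IsCentered.sum (hM.history_le n) (fun s => (hbase s).mul (hf s) ⟨c, fun ω => hc ω s⟩)
    fun s => ?_
  refine integrable_of_abs_le (((hf s).mono (hM.history_le n) le_rfl).mul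
    ((hφm s).comp hpm)) (c := c * 1) fun ω => ?_
  rw [abs_mul]
  exact mul_le_mul (hc ω s) (hb s ω) (abs_nonneg _) ((abs_nonneg _).trans (hc ω s))

theorem measurable_bellmanNoise (t : ℕ) (i : S × A) :
    Measurable[history rew nxt t] fun ω => M.bellmanNoise rew nxt t ω i := by
  refine ((measurable_history_rew le_rfl i).sub_const _).add (Measurable.const_mul
    (Measurable.sub_const ?_ _) _)
  exact (measurable_of_finite M.optV).comp (measurable_history_nxt le_rfl i)

theorem rewardsInUnitInterval : M.RewardsInUnitInterval := by
  intro i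
  have h := (hM.model.law 0 i).map_eq
  have h2 : Measure.map (rew 0 i) μ = (M.R i : Measure ℝ) := by
    have e : rew 0 i = Prod.fst ∘ fun ω => (rew 0 i ω, nxt 0 i ω) := rfl
    rw [e, ← Measure.map_map measurable_fst
      ((hM.measurable_rew _ _).prodMk (hM.measurable_nxt _ _)), h, Measure.map_fst_prod]
    simp
  rw [← h2]
  refine (ae_map_iff (p := fun x => x ∈ Set.Icc (0 : ℝ) 1) (hM.measurable_rew 0 i).aemeasurable measurableSet_Icc).2 ?_
  exact Filter.Eventually.of_forall fun ω => hM.rew_mem 0 i ω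

theorem isCentered_bellmanNoise (n : ℕ) (i : S × A) :
    IsCentered (history rew nxt n) μ fun ω => M.bellmanNoise rew nxt (n + 1) ω i := by
  have hb : ∃ c, ∀ s, |M.optV s| ≤ c := by
    obtain ⟨c, hc⟩ := Finite.bddAbove_range fun s => |M.optV s|
    exact ⟨c, fun s => hc ⟨s, rfl⟩⟩
  obtain ⟨c, hc⟩ := hb
  have h1 := hM.isCentered_rew n i
  have h2 := (hM.isCentered_nxt n i (f := fun _ => M.optV) (fun s => measurable_const)
    (fun _ => hc)).const_mul M.γ
  rintro g hg ⟨b, hgb⟩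
  have hgm := (hg.mono (hM.history_le n) le_rfl).aestronglyMeasurable (μ := μ)
  have hi1 : Integrable (fun ω => g ω * (rew (n + 1) i ω - M.r i)) μ := by
    refine Integrable.bdd_mul ?_ hgm (Filter.Eventually.of_forall hgb)
    refine integrable_of_abs_le ((hM.measurable_rew _ _).sub_const _) (c := 1 + |M.r i|)
      fun ω => ?_
    have := hM.rew_mem (n + 1) i ω
    refine (abs_sub _ _).trans (add_le_add_left ?_ _)
    rw [abs_of_nonneg this.1]; exact this.2
  have hi2 : Integrable (fun ω => g ω * (M.γ * (M.optV (nxt (n + 1) i ω) - M.next M.optV i))) μ := by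
    refine Integrable.bdd_mul ?_ hgm (Filter.Eventually.of_forall hgb)
    refine Integrable.const_mul ?_ _
    refine integrable_of_abs_le (((measurable_of_finite M.optV).comp
      (hM.measurable_nxt _ _)).sub_const _) (c := c + c) fun ω => ?_
    exact (abs_sub _ _).trans (add_le_add (hc _) (M.abs_next_le hc i))
  have e := integral_add hi1 hi2
  rw [h1 g hg ⟨b, hgb⟩, h2 g hg ⟨b, hgb⟩, add_zero] at e
  rw [← e]
  refine integral_congr_ae (Filter.Eventually.of_forall fun ω => ?_)
  simp only [bellmanNoise, next]
  ring

variable {πs : S → PMF A} (hπ : M.IsOptimal πs)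
include hπ

/-- The reward part is at most `1` and `V^*` lies in `[0, h]`, which gives `1 + γ h = h`. -/
theorem abs_bellmanNoise_le (t : ℕ) (ω : Ω) (i : S × A) :
    |M.bellmanNoise rew nxt t ω i| ≤ M.horizon := by
  have hR := hM.rewardsInUnitInterval
  have h1 := hM.rew_mem t i ω
  have h2 := M.r_mem hR i
  have h3 := hπ.optV_mem hR (nxt t i ω)
  have h4 : 0 ≤ M.next M.optV i ∧ M.next M.optV i ≤ M.horizon :=
    ⟨(M.P i).le_sum_toReal_mul fun s _ => (hπ.optV_mem hR s).1,
      (M.P i).sum_toReal_mul_le fun s _ => (hπ.optV_mem hR s).2⟩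
  have hγ := M.γ_pos
  have h5 := M.one_add_γ_mul_horizon
  have e : M.bellmanNoise rew nxt t ω i
      = (rew t i ω - M.r i) + M.γ * (M.optV (nxt t i ω) - M.next M.optV i) := rfl
  rw [e, abs_le]
  have h6 : M.γ * (M.optV (nxt t i ω) - M.next M.optV i) ≤ M.γ * M.horizon :=
    mul_le_mul_of_nonneg_left (by linarith) hγ.le
  have h7 : M.γ * -M.horizon ≤ M.γ * (M.optV (nxt t i ω) - M.next M.optV i) :=
    mul_le_mul_of_nonneg_left (by linarith) hγ.le
  constructor <;> linarith

/-- `varZ` is defined through iteration `1`, but the observations have the same law in every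
iteration. -/
theorem integral_bellmanNoise_sq (t : ℕ) (i : S × A) :
    ∫ ω, M.bellmanNoise rew nxt t ω i ^ 2 ∂μ = M.varZ μ rew nxt i i := by
  have hφ : Measurable fun x : ℝ × S =>
      ((x.1 - M.r i) + M.γ * (M.optV x.2 - M.next M.optV i)) ^ 2 := by
    have : Measurable fun x : ℝ × S => M.optV x.2 :=
      (measurable_of_finite M.optV).comp measurable_snd
    exact ((measurable_fst.sub_const _).add ((this.sub_const _).const_mul _)).pow_const 2
  have h1 := hM.integral_comp t i hφ
  have h2 := hM.integral_comp 1 i hφ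
  simp only [varZ, Matrix.of_apply, ← sq]
  exact h1.trans h2.symm

theorem iIndepFun_bellmanNoise : iIndepFun
    (fun (p : ℕ × (S × A)) ω => M.bellmanNoise rew nxt p.1 ω p.2) μ := by
  have hφ : ∀ i : S × A, Measurable fun x : ℝ × S =>
      ((x.1 - M.r i) + M.γ * (M.optV x.2 - M.next M.optV i)) := fun i => by
    have : Measurable fun x : ℝ × S => M.optV x.2 :=
      (measurable_of_finite M.optV).comp measurable_snd
    exact (measurable_fst.sub_const _).add ((this.sub_const _).const_mul _)
  exact hM.model.indep.comp (fun p x => (x.1 - M.r p.2) + M.γ * (M.optV x.2 - M.next M.optV p.2))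
    fun p => hφ p.2

theorem integral_bellmanNoise (t : ℕ) (i : S × A) :
    ∫ ω, M.bellmanNoise rew nxt (t + 1) ω i ∂μ = 0 := by
  have := hM.isCentered_bellmanNoise t i (fun _ => 1) measurable_const ⟨1, by simp⟩
  simpa using this

/-- Independence across state-action pairs makes `Var(Z)` diagonal. This is what lets the variance
proxy of a coordinate of `G Z` be a diagonal entry of `Var_Q`. -/
theorem varZ_eq_zero {i j : S × A} (hij : i ≠ j) : M.varZ μ rew nxt i j = 0 := by
  have h := (hM.iIndepFun_bellmanNoise hπ).indepFun (i := (1, i)) (j := (1, j))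
    (by simpa using hij)
  have hm : ∀ i, AEStronglyMeasurable (fun ω => M.bellmanNoise rew nxt 1 ω i) μ := fun i =>
    ((hM.measurable_bellmanNoise 1 i).mono (hM.history_le 1) le_rfl).aestronglyMeasurable
  have h2 := h.integral_mul_eq_mul_integral (hm i) (hm j)
  simp only [Pi.mul_apply] at h2
  simp only [varZ, Matrix.of_apply]
  rw [h2, hM.integral_bellmanNoise hπ 0 i, zero_mul]

/-- Linear combinations of the Bellman noise have sub-exponential tails. -/
theorem integral_exp_sum_bellmanNoise_le (n : ℕ) (a : ℕ → S × A → ℝ) (l : ℝ)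
    (hl : ∀ j < n, ∀ k, |l * a j k| * M.horizon ≤ 1) :
    ∫ ω, Real.exp (l * ∑ j ∈ Finset.range n, ∑ k, a j k * M.bellmanNoise rew nxt (j + 1) ω k) ∂μ
      ≤ Real.exp (l ^ 2 * ∑ j ∈ Finset.range n, ∑ k, a j k ^ 2 * M.varZ μ rew nxt k k) := by
  have hind := (hM.iIndepFun_bellmanNoise hπ).precomp (g := fun p : ℕ × (S × A) => (p.1 + 1, p.2))
    (fun p q h => by
      simp only [Prod.mk.injEq] at h
      exact Prod.ext (by omega) h.2)
  have hind2 := hind.comp (fun p x => a p.1 p.2 * x) fun p => by fun_prop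
  have hmZ : ∀ t k, Measurable fun ω => M.bellmanNoise rew nxt t ω k := fun t k =>
    (hM.measurable_bellmanNoise t k).mono (hM.history_le t) le_rfl
  have hprod := hind2.mgf_sum (t := l) (fun p => (hmZ _ _).const_mul _)
    (Finset.range n ×ˢ Finset.univ)
  have e1 : ∫ ω, Real.exp (l * ∑ j ∈ Finset.range n, ∑ k,
      a j k * M.bellmanNoise rew nxt (j + 1) ω k) ∂μ
      = ∏ p ∈ Finset.range n ×ˢ Finset.univ,
        ∫ ω, Real.exp (l * (a p.1 p.2 * M.bellmanNoise rew nxt (p.1 + 1) ω p.2)) ∂μ := by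
    rw [mgf] at hprod
    refine Eq.trans ?_ hprod
    refine integral_congr_ae (Filter.Eventually.of_forall fun ω => ?_)
    simp only [Finset.sum_apply, Finset.sum_product, Function.comp]
  rw [e1, Finset.mul_sum, ]
  simp only [Finset.mul_sum]
  rw [← Finset.sum_product', Real.exp_sum]
  refine Finset.prod_le_prod (fun p _ => integral_nonneg fun ω => (Real.exp_pos _).le)
    fun p hp => ?_
  obtain ⟨j, k⟩ := p
  simp only [Finset.mem_product, Finset.mem_range, Finset.mem_univ, and_true] at hp
  simp only
  set c := l * a j k with hc
  have hZ1 : ∀ ω, |c * M.bellmanNoise rew nxt (j + 1) ω k| ≤ 1 := fun ω => by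
    rw [abs_mul]
    exact (mul_le_mul_of_nonneg_left (hM.abs_bellmanNoise_le hπ _ ω k) (abs_nonneg _)).trans
      (hl j hp k)
  have hZi : Integrable (fun ω => M.bellmanNoise rew nxt (j + 1) ω k) μ :=
    integrable_of_abs_le (hmZ _ _) fun ω => hM.abs_bellmanNoise_le hπ _ ω k
  have hZ2 : Integrable (fun ω => M.bellmanNoise rew nxt (j + 1) ω k ^ 2) μ :=
    integrable_of_abs_le ((hmZ _ _).pow_const 2) (c := M.horizon ^ 2) fun ω => by
      rw [abs_pow]
      exact pow_le_pow_left₀ (abs_nonneg _) (hM.abs_bellmanNoise_le hπ _ ω k) 2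
  calc ∫ ω, Real.exp (l * (a j k * M.bellmanNoise rew nxt (j + 1) ω k)) ∂μ
      ≤ ∫ ω, (1 + c * M.bellmanNoise rew nxt (j + 1) ω k
          + c ^ 2 * M.bellmanNoise rew nxt (j + 1) ω k ^ 2) ∂μ := by
        refine integral_mono (integrable_of_abs_le (((hmZ _ _).const_mul _).const_mul _).exp
          (c := Real.exp 1) fun ω => ?_)
          (((integrable_const _).add (hZi.const_mul _)).add (hZ2.const_mul _)) fun ω => ?_
        · rw [abs_of_pos (Real.exp_pos _), ← mul_assoc]
          exact Real.exp_le_exp.2 ((le_abs_self _).trans (hZ1 ω))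
        -- `e^x ≤ 1 + x + x²` for `|x| ≤ 1` retains the true variance; a bound through the range of
        -- the noise would lose it.
        · have := (abs_le.1 (Real.abs_exp_sub_one_sub_id_le (hZ1 ω))).2
          simp only
          rw [← mul_assoc]
          linarith
    _ = 1 + c ^ 2 * M.varZ μ rew nxt k k := by
        have e2 := integral_add ((integrable_const (1 : ℝ)).add (hZi.const_mul c))
          (hZ2.const_mul (c ^ 2))
        have e3 := integral_add (integrable_const (1 : ℝ)) (hZi.const_mul c)
        simp only [Pi.add_apply] at e2
        rw [e2, e3, integral_const_mul, integral_const_mul, hM.integral_bellmanNoise hπ,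
          hM.integral_bellmanNoise_sq hπ]
        simp
    _ ≤ _ := by
        have := Real.add_one_le_exp (c ^ 2 * M.varZ μ rew nxt k k)
        rw [hc, mul_pow] at this
        rw [hc, mul_pow, ← mul_assoc]
        linarith

end IsBoundedModel

end DiscountedMDP

/-! ### Error recursion and second moments -/

/-- The conditions on the step sizes under which averages of noise have variance `O(η_t)`. -/
structure IsStepSize (η : ℕ → ℝ) : Prop where
  zero : η 0 = 1
  pos : ∀ t, 0 < η t
  le_one : ∀ t, η t ≤ 1
  mul_le : ∀ t, (1 - η (t + 1)) * η t ≤ η (t + 1)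

namespace DiscountedMDP

variable {S A : Type*} [Fintype S] [Fintype A] [DecidableEq S] [DecidableEq A]
  [MeasurableSpace S] [MeasurableSingletonClass S] (M : DiscountedMDP S A)
  {Ω : Type*} [mΩ : MeasurableSpace Ω] {μ : Measure Ω} [IsProbabilityMeasure μ]
  (η : ℕ → ℝ) (Q₀ : S × A → ℝ) (rew : ℕ → S × A → Ω → ℝ) (nxt : ℕ → S × A → Ω → S)

/-- The error `Δ_t = Q_t - Q^*`. -/
noncomputable def qError (t : ℕ) (ω : Ω) : S × A → ℝ :=
  M.qLearning η Q₀ rew nxt t ω - M.optQ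

/-- The error `V_t - V^*` of the value function `V_t(s) = max_a Q_t(s, a)`. -/
noncomputable def valueError (t : ℕ) (ω : Ω) : S → ℝ :=
  greedyValue (M.qLearning η Q₀ rew nxt t ω) - M.optV

/-- The martingale difference `(P_{t+1} - P) (V_t - V^*)`. -/
noncomputable def transitionNoise (t : ℕ) (ω : Ω) (i : S × A) : ℝ :=
  M.valueError η Q₀ rew nxt t ω (nxt (t + 1) i ω) - M.next (M.valueError η Q₀ rew nxt t ω) i

/-- The weighted average of the noise: the recursion of `Q_t` without the contraction. -/
noncomputable def noiseAverage : ℕ → Ω → S × A → ℝ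
  | 0, _ => 0
  | t + 1, ω => fun i => (1 - η (t + 1)) * noiseAverage t ω i
      + η (t + 1) * (M.bellmanNoise rew nxt (t + 1) ω i
        + M.γ * M.transitionNoise η Q₀ rew nxt t ω i)

variable {M η Q₀ rew nxt} {πs : S → PMF A}

/-- Subtracts the Bellman equation of `Q^*` and splits the sampled target into noise unaffected by
the iterates, a martingale difference that shrinks with the error, and the drift. -/
theorem qError_succ (hπ : M.IsOptimal πs) (hR : M.RewardsInUnitInterval) (t : ℕ) (ω : Ω)
    (i : S × A) :
    M.qError η Q₀ rew nxt (t + 1) ω i = (1 - η (t + 1)) * M.qError η Q₀ rew nxt t ω i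
      + η (t + 1) * (M.bellmanNoise rew nxt (t + 1) ω i
        + M.γ * M.transitionNoise η Q₀ rew nxt t ω i
        + M.γ * M.next (M.valueError η Q₀ rew nxt t ω) i) := by
  have h := hπ.optQ_bellman hR i
  have hq : M.qLearning η Q₀ rew nxt (t + 1) ω i
      = (1 - η (t + 1)) * M.qLearning η Q₀ rew nxt t ω i + η (t + 1) * (rew (t + 1) i ω
        + M.γ * greedyValue (M.qLearning η Q₀ rew nxt t ω) (nxt (t + 1) i ω)) := rfl
  have hz : M.bellmanNoise rew nxt (t + 1) ω i = (rew (t + 1) i ω - M.r i)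
      + M.γ * (M.optV (nxt (t + 1) i ω) - M.next M.optV i) := rfl
  simp only [qError, Pi.sub_apply, transitionNoise, valueError, hq, hz]
  linear_combination (-η (t + 1)) * h

section Bounds

variable (hη : ∀ t, 0 ≤ η t ∧ η t ≤ 1) (hM : M.IsBoundedModel μ rew nxt) (hπ : M.IsOptimal πs)
  (hQ : ‖Q₀ - M.optQ‖ ≤ M.horizon)

include hη hM hπ hQ

/-- An invariant interval: if `|Q_t| ≤ 2h`, the sampled target is at most `1 + 2γh = 2h - 1`. It
feeds the uniform bounds `3h` on the error and `7h = h + 2·3h` on the noise. -/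
theorem abs_qLearning_le (t : ℕ) (ω : Ω) :
    ∀ i, |M.qLearning η Q₀ rew nxt t ω i| ≤ 2 * M.horizon := by
  have hR := hM.rewardsInUnitInterval
  induction t with
  | zero =>
    intro i
    have h1 := (norm_le_pi_norm (Q₀ - M.optQ) i).trans hQ
    rw [Pi.sub_apply, Real.norm_eq_abs, abs_le] at h1
    have h2 := hπ.optQ_mem hR i
    have := M.horizon_pos
    simp only [qLearning]
    rw [abs_le]
    constructor <;> linarith
  | succ t ih =>
    intro i
    have : Nonempty A := ⟨i.2⟩
    have hq : M.qLearning η Q₀ rew nxt (t + 1) ω i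
        = (1 - η (t + 1)) * M.qLearning η Q₀ rew nxt t ω i + η (t + 1) * (rew (t + 1) i ω
          + M.γ * greedyValue (M.qLearning η Q₀ rew nxt t ω) (nxt (t + 1) i ω)) := rfl
    have hg : |greedyValue (M.qLearning η Q₀ rew nxt t ω) (nxt (t + 1) i ω)| ≤ 2 * M.horizon := by
      have := abs_greedyValue_sub_le (Q := M.qLearning η Q₀ rew nxt t ω) (Q' := 0)
        (c := 2 * M.horizon) (by simpa using ih) (nxt (t + 1) i ω)
      simpa [greedyValue] using this
    obtain ⟨h0, h1⟩ := hη (t + 1)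
    have hr := hM.rew_mem (t + 1) i ω
    have e := M.one_add_γ_mul_horizon
    have hh := M.one_le_horizon
    have hin : |rew (t + 1) i ω
        + M.γ * greedyValue (M.qLearning η Q₀ rew nxt t ω) (nxt (t + 1) i ω)|
        ≤ 2 * M.horizon := by
      refine (abs_add_le _ _).trans ?_
      rw [abs_mul, abs_of_pos M.γ_pos, abs_of_nonneg hr.1]
      have := mul_le_mul_of_nonneg_left hg M.γ_pos.le
      linarith
    rw [hq]
    refine (abs_add_le _ _).trans ?_
    rw [abs_mul, abs_mul, abs_of_nonneg h0, abs_of_nonneg (by linarith : 0 ≤ 1 - η (t + 1))]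
    have := mul_le_mul_of_nonneg_left (ih i) (by linarith : 0 ≤ 1 - η (t + 1))
    have := mul_le_mul_of_nonneg_left hin h0
    linarith

theorem abs_qError_le (t : ℕ) (ω : Ω) (i : S × A) :
    |M.qError η Q₀ rew nxt t ω i| ≤ 3 * M.horizon := by
  have h1 := abs_qLearning_le hη hM hπ hQ t ω i
  have h2 := hπ.optQ_mem hM.rewardsInUnitInterval i
  rw [abs_le] at h1
  simp only [qError, Pi.sub_apply]
  rw [abs_le]
  have := M.horizon_pos
  constructor <;> linarith

theorem norm_qError_le (t : ℕ) (ω : Ω) : ‖M.qError η Q₀ rew nxt t ω‖ ≤ 3 * M.horizon :=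
  (pi_norm_le_iff_of_nonneg (by have := M.horizon_pos; linarith)).2
    (abs_qError_le hη hM hπ hQ t ω)

omit hη hQ

theorem abs_valueError_le [Nonempty A] (t : ℕ) (ω : Ω) (s : S) :
    |M.valueError η Q₀ rew nxt t ω s| ≤ ‖M.qError η Q₀ rew nxt t ω‖ := by
  have h := hπ.greedyValue_eq hM.rewardsInUnitInterval
  simp only [valueError, ← h, Pi.sub_apply]
  exact abs_greedyValue_sub_le (fun i => norm_le_pi_norm (M.qError η Q₀ rew nxt t ω) i) s

theorem abs_next_valueError_le (t : ℕ) (ω : Ω) (i : S × A) :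
    |M.next (M.valueError η Q₀ rew nxt t ω) i| ≤ ‖M.qError η Q₀ rew nxt t ω‖ :=
  have : Nonempty A := ⟨i.2⟩
  M.abs_next_le (abs_valueError_le hM hπ t ω) i

theorem abs_transitionNoise_le (t : ℕ) (ω : Ω) (i : S × A) :
    |M.transitionNoise η Q₀ rew nxt t ω i| ≤ 2 * ‖M.qError η Q₀ rew nxt t ω‖ := by
  have : Nonempty A := ⟨i.2⟩
  refine (abs_sub _ _).trans ?_
  rw [two_mul]
  exact add_le_add (abs_valueError_le hM hπ _ _ _) (abs_next_valueError_le hM hπ _ _ _)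

omit hM hπ

theorem measurable_qError (t : ℕ) (i : S × A) :
    Measurable[history rew nxt t] fun ω => M.qError η Q₀ rew nxt t ω i :=
  (measurable_qLearning η Q₀ t i).sub_const _

theorem measurable_valueError (t : ℕ) (s : S) :
    Measurable[history rew nxt t] fun ω => M.valueError η Q₀ rew nxt t ω s :=
  (measurable_greedyValue (measurable_qLearning η Q₀ t) s).sub_const _

theorem measurable_transitionNoise (t : ℕ) (i : S × A) :
    Measurable[history rew nxt (t + 1)] fun ω => M.transitionNoise η Q₀ rew nxt t ω i := by
  have h : ∀ s, Measurable[history rew nxt (t + 1)] fun ω => M.valueError η Q₀ rew nxt t ω s :=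
    fun s => (measurable_valueError t s).mono (history_mono t.le_succ) le_rfl
  exact (Measurable.eval_of_finite h (measurable_history_nxt le_rfl i)).sub (measurable_next h i)

include hM

theorem measurable_noiseAverage (t : ℕ) :
    ∀ i, Measurable[history rew nxt t] fun ω => M.noiseAverage η Q₀ rew nxt t ω i := by
  induction t with
  | zero => intro i; exact measurable_const
  | succ t ih =>
    intro i
    have h := (ih i).mono (history_mono (rew := rew) (nxt := nxt) t.le_succ) le_rfl
    exact (h.const_mul _).add (((hM.measurable_bellmanNoise (t + 1) i).add
      ((measurable_transitionNoise t i).const_mul _)).const_mul _)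

include hη hπ hQ

theorem isCentered_transitionNoise (t : ℕ) (i : S × A) :
    IsCentered (history rew nxt t) μ fun ω => M.transitionNoise η Q₀ rew nxt t ω i := by
  have : Nonempty A := ⟨i.2⟩
  exact hM.isCentered_nxt t i (measurable_valueError t) (c := 3 * M.horizon) fun ω s =>
    (abs_valueError_le hM hπ t ω s).trans (norm_qError_le hη hM hπ hQ t ω)

theorem abs_noise_le (t : ℕ) (ω : Ω) (i : S × A) :
    |M.bellmanNoise rew nxt (t + 1) ω i + M.γ * M.transitionNoise η Q₀ rew nxt t ω i|
      ≤ 7 * M.horizon := by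
  refine (abs_add_le _ _).trans ?_
  have h1 := hM.abs_bellmanNoise_le hπ (t + 1) ω i
  have h2 := abs_transitionNoise_le (η := η) (Q₀ := Q₀) hM hπ t ω i
  have h3 := norm_qError_le hη hM hπ hQ t ω
  rw [abs_mul, abs_of_pos M.γ_pos]
  have : M.γ * |M.transitionNoise η Q₀ rew nxt t ω i| ≤ |M.transitionNoise η Q₀ rew nxt t ω i| :=
    mul_le_of_le_one_left (abs_nonneg _) M.γ_lt_one.le
  linarith

theorem abs_noiseAverage_le (t : ℕ) (ω : Ω) :
    ∀ i, |M.noiseAverage η Q₀ rew nxt t ω i| ≤ 7 * M.horizon := by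
  induction t with
  | zero =>
    intro i
    have := M.horizon_pos
    simp only [noiseAverage, Pi.zero_apply, abs_zero]
    linarith
  | succ t ih =>
    intro i
    obtain ⟨h0, h1⟩ := hη (t + 1)
    simp only [noiseAverage]
    refine (abs_add_le _ _).trans ?_
    rw [abs_mul, abs_mul, abs_of_nonneg h0, abs_of_nonneg (by linarith : 0 ≤ 1 - η (t + 1))]
    have := mul_le_mul_of_nonneg_left (ih i) (by linarith : 0 ≤ 1 - η (t + 1))
    have := mul_le_mul_of_nonneg_left (abs_noise_le hη hM hπ hQ t ω i) h0
    linarith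

theorem isCentered_noise (t : ℕ) (i : S × A) :
    IsCentered (history rew nxt t) μ fun ω =>
      M.bellmanNoise rew nxt (t + 1) ω i + M.γ * M.transitionNoise η Q₀ rew nxt t ω i := by
  have h1 := hM.isCentered_bellmanNoise t i
  have h2 := (isCentered_transitionNoise hη hM hπ hQ t i).const_mul M.γ
  have := IsCentered.sum (F := history rew nxt t) (μ := μ) (κ := Bool)
    (X := fun b ω => if b then M.bellmanNoise rew nxt (t + 1) ω i
      else M.γ * M.transitionNoise η Q₀ rew nxt t ω i) (hM.history_le t)
    (by rintro (_ | _); exacts [by simpa using h2, by simpa using h1])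
    (by
      rintro (_ | _)
      · simp only [Bool.false_eq_true, if_false]
        refine Integrable.const_mul (integrable_of_abs_le
          ((measurable_transitionNoise t i).mono (hM.history_le _) le_rfl)
          (c := 2 * (3 * M.horizon)) fun ω => ?_) _
        have h3 := norm_qError_le hη hM hπ hQ t ω
        linarith [abs_transitionNoise_le (η := η) (Q₀ := Q₀) hM hπ t ω i]
      · simp only [if_true]
        exact integrable_of_abs_le ((hM.measurable_bellmanNoise (t + 1) i).mono
          (hM.history_le _) le_rfl) fun ω => hM.abs_bellmanNoise_le hπ (t + 1) ω i)
  simpa using this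

end Bounds

section SecondMoment

variable (hη : IsStepSize η) (hM : M.IsBoundedModel μ rew nxt) (hπ : M.IsOptimal πs)
  (hQ : ‖Q₀ - M.optQ‖ ≤ M.horizon)

include hη hM hπ hQ

/-- A step multiplies the variance proxy by `(1 - η_{t+1})²` and adds `(7h η_{t+1})²`; the step-size
condition makes `49 h² η_t` stable under this. -/
theorem integral_exp_noiseAverage_le (t : ℕ) : ∀ (l : ℝ) (i : S × A),
    ∫ ω, Real.exp (l * M.noiseAverage η Q₀ rew nxt t ω i) ∂μ
      ≤ Real.exp (l ^ 2 * (49 * M.horizon ^ 2 * η t)) := by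
  have hη' : ∀ t, 0 ≤ η t ∧ η t ≤ 1 := fun t => ⟨(hη.pos t).le, hη.le_one t⟩
  induction t with
  | zero =>
    intro l i
    have := hη.pos 0
    simp only [noiseAverage, Pi.zero_apply, mul_zero, Real.exp_zero, integral_const,
      probReal_univ, smul_eq_mul, mul_one]
    exact Real.one_le_exp (by positivity)
  | succ t ih =>
    intro l i
    obtain ⟨h0, h1⟩ := hη' (t + 1)
    have hh := M.horizon_pos
    have hNm := measurable_noiseAverage (η := η) (Q₀ := Q₀) hM t i
    have hm : Measurable fun ω =>
        M.bellmanNoise rew nxt (t + 1) ω i + M.γ * M.transitionNoise η Q₀ rew nxt t ω i :=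
      ((hM.measurable_bellmanNoise (t + 1) i).add
        ((measurable_transitionNoise t i).const_mul _)).mono (hM.history_le _) le_rfl
    have key := ((isCentered_noise hη' hM hπ hQ t i).const_mul
      (l * η (t + 1))).integral_mul_exp_le (c := |l| * η (t + 1) * (7 * M.horizon))
      (g := fun ω => Real.exp (l * (1 - η (t + 1)) * M.noiseAverage η Q₀ rew nxt t ω i))
      (b := Real.exp (|l * (1 - η (t + 1))| * (7 * M.horizon)))
      (hM.history_le t) (hm.const_mul _) (fun ω => by
        rw [abs_mul, abs_mul, abs_of_nonneg h0]
        exact mul_le_mul_of_nonneg_left (abs_noise_le hη' hM hπ hQ t ω i) (by positivity))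
      (hNm.const_mul _).exp (fun ω => by
        rw [abs_of_pos (Real.exp_pos _)]
        refine Real.exp_le_exp.2 ((le_abs_self _).trans ?_)
        rw [abs_mul]
        exact mul_le_mul_of_nonneg_left (abs_noiseAverage_le hη' hM hπ hQ t ω i) (abs_nonneg _))
      fun ω => (Real.exp_pos _).le
    have e : ∀ ω, Real.exp (l * M.noiseAverage η Q₀ rew nxt (t + 1) ω i)
        = Real.exp (l * (1 - η (t + 1)) * M.noiseAverage η Q₀ rew nxt t ω i)
          * Real.exp (l * η (t + 1) * (M.bellmanNoise rew nxt (t + 1) ω i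
            + M.γ * M.transitionNoise η Q₀ rew nxt t ω i)) := fun ω => by
      rw [← Real.exp_add]
      congr 1
      simp only [noiseAverage]
      ring
    simp only [e]
    refine key.trans ((mul_le_mul_of_nonneg_left (ih _ i) (Real.exp_pos _).le).trans ?_)
    rw [← Real.exp_add]
    refine Real.exp_le_exp.2 ?_
    -- With `η = η_{t+1}`: `(1-η)² η_t + η² ≤ (1-η) η + η² = η`.
    have h3 : (1 - η (t + 1)) * ((1 - η (t + 1)) * η t) ≤ (1 - η (t + 1)) * η (t + 1) :=
      mul_le_mul_of_nonneg_left (hη.mul_le t) (by linarith)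
    have h4 : 0 ≤ 49 * l ^ 2 * M.horizon ^ 2 := by positivity
    have h5 := mul_le_mul_of_nonneg_left h3 h4
    have h6 : |l| ^ 2 = l ^ 2 := sq_abs l
    calc (|l| * η (t + 1) * (7 * M.horizon)) ^ 2
          + (l * (1 - η (t + 1))) ^ 2 * (49 * M.horizon ^ 2 * η t)
        = 49 * |l| ^ 2 * M.horizon ^ 2 * η (t + 1) ^ 2 + 49 * l ^ 2 * M.horizon ^ 2
          * ((1 - η (t + 1)) * ((1 - η (t + 1)) * η t)) := by ring
      _ ≤ 49 * l ^ 2 * M.horizon ^ 2 * η (t + 1) ^ 2 + 49 * l ^ 2 * M.horizon ^ 2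
          * ((1 - η (t + 1)) * η (t + 1)) := by rw [h6]; linarith
      _ = _ := by ring

theorem integral_norm_noiseAverage_sq_le (hD : 2 ≤ Fintype.card (S × A)) (t : ℕ) :
    ∫ ω, ‖M.noiseAverage η Q₀ rew nxt t ω‖ ^ 2 ∂μ
      ≤ 490 * Real.log (2 * Fintype.card (S × A)) * M.horizon ^ 2 * η t := by
  have hη' : ∀ t, 0 ≤ η t ∧ η t ≤ 1 := fun t => ⟨(hη.pos t).le, hη.le_one t⟩
  have : Nonempty (S × A) := Fintype.card_pos_iff.1 (by omega)
  have := integral_norm_sq_le_of_subgaussian (μ := μ) hD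
    (fun i => (measurable_noiseAverage (η := η) (Q₀ := Q₀) hM t i).mono (hM.history_le t) le_rfl)
    (abs_noiseAverage_le hη' hM hπ hQ t) (v := 49 * M.horizon ^ 2 * η t)
    (by have := hη.pos t; have := M.horizon_pos; positivity)
    (fun l i => integral_exp_noiseAverage_le hη hM hπ hQ t l i)
  linarith

/-- The recursion for the distance between the error and the averaged noise. -/
theorem integral_norm_sub_noiseAverage_sq_le (hD : 2 ≤ Fintype.card (S × A)) (t : ℕ) :
    ∫ ω, ‖M.qError η Q₀ rew nxt (t + 1) ω - M.noiseAverage η Q₀ rew nxt (t + 1) ω‖ ^ 2 ∂μ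
      ≤ (1 - (1 - M.γ) * η (t + 1))
          * ∫ ω, ‖M.qError η Q₀ rew nxt t ω - M.noiseAverage η Q₀ rew nxt t ω‖ ^ 2 ∂μ
        + (1 - M.γ) * η (t + 1)
          * (490 * Real.log (2 * Fintype.card (S × A)) * M.horizon ^ 4 * η t) := by
  have hη' : ∀ t, 0 ≤ η t ∧ η t ≤ 1 := fun t => ⟨(hη.pos t).le, hη.le_one t⟩
  have : Nonempty (S × A) := Fintype.card_pos_iff.1 (by omega)
  obtain ⟨h0, h1⟩ := hη' (t + 1)
  have hγ0 := M.γ_pos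
  have hγ := M.one_sub_γ_pos
  have hh := M.horizon_pos
  have hNm : ∀ t i, Measurable fun ω => M.noiseAverage η Q₀ rew nxt t ω i := fun t i =>
    (measurable_noiseAverage (η := η) (Q₀ := Q₀) hM t i).mono (hM.history_le t) le_rfl
  have hΔm : ∀ t i, Measurable fun ω => M.qError η Q₀ rew nxt t ω i := fun t i =>
    (measurable_qError t i).mono (hM.history_le t) le_rfl
  have hNb : ∀ t ω, ‖M.noiseAverage η Q₀ rew nxt t ω‖ ≤ 7 * M.horizon := fun t ω => by
    rw [pi_norm_le_iff_of_nonempty]; exact abs_noiseAverage_le hη' hM hπ hQ t ω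
  have hYi : ∀ t, Integrable (fun ω =>
      ‖M.qError η Q₀ rew nxt t ω - M.noiseAverage η Q₀ rew nxt t ω‖ ^ 2) μ := fun t =>
    integrable_of_abs_le ((measurable_norm_pi fun i => (hΔm t i).sub (hNm t i)).pow_const 2)
      (c := (3 * M.horizon + 7 * M.horizon) ^ 2) fun ω => by
        rw [abs_of_nonneg (sq_nonneg _)]
        exact pow_le_pow_left₀ (norm_nonneg _) ((norm_sub_le _ _).trans
          (add_le_add (norm_qError_le hη' hM hπ hQ t ω) (hNb t ω))) 2
  have hNi : Integrable (fun ω => ‖M.noiseAverage η Q₀ rew nxt t ω‖ ^ 2) μ :=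
    integrable_of_abs_le ((measurable_norm_pi (hNm t)).pow_const 2)
      (c := (7 * M.horizon) ^ 2) fun ω => by
        rw [abs_of_nonneg (sq_nonneg _)]
        exact pow_le_pow_left₀ (norm_nonneg _) (hNb t ω) 2
  set x := (1 - M.γ) * η (t + 1) with hx
  have hx0 : 0 ≤ x := mul_nonneg hγ.le h0
  have hx1 : x ≤ 1 := mul_le_one₀ (by linarith) h0 h1
  have hxh : M.horizon * x = η (t + 1) := by
    rw [hx, ← mul_assoc, M.horizon_mul, one_mul]
  have pointwise : ∀ ω,
      ‖M.qError η Q₀ rew nxt (t + 1) ω - M.noiseAverage η Q₀ rew nxt (t + 1) ω‖ ^ 2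
      ≤ (1 - x) * ‖M.qError η Q₀ rew nxt t ω - M.noiseAverage η Q₀ rew nxt t ω‖ ^ 2
        + x * M.horizon ^ 2 * ‖M.noiseAverage η Q₀ rew nxt t ω‖ ^ 2 := by
    intro ω
    set y := ‖M.qError η Q₀ rew nxt t ω - M.noiseAverage η Q₀ rew nxt t ω‖ with hy
    set z := ‖M.noiseAverage η Q₀ rew nxt t ω‖ with hz
    have hy0 : 0 ≤ y := norm_nonneg _
    have hz0 : 0 ≤ z := norm_nonneg _
    have hΔ : ‖M.qError η Q₀ rew nxt t ω‖ ≤ y + z := by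
      have := norm_add_le (M.qError η Q₀ rew nxt t ω - M.noiseAverage η Q₀ rew nxt t ω)
        (M.noiseAverage η Q₀ rew nxt t ω)
      rwa [sub_add_cancel] at this
    -- The step is bounded by a convex combination of `y` and `h z` with weight `x = (1-γ) η_{t+1}`;
    -- since `h x = η_{t+1}`, the factor `h` makes room for the whole forcing.
    have hstep : ‖M.qError η Q₀ rew nxt (t + 1) ω - M.noiseAverage η Q₀ rew nxt (t + 1) ω‖
        ≤ (1 - x) * y + x * (M.horizon * z) := by
      rw [pi_norm_le_iff_of_nonempty]
      intro i
      have e : (M.qError η Q₀ rew nxt (t + 1) ω - M.noiseAverage η Q₀ rew nxt (t + 1) ω) i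
          = (1 - η (t + 1)) * (M.qError η Q₀ rew nxt t ω - M.noiseAverage η Q₀ rew nxt t ω) i
            + η (t + 1) * (M.γ * M.next (M.valueError η Q₀ rew nxt t ω) i) := by
        rw [Pi.sub_apply, qError_succ hπ hM.rewardsInUnitInterval]
        simp only [noiseAverage, Pi.sub_apply]
        ring
      rw [e, Real.norm_eq_abs]
      refine (abs_add_le _ _).trans ?_
      rw [abs_mul, abs_mul, abs_mul, abs_of_nonneg h0, abs_of_pos hγ0,
        abs_of_nonneg (by linarith : 0 ≤ 1 - η (t + 1))]
      have i1 : (1 - η (t + 1)) * |(M.qError η Q₀ rew nxt t ω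
          - M.noiseAverage η Q₀ rew nxt t ω) i| ≤ (1 - η (t + 1)) * y :=
        mul_le_mul_of_nonneg_left (norm_le_pi_norm (M.qError η Q₀ rew nxt t ω
          - M.noiseAverage η Q₀ rew nxt t ω) i) (by linarith)
      have i2 : η (t + 1) * (M.γ * |M.next (M.valueError η Q₀ rew nxt t ω) i|)
          ≤ η (t + 1) * (M.γ * (y + z)) := by
        have := (abs_next_valueError_le (η := η) (Q₀ := Q₀) hM hπ t ω i).trans hΔ
        gcongr
      have i3 : η (t + 1) * M.γ * z ≤ η (t + 1) * z := by
        refine mul_le_mul_of_nonneg_right ?_ hz0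
        exact mul_le_of_le_one_right h0 M.γ_lt_one.le
      have i4 : x * (M.horizon * z) = η (t + 1) * z := by rw [← hxh]; ring
      rw [i4]
      have i5 : (1 - x) * y = (1 - η (t + 1)) * y + η (t + 1) * M.γ * y := by rw [hx]; ring
      linarith
    refine (pow_le_pow_left₀ (norm_nonneg _) hstep 2).trans ?_
    -- Convexity of the square, with defect `x (1-x) (y - h z)²`.
    have := mul_nonneg (mul_nonneg hx0 (by linarith : 0 ≤ 1 - x)) (sq_nonneg (y - M.horizon * z))
    nlinarith
  calc _ ≤ ∫ ω, ((1 - x) * ‖M.qError η Q₀ rew nxt t ω - M.noiseAverage η Q₀ rew nxt t ω‖ ^ 2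
        + x * M.horizon ^ 2 * ‖M.noiseAverage η Q₀ rew nxt t ω‖ ^ 2) ∂μ :=
        integral_mono (hYi (t + 1)) (((hYi t).const_mul _).add (hNi.const_mul _)) pointwise
    _ = (1 - x) * ∫ ω, ‖M.qError η Q₀ rew nxt t ω - M.noiseAverage η Q₀ rew nxt t ω‖ ^ 2 ∂μ
        + x * M.horizon ^ 2 * ∫ ω, ‖M.noiseAverage η Q₀ rew nxt t ω‖ ^ 2 ∂μ := by
        rw [integral_add ((hYi t).const_mul _) (hNi.const_mul _), integral_const_mul,
          integral_const_mul]
    _ ≤ _ := by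
        have h := integral_norm_noiseAverage_sq_le hη hM hπ hQ hD t
        have := mul_le_mul_of_nonneg_left h (by positivity : 0 ≤ x * M.horizon ^ 2)
        linarith

theorem integral_norm_sub_noiseAverage_sq_zero_le :
    ∫ ω, ‖M.qError η Q₀ rew nxt 0 ω - M.noiseAverage η Q₀ rew nxt 0 ω‖ ^ 2 ∂μ
      ≤ M.horizon ^ 2 := by
  have e : ∀ ω, ‖M.qError η Q₀ rew nxt 0 ω - M.noiseAverage η Q₀ rew nxt 0 ω‖
      = ‖Q₀ - M.optQ‖ := fun ω => by simp [qError, qLearning, noiseAverage]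
  simp only [e, integral_const, probReal_univ, smul_eq_mul, one_mul]
  exact pow_le_pow_left₀ (norm_nonneg _) hQ 2

/-- A bound of the second moment of the error by that of its distance to the averaged noise. -/
theorem integral_norm_qError_sq_le (hD : 2 ≤ Fintype.card (S × A)) (t : ℕ) :
    ∫ ω, ‖M.qError η Q₀ rew nxt t ω‖ ^ 2 ∂μ
      ≤ 2 * ∫ ω, ‖M.qError η Q₀ rew nxt t ω - M.noiseAverage η Q₀ rew nxt t ω‖ ^ 2 ∂μ
        + 980 * Real.log (2 * Fintype.card (S × A)) * M.horizon ^ 2 * η t := by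
  have hη' : ∀ t, 0 ≤ η t ∧ η t ≤ 1 := fun t => ⟨(hη.pos t).le, hη.le_one t⟩
  have : Nonempty (S × A) := Fintype.card_pos_iff.1 (by omega)
  have hNm : ∀ t i, Measurable fun ω => M.noiseAverage η Q₀ rew nxt t ω i := fun t i =>
    (measurable_noiseAverage (η := η) (Q₀ := Q₀) hM t i).mono (hM.history_le t) le_rfl
  have hΔm : ∀ t i, Measurable fun ω => M.qError η Q₀ rew nxt t ω i := fun t i =>
    (measurable_qError t i).mono (hM.history_le t) le_rfl
  have hNb : ∀ t ω, ‖M.noiseAverage η Q₀ rew nxt t ω‖ ≤ 7 * M.horizon := fun t ω => by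
    rw [pi_norm_le_iff_of_nonempty]; exact abs_noiseAverage_le hη' hM hπ hQ t ω
  have hΔb := norm_qError_le hη' hM hπ hQ
  have hi : ∀ {f : Ω → S × A → ℝ} {c : ℝ}, (∀ i, Measurable fun ω => f ω i) →
      (∀ ω, ‖f ω‖ ≤ c) → Integrable (fun ω => ‖f ω‖ ^ 2) μ := fun {f c} hf hc =>
    integrable_of_abs_le ((measurable_norm_pi hf).pow_const 2) (c := c ^ 2) fun ω => by
      rw [abs_of_nonneg (sq_nonneg _)]
      exact pow_le_pow_left₀ (norm_nonneg _) (hc ω) 2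
  have hYi := hi (f := fun ω => M.qError η Q₀ rew nxt t ω - M.noiseAverage η Q₀ rew nxt t ω)
    (fun i => (hΔm t i).sub (hNm t i)) fun ω => (norm_sub_le _ _).trans
      (add_le_add (hΔb t ω) (hNb t ω))
  have hNi := hi (hNm t) (hNb t)
  calc ∫ ω, ‖M.qError η Q₀ rew nxt t ω‖ ^ 2 ∂μ
      ≤ ∫ ω, (2 * ‖M.qError η Q₀ rew nxt t ω - M.noiseAverage η Q₀ rew nxt t ω‖ ^ 2
          + 2 * ‖M.noiseAverage η Q₀ rew nxt t ω‖ ^ 2) ∂μ := by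
        refine integral_mono (hi (hΔm t) (hΔb t))
          ((hYi.const_mul 2).add (hNi.const_mul 2)) fun ω => ?_
        have h := norm_add_le (M.qError η Q₀ rew nxt t ω - M.noiseAverage η Q₀ rew nxt t ω)
          (M.noiseAverage η Q₀ rew nxt t ω)
        rw [sub_add_cancel] at h
        have h2 := pow_le_pow_left₀ (norm_nonneg _) h 2
        simp only
        nlinarith [sq_nonneg (‖M.qError η Q₀ rew nxt t ω - M.noiseAverage η Q₀ rew nxt t ω‖
          - ‖M.noiseAverage η Q₀ rew nxt t ω‖)]
    _ = _ := by rw [integral_add (hYi.const_mul 2) (hNi.const_mul 2), integral_const_mul,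
          integral_const_mul]
    _ ≤ _ := by
        have h := integral_norm_noiseAverage_sq_le hη hM hπ hQ hD t
        linarith

end SecondMoment

end DiscountedMDP

/-! ### Resolvent, weighted noise sums and the linearized recursion -/

namespace DiscountedMDP

variable {S A : Type*} [Fintype S] [Fintype A] [DecidableEq S] [DecidableEq A]

section Resolvent

variable (M : DiscountedMDP S A) (π : S → PMF A)

/-- The resolvent `(I - γ P^π)⁻¹`. -/
noncomputable def resolvent : Matrix (S × A) (S × A) ℝ := (1 - M.γ • M.transition π)⁻¹

/-- `P^π` does not expand the maximum norm, so `‖x‖ ≤ ‖(I - γP^π)x‖ + γ‖x‖`. This one estimate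
yields both invertibility and the norm of the resolvent, without a Neumann series. -/
theorem norm_le_of_sub_transition {x : S × A → ℝ} :
    ‖x‖ ≤ M.horizon * ‖(1 - M.γ • M.transition π).mulVec x‖ := by
  have h1 : ‖(M.transition π).mulVec x‖ ≤ ‖x‖ :=
    (pi_norm_le_iff_of_nonneg (norm_nonneg _)).2
      (M.abs_transition_mulVec_le π fun i => norm_le_pi_norm x i)
  have e : x = (1 - M.γ • M.transition π).mulVec x + M.γ • (M.transition π).mulVec x := by
    rw [Matrix.sub_mulVec, Matrix.one_mulVec, Matrix.smul_mulVec, sub_add_cancel]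
  have h2 : ‖x‖ ≤ ‖(1 - M.γ • M.transition π).mulVec x‖ + M.γ * ‖x‖ := by
    conv_lhs => rw [e]
    refine (norm_add_le _ _).trans (add_le_add le_rfl ?_)
    rw [norm_smul, Real.norm_eq_abs, abs_of_pos M.γ_pos]
    exact mul_le_mul_of_nonneg_left h1 M.γ_pos.le
  have h3 := mul_le_mul_of_nonneg_left h2 M.horizon_pos.le
  have h4 : M.horizon * (1 - M.γ) * ‖x‖ = ‖x‖ := by rw [M.horizon_mul, one_mul]
  linarith

theorem isUnit_sub_transition : IsUnit (1 - M.γ • M.transition π) := by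
  rw [← Matrix.mulVec_injective_iff_isUnit]
  intro x y hxy
  have h : (1 - M.γ • M.transition π).mulVec (x - y) = 0 := by
    rw [Matrix.mulVec_sub]; exact sub_eq_zero.2 hxy
  have h2 := M.norm_le_of_sub_transition π (x := x - y)
  rw [h, norm_zero, mul_zero] at h2
  exact sub_eq_zero.1 (norm_le_zero_iff.1 h2)

theorem resolvent_mulVec_sub_transition (x : S × A → ℝ) :
    (M.resolvent π).mulVec ((1 - M.γ • M.transition π).mulVec x) = x := by
  rw [Matrix.mulVec_mulVec, resolvent, Matrix.nonsing_inv_mul _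
    ((Matrix.isUnit_iff_isUnit_det _).1 (M.isUnit_sub_transition π)), Matrix.one_mulVec]

theorem norm_resolvent_mulVec_le (x : S × A → ℝ) :
    ‖(M.resolvent π).mulVec x‖ ≤ M.horizon * ‖x‖ := by
  have h := M.norm_le_of_sub_transition π (x := (M.resolvent π).mulVec x)
  rwa [Matrix.mulVec_mulVec, resolvent, Matrix.mul_nonsing_inv _
    ((Matrix.isUnit_iff_isUnit_det _).1 (M.isUnit_sub_transition π)), Matrix.one_mulVec] at h

end Resolvent

theorem _root_.Matrix.abs_apply_le_of_norm_mulVec_le {ι : Type*} [Fintype ι] [DecidableEq ι]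
    {B : Matrix ι ι ℝ} {β : ℝ} (h : ∀ x, ‖B.mulVec x‖ ≤ β * ‖x‖) (i k : ι) : |B i k| ≤ β := by
  have : Nonempty ι := ⟨i⟩
  have h1 := (norm_le_pi_norm _ i).trans (h (Pi.single k 1))
  rw [Matrix.mulVec_single_one, Pi.norm_single, norm_one, mul_one] at h1
  exact h1

variable [MeasurableSpace S] [MeasurableSingletonClass S] {M : DiscountedMDP S A}
  {Ω : Type*} [mΩ : MeasurableSpace Ω] {μ : Measure Ω} [IsProbabilityMeasure μ]
  {η : ℕ → ℝ} {Q₀ : S × A → ℝ} {rew : ℕ → S × A → Ω → ℝ} {nxt : ℕ → S × A → Ω → S}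
  {πs : S → PMF A}

/-- Bernstein form: the coordinatewise variance bound `v` sits under the leading root, while the
range `b` of a single term enters only linearly and without a factor `n`. -/
theorem integral_norm_sum_bellmanNoise_le (hM : M.IsBoundedModel μ rew nxt)
    (hπ : M.IsOptimal πs) (hD : 2 ≤ Fintype.card (S × A)) (n : ℕ)
    (B : ℕ → Matrix (S × A) (S × A) ℝ) {v b : ℝ} (hb : 0 < b) (hv : 0 ≤ v)
    (hBb : ∀ j < n, ∀ i k, |B j i k| * M.horizon ≤ b)
    (hBv : ∀ i, ∑ j ∈ Finset.range n, ∑ k, B j i k ^ 2 * M.varZ μ rew nxt k k ≤ v) :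
    ∫ ω, ‖∑ j ∈ Finset.range n, (B j).mulVec (M.bellmanNoise rew nxt (j + 1) ω)‖ ∂μ
      ≤ 3 * √(v * Real.log (2 * Fintype.card (S × A)))
        + 2 * b * Real.log (2 * Fintype.card (S × A)) := by
  have : Nonempty (S × A) := Fintype.card_pos_iff.1 (by omega)
  have hmZ : ∀ t k, Measurable fun ω => M.bellmanNoise rew nxt t ω k := fun t k =>
    (hM.measurable_bellmanNoise t k).mono (hM.history_le t) le_rfl
  have e : ∀ ω i, (∑ j ∈ Finset.range n, (B j).mulVec (M.bellmanNoise rew nxt (j + 1) ω)) i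
      = ∑ j ∈ Finset.range n, ∑ k, B j i k * M.bellmanNoise rew nxt (j + 1) ω k := fun ω i => by
    simp [Finset.sum_apply, Matrix.mulVec, dotProduct]
  refine integral_norm_le_of_subexponential (μ := μ) hD (fun i => ?_)
    (B := ∑ j ∈ Finset.range n, ∑ _k : S × A, b) (fun ω i => ?_) hv hb fun l hl i => ?_
  · simp only [e]
    exact Finset.measurable_fun_sum _ fun j _ => Finset.measurable_fun_sum _ fun k _ =>
      (hmZ _ _).const_mul _
  · rw [e]
    refine (Finset.abs_sum_le_sum_abs _ _).trans (Finset.sum_le_sum fun j hj =>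
      (Finset.abs_sum_le_sum_abs _ _).trans (Finset.sum_le_sum fun k _ => ?_))
    rw [abs_mul]
    exact (mul_le_mul_of_nonneg_left (hM.abs_bellmanNoise_le hπ _ ω k) (abs_nonneg _)).trans
      (hBb j (Finset.mem_range.1 hj) i k)
  · simp only [e]
    refine (hM.integral_exp_sum_bellmanNoise_le hπ n (fun j k => B j i k) l
      fun j hj k => ?_).trans (Real.exp_le_exp.2 (mul_le_mul_of_nonneg_left (hBv i)
        (sq_nonneg l)))
    rw [abs_mul, mul_assoc]
    exact (mul_le_mul_of_nonneg_left (hBb j hj i k) (abs_nonneg l)).trans hl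

/-- The increments have the random size `2 β_j ‖Δ_j‖`, and only the expected squares are required.
The uniform bound `3h` on `‖Δ_j‖` would not decay in `j`. -/
theorem integral_norm_sum_transitionNoise_le (hη : ∀ t, 0 ≤ η t ∧ η t ≤ 1)
    (hM : M.IsBoundedModel μ rew nxt) (hπ : M.IsOptimal πs) (hQ : ‖Q₀ - M.optQ‖ ≤ M.horizon)
    [Nonempty (S × A)] (n : ℕ) (B : ℕ → Matrix (S × A) (S × A) ℝ) {β : ℕ → ℝ}
    (hβ : ∀ j, 0 ≤ β j) (hB : ∀ j x, ‖(B j).mulVec x‖ ≤ β j * ‖x‖) {s : ℝ} (hs : 0 < s)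
    (hβs : ∑ j ∈ Finset.range n, β j ^ 2 * ∫ ω, ‖M.qError η Q₀ rew nxt j ω‖ ^ 2 ∂μ ≤ s) :
    ∫ ω, ‖∑ j ∈ Finset.range n, (B j).mulVec (M.transitionNoise η Q₀ rew nxt j ω)‖ ∂μ
      ≤ 8 * √(s * Real.log (2 * Fintype.card (S × A))) := by
  have hW : ∀ j ω, ‖M.transitionNoise η Q₀ rew nxt j ω‖ ≤ 2 * ‖M.qError η Q₀ rew nxt j ω‖ :=
    fun j ω => (pi_norm_le_iff_of_nonneg (by positivity)).2 (abs_transitionNoise_le hM hπ j ω)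
  have hWm : ∀ j k, Measurable fun ω => M.transitionNoise η Q₀ rew nxt j ω k := fun j k =>
    (measurable_transitionNoise j k).mono (hM.history_le _) le_rfl
  have hΔ := norm_qError_le hη hM hπ hQ
  have key := integral_norm_sum_le (μ := μ) (F := history rew nxt) history_mono hM.history_le
    (X := fun j ω => (B j).mulVec (M.transitionNoise η Q₀ rew nxt j ω))
    (fun j k => by
      simp only [Matrix.mulVec, dotProduct]
      exact Finset.measurable_fun_sum _ fun l _ => (measurable_transitionNoise j l).const_mul _)
    (fun j k => by
      simp only [Matrix.mulVec, dotProduct]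
      refine IsCentered.sum (hM.history_le j) (fun l =>
        (isCentered_transitionNoise hη hM hπ hQ j l).const_mul _) fun l => ?_
      refine Integrable.const_mul (integrable_of_abs_le (hWm j l) (c := 2 * (3 * M.horizon))
        fun ω => ?_) _
      exact (norm_le_pi_norm _ l).trans ((hW j ω).trans
        (mul_le_mul_of_nonneg_left (hΔ j ω) zero_le_two)))
    (c := fun j ω => β j * (2 * ‖M.qError η Q₀ rew nxt j ω‖))
    (fun j => ((measurable_norm_pi fun i => (measurable_qError j i).mono (hM.history_le j)
      le_rfl).const_mul _).const_mul _)
    (fun j ω k => (norm_le_pi_norm _ k).trans ((hB j _).trans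
      (mul_le_mul_of_nonneg_left (hW j ω) (hβ j))))
    (b := fun j => β j * (2 * (3 * M.horizon)))
    (fun j ω => mul_le_mul_of_nonneg_left (mul_le_mul_of_nonneg_left (hΔ j ω) zero_le_two) (hβ j))
    n (s := 4 * s) (by positivity) (by
      have e : ∀ j, ∫ ω, (β j * (2 * ‖M.qError η Q₀ rew nxt j ω‖)) ^ 2 ∂μ
          = 4 * (β j ^ 2 * ∫ ω, ‖M.qError η Q₀ rew nxt j ω‖ ^ 2 ∂μ) := fun j => by
        rw [← integral_const_mul, ← integral_const_mul]
        congr 1; ext ω; ring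
      simp only [e]
      rw [← Finset.mul_sum]
      linarith)
  refine key.trans_eq ?_
  have h4 : √(4 : ℝ) = 2 := by
    rw [show (4 : ℝ) = 2 ^ 2 by norm_num]; exact Real.sqrt_sq zero_le_two
  rw [mul_assoc, Real.sqrt_mul (by norm_num), h4]
  ring

/-- The linearization error of the Bellman operator along the trajectory. -/
noncomputable def linearizationError (M : DiscountedMDP S A) (η : ℕ → ℝ) (Q₀ : S × A → ℝ)
    (rew : ℕ → S × A → Ω → ℝ) (nxt : ℕ → S × A → Ω → S) (πs : S → PMF A) (t : ℕ) (ω : Ω) :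
    S × A → ℝ :=
  M.next (M.valueError η Q₀ rew nxt t ω)
    - (M.transition πs).mulVec (M.qError η Q₀ rew nxt t ω)

theorem norm_linearizationError_le (hπ : M.IsOptimal πs) (hR : M.RewardsInUnitInterval) {L : ℝ}
    (hL : M.LipschitzCondition πs L) (hL0 : 0 ≤ L) (t : ℕ) (ω : Ω) :
    ‖M.linearizationError η Q₀ rew nxt πs t ω‖ ≤ L * ‖M.qError η Q₀ rew nxt t ω‖ ^ 2 :=
  (pi_norm_le_iff_of_nonneg (by positivity)).2 fun i =>
    hπ.abs_next_greedyValue_sub_le hR hL (M.qLearning η Q₀ rew nxt t ω) i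

theorem qError_succ_eq (hπ : M.IsOptimal πs) (hR : M.RewardsInUnitInterval) (t : ℕ) (ω : Ω) :
    M.qError η Q₀ rew nxt (t + 1) ω = M.qError η Q₀ rew nxt t ω
      - η (t + 1) • (1 - M.γ • M.transition πs).mulVec (M.qError η Q₀ rew nxt t ω)
      + η (t + 1) • (M.bellmanNoise rew nxt (t + 1) ω
        + M.γ • M.transitionNoise η Q₀ rew nxt t ω
        + M.γ • M.linearizationError η Q₀ rew nxt πs t ω) := by
  ext i
  rw [qError_succ hπ hR]
  simp only [linearizationError, Matrix.sub_mulVec, Matrix.one_mulVec, Matrix.smul_mulVec,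
    Pi.add_apply, Pi.sub_apply, Pi.smul_apply, smul_eq_mul]
  ring

end DiscountedMDP

/-! ### Polynomial step sizes: recursion and sums -/

section PolyStep

variable {α : ℝ}

theorem polyStep_succ (t : ℕ) : polyStep α (t + 1) = ((t : ℝ) + 1) ^ (-α) := by
  simp [polyStep]

theorem polyStep_zero : polyStep α 0 = 1 := by simp [polyStep]

theorem polyStep_pos (t : ℕ) : 0 < polyStep α t := by
  cases t with
  | zero => simp [polyStep]
  | succ t => rw [polyStep_succ]; positivity

theorem polyStep_le_one (hα : 0 < α) (t : ℕ) : polyStep α t ≤ 1 := by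
  cases t with
  | zero => simp [polyStep]
  | succ t =>
    rw [polyStep_succ]
    exact Real.rpow_le_one_of_one_le_of_nonpos (by linarith [Nat.cast_nonneg (α := ℝ) t])
      (by linarith)

/-- For `t ≥ 1` this says that `t η_t = t^{1-α}` is nondecreasing; at `t = 0` the left-hand side
vanishes. -/
theorem one_sub_inv_mul_polyStep_le (hα : α < 1) (t : ℕ) :
    (1 - 1 / ((t : ℝ) + 1)) * polyStep α t ≤ polyStep α (t + 1) := by
  cases t with
  | zero => simpa using (polyStep_pos (α := α) 1).le
  | succ t =>
    have h0 : (0 : ℝ) < (t : ℝ) + 1 := by positivity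
    have h1 : (0 : ℝ) < (t : ℝ) + 1 + 1 := by positivity
    rw [polyStep_succ, polyStep_succ]
    push_cast
    have h2 : ((t : ℝ) + 1) ^ (1 - α) ≤ ((t : ℝ) + 1 + 1) ^ (1 - α) :=
      Real.rpow_le_rpow h0.le (by linarith) (by linarith)
    rw [sub_eq_add_neg, Real.rpow_add h0, Real.rpow_add h1, Real.rpow_one, Real.rpow_one] at h2
    have e : (1 - 1 / ((t : ℝ) + 1 + 1)) = ((t : ℝ) + 1) / ((t : ℝ) + 1 + 1) := by
      field_simp; ring
    rw [e, div_mul_eq_mul_div, div_le_iff₀ h1]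
    linarith

theorem isStepSize_polyStep (hα₀ : 0 < α) (hα : α < 1) : IsStepSize (polyStep α) where
  zero := polyStep_zero
  pos := polyStep_pos
  le_one := polyStep_le_one hα₀
  mul_le t := by
    refine le_trans (mul_le_mul_of_nonneg_right ?_ (polyStep_pos t).le)
      (one_sub_inv_mul_polyStep_le hα t)
    have h0 : (0 : ℝ) < (t : ℝ) + 1 := by positivity
    have : 1 / ((t : ℝ) + 1) ≤ polyStep α (t + 1) := by
      rw [polyStep_succ, one_div, ← Real.rpow_neg_one]
      exact Real.rpow_le_rpow_of_exponent_le (by linarith [Nat.cast_nonneg (α := ℝ) t])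
        (by linarith)
    linarith

/-- Identifies the burn-in time `τ = (2h)^{1/(1-α)}`: beyond it `t^{1-α} ≥ 2h`, so the contraction
rate `η_t / h` is at least `2/t` and a transient decays like `t^{-2}`. -/
theorem two_div_le_polyStep {h : ℝ} (hα : α < 1) (hh : 1 ≤ h) {t : ℕ}
    (ht : (2 * h) ^ (1 / (1 - α)) ≤ (t : ℝ) + 1) :
    2 / ((t : ℝ) + 1) ≤ 1 / h * polyStep α (t + 1) := by
  have h0 : (0 : ℝ) < (t : ℝ) + 1 := by positivity
  have h1 : 2 * h ≤ ((t : ℝ) + 1) ^ (1 - α) := by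
    have := Real.rpow_le_rpow (by positivity) ht (by linarith : 0 ≤ 1 - α)
    rwa [← Real.rpow_mul (by positivity), one_div_mul_cancel (by linarith), Real.rpow_one] at this
  rw [sub_eq_add_neg, Real.rpow_add h0, Real.rpow_one, ← polyStep_succ] at h1
  rw [div_le_iff₀ h0, one_div, mul_assoc, le_inv_mul_iff₀ (by linarith)]
  linarith

/-- The linear recursion behind the contraction, for polynomial step sizes. -/
theorem le_of_polyStep_recursion {h K : ℝ} (hα₀ : 0 < α) (hα : α < 1) (hh : 1 ≤ h) (hK : 0 ≤ K)
    {y : ℕ → ℝ} (h0 : y 0 ≤ K)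
    (hy : ∀ t, y (t + 1) ≤ (1 - 1 / h * polyStep α (t + 1)) * y t
      + 1 / h * polyStep α (t + 1) * (K * polyStep α t)) (t : ℕ) :
    y t ≤ K * (2 * polyStep α t + min 1 ((2 * h) ^ (1 / (1 - α)) / t) ^ 2) := by
  set τ := (2 * h) ^ (1 / (1 - α)) with hτ
  have hτ1 : 1 < τ := Real.one_lt_rpow (by linarith) (by
    have : 0 < 1 - α := by linarith
    positivity)
  have hx0 : ∀ t, 0 ≤ 1 / h * polyStep α t := fun t => by
    have := (polyStep_pos (α := α) t).le
    positivity
  have hx1 : ∀ t, 1 / h * polyStep α t ≤ 1 := fun t =>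
    mul_le_one₀ (by rw [div_le_one (by linarith)]; exact hh) (polyStep_pos t).le
      (polyStep_le_one hα₀ t)
  have hyK : ∀ t, y t ≤ K := by
    intro t
    induction t with
    | zero => exact h0
    | succ t ih =>
      refine (hy t).trans ?_
      have h1 := mul_le_mul_of_nonneg_left ih (by linarith [hx1 (t + 1)] :
        0 ≤ 1 - 1 / h * polyStep α (t + 1))
      have h2 := mul_le_mul_of_nonneg_left (mul_le_of_le_one_right hK (polyStep_le_one hα₀ t))
        (hx0 (t + 1))
      linarith
  induction t with
  | zero =>
    -- Here `τ / 0 = 0`, and the first summand alone, `2K`, suffices.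
    rw [polyStep_zero]
    have := sq_nonneg (min 1 (τ / (0 : ℕ)))
    nlinarith
  | succ t ih =>
    have hn : (0 : ℝ) < (t : ℝ) + 1 := by positivity
    push_cast
    -- During burn-in the minimum is `1` and the trivial bound `K` suffices. Afterwards, with `u =
    -- 1/(t+1)`, both summands reproduce themselves: `1 - x ≤ (1-u)²` carries the squared transient,
    -- and `2 - x ≤ 2(1-u)` carries the multiple of the step size. The square matters for first
    -- moments, where the transient becomes `τ/t` with a logarithmic sum.
    rcases le_or_gt ((t : ℝ) + 1) τ with hle | hgt
    · have e : min 1 (τ / ((t : ℝ) + 1)) = 1 := min_eq_left ((one_le_div hn).2 hle)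
      rw [e, one_pow]
      have := polyStep_pos (α := α) (t + 1)
      nlinarith [hyK (t + 1), mul_nonneg hK this.le]
    · have ht : 0 < t := by
        by_contra h
        have : t = 0 := by omega
        subst this
        norm_num at hgt
        linarith
      have ht' : (0 : ℝ) < t := by exact_mod_cast ht
      have e : min 1 (τ / ((t : ℝ) + 1)) = τ / ((t : ℝ) + 1) :=
        min_eq_right ((div_le_one hn).2 hgt.le)
      rw [e]
      set x := 1 / h * polyStep α (t + 1) with hx
      have hx2 : 2 / ((t : ℝ) + 1) ≤ x := two_div_le_polyStep hα hh hgt.le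
      have hxu : 2 * (1 / ((t : ℝ) + 1)) ≤ x := by rw [mul_one_div]; exact hx2
      set u := 1 / ((t : ℝ) + 1) with hu
      have hρ : min 1 (τ / (t : ℝ)) ^ 2 ≤ (τ / t) ^ 2 :=
        pow_le_pow_left₀ (le_min zero_le_one (by positivity)) (min_le_right _ _) 2
      have hρ0 : 0 ≤ min 1 (τ / (t : ℝ)) ^ 2 := sq_nonneg _
      have h1 := one_sub_inv_mul_polyStep_le (α := α) hα t
      have h2 : (1 - u) ^ 2 * (τ / t) ^ 2 = (τ / ((t : ℝ) + 1)) ^ 2 := by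
        rw [← mul_pow]
        congr 1
        rw [hu]; field_simp; ring
      have h3 : (1 - x) * min 1 (τ / (t : ℝ)) ^ 2 ≤ (τ / ((t : ℝ) + 1)) ^ 2 := by
        rw [← h2]
        have : 1 - x ≤ (1 - u) ^ 2 := by nlinarith [sq_nonneg u]
        exact (mul_le_mul_of_nonneg_right this hρ0).trans
          (mul_le_mul_of_nonneg_left hρ (sq_nonneg _))
      have h4 : (2 - x) * polyStep α t ≤ 2 * polyStep α (t + 1) := by
        have := mul_le_mul_of_nonneg_right (by linarith : 2 - x ≤ 2 * (1 - u))
          (polyStep_pos (α := α) t).le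
        linarith
      calc y (t + 1) ≤ (1 - x) * y t + x * (K * polyStep α t) := hy t
        _ ≤ (1 - x) * (K * (2 * polyStep α t + min 1 (τ / (t : ℝ)) ^ 2))
            + x * (K * polyStep α t) := by
            have := mul_le_mul_of_nonneg_left ih (by linarith [hx1 (t + 1)] : 0 ≤ 1 - x)
            linarith
        _ = K * ((2 - x) * polyStep α t + (1 - x) * min 1 (τ / (t : ℝ)) ^ 2) := by ring
        _ ≤ _ := mul_le_mul_of_nonneg_left (add_le_add h4 h3) hK

/-- Induction with the tangent bound for the concave function `x^{1-α}` at `n + 1`. -/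
theorem sum_polyStep_le (hα₀ : 0 < α) (hα : α < 1) (n : ℕ) :
    ∑ t ∈ Finset.range n, polyStep α (t + 1) ≤ (n : ℝ) ^ (1 - α) / (1 - α) := by
  have hβ : 0 < 1 - α := by linarith
  induction n with
  | zero => simp [Real.zero_rpow hβ.ne']
  | succ n ih =>
    rw [Finset.sum_range_succ]
    have hn : (0 : ℝ) < (n : ℝ) + 1 := by positivity
    have key : (n : ℝ) ^ (1 - α) ≤ ((n : ℝ) + 1) ^ (1 - α) - (1 - α) * ((n : ℝ) + 1) ^ (-α) := by
      have h1 := rpow_one_add_le_one_add_mul_self (s := -(1 / ((n : ℝ) + 1))) (p := 1 - α)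
        (by rw [neg_le_neg_iff, div_le_one hn]; linarith [Nat.cast_nonneg (α := ℝ) n])
        hβ.le (by linarith)
      have e : 1 + -(1 / ((n : ℝ) + 1)) = n / ((n : ℝ) + 1) := by field_simp; ring
      rw [e, Real.div_rpow (Nat.cast_nonneg n) hn.le, div_le_iff₀ (by positivity)] at h1
      refine h1.trans_eq ?_
      rw [sub_eq_add_neg 1 α, Real.rpow_add hn, Real.rpow_one]
      field_simp
      ring
    rw [polyStep_succ]
    push_cast
    rw [le_div_iff₀ hβ] at ih ⊢
    linarith

theorem sum_one_div_le {n T : ℕ} (h : n ≤ T) :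
    ∑ t ∈ Finset.range n, 1 / ((t : ℝ) + 1) ≤ 1 + Real.log T := by
  have h1 := harmonic_le_one_add_log T
  have h2 : ((harmonic T : ℚ) : ℝ) = ∑ t ∈ Finset.range T, 1 / ((t : ℝ) + 1) := by
    simp [harmonic]
  rw [h2] at h1
  exact (Finset.sum_le_sum_of_subset_of_nonneg (Finset.range_mono h)
    fun t _ _ => by positivity).trans h1

/-- Pairs the increments of `η⁻¹` from Abel summation with the decay `t^{-α/2}` of the error. If `a
≤ b` are the powers `α/2` of consecutive integers, a summand is `(b² - a²)/a ≤ 3(b - a)` because `b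
≤ 2a`, and this telescopes. -/
theorem sum_rpow_sub_mul_le (hα₀ : 0 < α) (hα : α < 1) (n : ℕ) :
    ∑ t ∈ Finset.range n, (((t : ℝ) + 2) ^ α - ((t : ℝ) + 1) ^ α) * ((t : ℝ) + 1) ^ (-(α / 2))
      ≤ 3 * ((n : ℝ) + 1) ^ (α / 2) := by
  suffices h : ∑ t ∈ Finset.range n, (((t : ℝ) + 2) ^ α - ((t : ℝ) + 1) ^ α)
      * ((t : ℝ) + 1) ^ (-(α / 2)) ≤ 3 * (((n : ℝ) + 1) ^ (α / 2) - 1) by linarith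
  induction n with
  | zero => simp
  | succ n ih =>
    rw [Finset.sum_range_succ]
    have h1 : (0 : ℝ) < (n : ℝ) + 1 := by positivity
    have h2 : (0 : ℝ) < (n : ℝ) + 2 := by positivity
    set a := ((n : ℝ) + 1) ^ (α / 2) with ha
    set b := ((n : ℝ) + 2) ^ (α / 2) with hb
    have ha0 : 0 < a := by positivity
    have hab : a ≤ b := Real.rpow_le_rpow h1.le (by linarith) (by linarith)
    have hb2 : b ≤ 2 * a := by
      have : b ≤ (2 * ((n : ℝ) + 1)) ^ (α / 2) :=
        Real.rpow_le_rpow h2.le (by linarith [Nat.cast_nonneg (α := ℝ) n]) (by linarith)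
      refine this.trans ?_
      rw [Real.mul_rpow zero_le_two h1.le]
      refine mul_le_mul_of_nonneg_right ?_ ha0.le
      calc (2 : ℝ) ^ (α / 2) ≤ 2 ^ (1 : ℝ) :=
            Real.rpow_le_rpow_of_exponent_le one_le_two (by linarith)
        _ = 2 := Real.rpow_one 2
    have e1 : ((n : ℝ) + 1) ^ α = a ^ 2 := by
      rw [ha, ← Real.rpow_natCast, ← Real.rpow_mul h1.le]; congr 1; push_cast; ring
    have e2 : ((n : ℝ) + 2) ^ α = b ^ 2 := by
      rw [hb, ← Real.rpow_natCast, ← Real.rpow_mul h2.le]; congr 1; push_cast; ring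
    rw [e1, e2, Real.rpow_neg h1.le, ← ha]
    have e3 : ((n + 1 : ℕ) : ℝ) + 1 = (n : ℝ) + 2 := by push_cast; ring
    rw [e3, ← hb]
    have h5 : (b ^ 2 - a ^ 2) * a⁻¹ ≤ 3 * (b - a) := by
      rw [← div_eq_mul_inv, div_le_iff₀ ha0]
      nlinarith [mul_nonneg (sub_nonneg.2 hab) (sub_nonneg.2 hb2)]
    linarith

theorem rpow_add_two_sub_le_one (hα₀ : 0 < α) (hα : α < 1) (t : ℕ) :
    ((t : ℝ) + 2) ^ α - ((t : ℝ) + 1) ^ α ≤ 1 := by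
  have h := Real.rpow_add_le_add_rpow (a := (t : ℝ) + 1) (b := 1) (p := α) (by positivity)
    zero_le_one hα₀.le hα.le
  rw [Real.one_rpow] at h
  have e : (t : ℝ) + 1 + 1 = (t : ℝ) + 2 := by ring
  rw [e] at h
  linarith

/-- For `α > 1/2`, a term of order `T ^ ((1 - α) / 2)` is dominated by `T ^ (α / 2)` up to a
constant. -/
theorem exists_mul_rpow_le (hα₀ : 1 / 2 < α) (hα : α < 1) :
    ∃ q : ℕ, ∀ A T : ℝ, 1 ≤ A → 1 ≤ T →
      A * T ^ ((1 - α) / 2) ≤ T ^ (α / 2) + A ^ q := by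
  -- Either `A ≤ T^{α-1/2}`, and the two powers of `T` combine to `T^{α/2}`, or `T` is smaller than
  -- a power of `A`, so that `T^{(1-α)/2} ≤ A^e`.
  set e := (1 - α) / (2 * α - 1) with he
  have h21 : 0 < 2 * α - 1 := by linarith
  refine ⟨⌈e⌉₊ + 1, fun A T hA hT => ?_⟩
  have hT0 : 0 < T := by linarith
  have hA0 : 0 < A := by linarith
  rcases le_or_gt A (T ^ (α - 1 / 2)) with h | h
  · have h1 : A * T ^ ((1 - α) / 2) ≤ T ^ (α - 1 / 2) * T ^ ((1 - α) / 2) :=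
      mul_le_mul_of_nonneg_right h (by positivity)
    rw [← Real.rpow_add hT0, show α - 1 / 2 + (1 - α) / 2 = α / 2 by ring] at h1
    have : 0 ≤ A ^ (⌈e⌉₊ + 1) := by positivity
    linarith
  · have h1 : T ^ ((1 - α) / 2) ≤ A ^ e := by
      have := Real.rpow_le_rpow (by positivity) h.le (by
        rw [he]; exact div_nonneg (by linarith) h21.le : 0 ≤ e)
      rw [← Real.rpow_mul hT0.le] at this
      have e2 : (α - 1 / 2) * e = (1 - α) / 2 := by
        rw [he, show α - 1 / 2 = (2 * α - 1) / 2 by ring]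
        field_simp
      rwa [e2] at this
    have h2 : A ^ e ≤ A ^ ⌈e⌉₊ := by
      rw [← Real.rpow_natCast]
      exact Real.rpow_le_rpow_of_exponent_le hA (Nat.le_ceil e)
    have h3 : A * T ^ ((1 - α) / 2) ≤ A * A ^ ⌈e⌉₊ :=
      mul_le_mul_of_nonneg_left (h1.trans h2) hA0.le
    rw [← pow_succ'] at h3
    have : 0 ≤ T ^ (α / 2) := by positivity
    linarith

end PolyStep

/-! ### The averaged iterate through the resolvent and Abel summation -/

theorem MeasureTheory.sq_integral_le {Ω : Type*} [MeasurableSpace Ω] {μ : Measure Ω}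
    [IsProbabilityMeasure μ] {f : Ω → ℝ} (hf : Integrable f μ)
    (hf2 : Integrable (fun ω => f ω ^ 2) μ) : (∫ ω, f ω ∂μ) ^ 2 ≤ ∫ ω, f ω ^ 2 ∂μ := by
  set m := ∫ ω, f ω ∂μ with hm
  have h0 : 0 ≤ ∫ ω, (f ω ^ 2 + (-(2 * m) * f ω + m ^ 2)) ∂μ :=
    integral_nonneg fun ω => by
      have := sq_nonneg (f ω - m)
      simp only [Pi.zero_apply]
      linarith
  have h1 := integral_add hf2 ((hf.const_mul (-(2 * m))).add (integrable_const (m ^ 2)))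
  have h2 := integral_add (hf.const_mul (-(2 * m))) (integrable_const (m ^ 2))
  simp only [Pi.add_apply] at h1
  rw [h1, h2, integral_const_mul, ← hm] at h0
  simp only [integral_const, probReal_univ, smul_eq_mul, one_mul] at h0
  linarith

/-- Abel summation, with `x` the error and `c` the inverse step sizes. -/
theorem Finset.sum_range_succ_smul_sub {E : Type*} [AddCommGroup E] [Module ℝ E] (c : ℕ → ℝ)
    (x : ℕ → E) (n : ℕ) :
    ∑ t ∈ Finset.range (n + 1), c t • (x t - x (t + 1))
      = c 0 • x 0 - c n • x (n + 1) + ∑ t ∈ Finset.range n, (c (t + 1) - c t) • x (t + 1) := by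
  induction n with
  | zero => simp [smul_sub]
  | succ n ih =>
    rw [Finset.sum_range_succ, ih, Finset.sum_range_succ _ n, smul_sub, sub_smul]
    abel

namespace DiscountedMDP

variable {S A : Type*} [Fintype S] [Fintype A] [DecidableEq S] [DecidableEq A]
  [MeasurableSpace S] [MeasurableSingletonClass S] {M : DiscountedMDP S A}
  {Ω : Type*} [mΩ : MeasurableSpace Ω] {μ : Measure Ω} [IsProbabilityMeasure μ]
  {η : ℕ → ℝ} {Q₀ : S × A → ℝ} {rew : ℕ → S × A → Ω → ℝ} {nxt : ℕ → S × A → Ω → S}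
  {πs : S → PMF A}

theorem avgQLearning_sub_optQ {T : ℕ} (hT : 1 ≤ T) (ω : Ω) :
    M.avgQLearning η Q₀ rew nxt T ω - M.optQ
      = (T : ℝ)⁻¹ • ∑ t ∈ Finset.range T, M.qError η Q₀ rew nxt (t + 1) ω := by
  have hT0 : (T : ℝ) ≠ 0 := by positivity
  have e : ∑ t ∈ Finset.Icc 1 T, M.qLearning η Q₀ rew nxt t ω
      = ∑ t ∈ Finset.range T, M.qLearning η Q₀ rew nxt (t + 1) ω := by
    rw [Finset.range_eq_Ico, Finset.sum_Ico_add' (fun t => M.qLearning η Q₀ rew nxt t ω) 0 T 1]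
    rfl
  simp only [avgQLearning, qError, Finset.sum_sub_distrib, Finset.sum_const, Finset.card_range, e]
  rw [smul_sub, ← Nat.cast_smul_eq_nsmul ℝ, smul_smul, inv_mul_cancel₀ hT0, one_smul]

section Integrable

variable (hη : ∀ t, 0 ≤ η t ∧ η t ≤ 1) (hM : M.IsBoundedModel μ rew nxt) (hπ : M.IsOptimal πs)
  (hQ : ‖Q₀ - M.optQ‖ ≤ M.horizon)

include hη hM hπ hQ

theorem integrable_norm_qError (t : ℕ) :
    Integrable (fun ω => ‖M.qError η Q₀ rew nxt t ω‖) μ :=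
  integrable_of_abs_le (measurable_norm_pi fun i => (measurable_qError t i).mono
    (hM.history_le t) le_rfl) fun ω => by
      rw [abs_norm]; exact norm_qError_le hη hM hπ hQ t ω

theorem integrable_norm_qError_sq (t : ℕ) :
    Integrable (fun ω => ‖M.qError η Q₀ rew nxt t ω‖ ^ 2) μ :=
  integrable_of_abs_le ((measurable_norm_pi fun i => (measurable_qError t i).mono
    (hM.history_le t) le_rfl).pow_const 2) (c := (3 * M.horizon) ^ 2) fun ω => by
      rw [abs_of_nonneg (sq_nonneg _)]
      exact pow_le_pow_left₀ (norm_nonneg _) (norm_qError_le hη hM hπ hQ t ω) 2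

theorem integrable_norm_avgQLearning_sub {T : ℕ} (hT : 1 ≤ T) :
    Integrable (fun ω => ‖M.avgQLearning η Q₀ rew nxt T ω - M.optQ‖) μ := by
  simp only [avgQLearning_sub_optQ hT, norm_smul]
  refine Integrable.const_mul (integrable_of_abs_le (measurable_norm_pi fun i => ?_)
    (c := ∑ _t ∈ Finset.range T, 3 * M.horizon) fun ω => ?_) _
  · simp only [Finset.sum_apply]
    exact Finset.measurable_fun_sum _ fun t _ => (measurable_qError _ i).mono
      (hM.history_le _) le_rfl
  · rw [abs_norm]
    exact (norm_sum_le _ _).trans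
      (Finset.sum_le_sum fun t _ => norm_qError_le hη hM hπ hQ _ ω)

theorem integrable_norm_sum_mulVec_bellmanNoise (n : ℕ) (B : ℕ → Matrix (S × A) (S × A) ℝ) :
    Integrable (fun ω => ‖∑ j ∈ Finset.range n,
      (B j).mulVec (M.bellmanNoise rew nxt (j + 1) ω)‖) μ := by
  refine integrable_of_abs_le (measurable_norm_pi fun i => ?_)
    (c := ∑ j ∈ Finset.range n, ∑ i, ∑ k, |B j i k| * M.horizon) fun ω => ?_
  · simp only [Finset.sum_apply, Matrix.mulVec, dotProduct]
    exact Finset.measurable_fun_sum _ fun j _ => Finset.measurable_fun_sum _ fun k _ =>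
      ((hM.measurable_bellmanNoise _ k).mono (hM.history_le _) le_rfl).const_mul _
  · rw [abs_norm]
    have hh := M.horizon_pos
    have hnn : ∀ j i, 0 ≤ ∑ k, |B j i k| * M.horizon := fun j i =>
      Finset.sum_nonneg fun k _ => by positivity
    refine (norm_sum_le _ _).trans (Finset.sum_le_sum fun j _ => ?_)
    refine (pi_norm_le_iff_of_nonneg (Finset.sum_nonneg fun i _ => hnn j i)).2 fun i => ?_
    refine le_trans ?_ (Finset.single_le_sum (f := fun i => ∑ k, |B j i k| * M.horizon)
      (fun i _ => hnn j i) (Finset.mem_univ i))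
    refine (Finset.abs_sum_le_sum_abs _ _).trans (Finset.sum_le_sum fun k _ => ?_)
    rw [abs_mul]
    exact mul_le_mul_of_nonneg_left (hM.abs_bellmanNoise_le hπ _ ω k) (abs_nonneg _)

theorem integrable_norm_sum_mulVec_transitionNoise (n : ℕ)
    (B : ℕ → Matrix (S × A) (S × A) ℝ) :
    Integrable (fun ω => ‖∑ j ∈ Finset.range n,
      (B j).mulVec (M.transitionNoise η Q₀ rew nxt j ω)‖) μ := by
  refine integrable_of_abs_le (measurable_norm_pi fun i => ?_)
    (c := ∑ j ∈ Finset.range n, ∑ i, ∑ k, |B j i k| * (2 * (3 * M.horizon))) fun ω => ?_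
  · simp only [Finset.sum_apply, Matrix.mulVec, dotProduct]
    exact Finset.measurable_fun_sum _ fun j _ => Finset.measurable_fun_sum _ fun k _ =>
      ((measurable_transitionNoise _ k).mono (hM.history_le _) le_rfl).const_mul _
  · rw [abs_norm]
    have hh := M.horizon_pos
    have hnn : ∀ j i, 0 ≤ ∑ k, |B j i k| * (2 * (3 * M.horizon)) := fun j i =>
      Finset.sum_nonneg fun k _ => by positivity
    refine (norm_sum_le _ _).trans (Finset.sum_le_sum fun j _ => ?_)
    refine (pi_norm_le_iff_of_nonneg (Finset.sum_nonneg fun i _ => hnn j i)).2 fun i => ?_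
    refine le_trans ?_ (Finset.single_le_sum
      (f := fun i => ∑ k, |B j i k| * (2 * (3 * M.horizon)))
      (fun i _ => hnn j i) (Finset.mem_univ i))
    refine (Finset.abs_sum_le_sum_abs _ _).trans (Finset.sum_le_sum fun k _ => ?_)
    rw [abs_mul]
    exact mul_le_mul_of_nonneg_left ((abs_transitionNoise_le hM hπ j ω k).trans
      (mul_le_mul_of_nonneg_left (norm_qError_le hη hM hπ hQ j ω) zero_le_two)) (abs_nonneg _)

end Integrable

/-- The recursion is solved for `(I - γP^{π^*}) Δ_t` and the resolvent is applied before summing. It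
stays inside the norms of the two noise sums, so that `Var_Q` can appear; on the other terms it
costs a factor `h`. -/
theorem norm_sum_qError_le (hη0 : ∀ t, 0 < η t) (hηa : Antitone η) (hπ : M.IsOptimal πs)
    (hR : M.RewardsInUnitInterval) {L : ℝ} (hL : M.LipschitzCondition πs L) (hL0 : 0 ≤ L)
    (n : ℕ) (ω : Ω) :
    ‖∑ t ∈ Finset.range (n + 1), M.qError η Q₀ rew nxt t ω‖
      ≤ M.horizon * ((η 1)⁻¹ * ‖M.qError η Q₀ rew nxt 0 ω‖
          + (η (n + 1))⁻¹ * ‖M.qError η Q₀ rew nxt (n + 1) ω‖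
          + ∑ t ∈ Finset.range n, ((η (t + 2))⁻¹ - (η (t + 1))⁻¹)
            * ‖M.qError η Q₀ rew nxt (t + 1) ω‖)
        + ‖∑ t ∈ Finset.range (n + 1),
            (M.resolvent πs).mulVec (M.bellmanNoise rew nxt (t + 1) ω)‖
        + ‖∑ t ∈ Finset.range (n + 1),
            (M.resolvent πs).mulVec (M.transitionNoise η Q₀ rew nxt t ω)‖
        + M.γ * L * M.horizon
          * ∑ t ∈ Finset.range (n + 1), ‖M.qError η Q₀ rew nxt t ω‖ ^ 2 := by
  have hγ := M.γ_pos
  have hh := M.horizon_pos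
  have e : ∀ t, M.qError η Q₀ rew nxt t ω
      = (M.resolvent πs).mulVec ((η (t + 1))⁻¹ • (M.qError η Q₀ rew nxt t ω
          - M.qError η Q₀ rew nxt (t + 1) ω))
        + (M.resolvent πs).mulVec (M.bellmanNoise rew nxt (t + 1) ω)
        + M.γ • (M.resolvent πs).mulVec (M.transitionNoise η Q₀ rew nxt t ω)
        + M.γ • (M.resolvent πs).mulVec (M.linearizationError η Q₀ rew nxt πs t ω) := by
    intro t
    conv_lhs => rw [← M.resolvent_mulVec_sub_transition πs (M.qError η Q₀ rew nxt t ω)]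
    rw [← Matrix.mulVec_smul, ← Matrix.mulVec_smul, ← Matrix.mulVec_add, ← Matrix.mulVec_add,
      ← Matrix.mulVec_add]
    congr 1
    have hn := (hη0 (t + 1)).ne'
    rw [qError_succ_eq hπ hR t ω]
    ext i
    simp only [Pi.add_apply, Pi.sub_apply, Pi.smul_apply, smul_eq_mul]
    field_simp
    ring
  have hsum : ∑ t ∈ Finset.range (n + 1), M.qError η Q₀ rew nxt t ω
      = (M.resolvent πs).mulVec (∑ t ∈ Finset.range (n + 1), (η (t + 1))⁻¹ •
          (M.qError η Q₀ rew nxt t ω - M.qError η Q₀ rew nxt (t + 1) ω))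
        + ∑ t ∈ Finset.range (n + 1),
            (M.resolvent πs).mulVec (M.bellmanNoise rew nxt (t + 1) ω)
        + M.γ • ∑ t ∈ Finset.range (n + 1),
            (M.resolvent πs).mulVec (M.transitionNoise η Q₀ rew nxt t ω)
        + M.γ • ∑ t ∈ Finset.range (n + 1),
            (M.resolvent πs).mulVec (M.linearizationError η Q₀ rew nxt πs t ω) := by
    rw [Finset.sum_congr rfl fun t _ => e t, Finset.sum_add_distrib, Finset.sum_add_distrib,
      Finset.sum_add_distrib, Matrix.mulVec_sum, Finset.smul_sum, Finset.smul_sum]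
  rw [hsum]
  refine (norm_add_le _ _).trans (add_le_add ((norm_add_le _ _).trans (add_le_add
    ((norm_add_le _ _).trans (add_le_add ?_ le_rfl)) ?_)) ?_)
  · refine (M.norm_resolvent_mulVec_le πs _).trans (mul_le_mul_of_nonneg_left ?_ hh.le)
    rw [Finset.sum_range_succ_smul_sub (fun t => (η (t + 1))⁻¹)
      (fun t => M.qError η Q₀ rew nxt t ω) n]
    refine (norm_add_le _ _).trans (add_le_add ((norm_sub_le _ _).trans_eq ?_)
      ((norm_sum_le _ _).trans_eq (Finset.sum_congr rfl fun t _ => ?_)))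
    · rw [norm_smul, norm_smul, Real.norm_eq_abs, Real.norm_eq_abs,
        abs_of_pos (inv_pos.2 (hη0 _)), abs_of_pos (inv_pos.2 (hη0 _))]
    · rw [norm_smul, Real.norm_eq_abs, abs_of_nonneg]
      exact sub_nonneg.2 (inv_anti₀ (hη0 _) (hηa (by omega)))
  · rw [norm_smul, Real.norm_eq_abs, abs_of_pos hγ]
    exact mul_le_of_le_one_left (norm_nonneg _) M.γ_lt_one.le
  · rw [norm_smul, Real.norm_eq_abs, abs_of_pos hγ, mul_assoc M.γ L, mul_assoc M.γ]
    refine mul_le_mul_of_nonneg_left ((norm_sum_le _ _).trans ?_) hγ.le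
    rw [Finset.mul_sum]
    refine Finset.sum_le_sum fun t _ => (M.norm_resolvent_mulVec_le πs _).trans ?_
    have := mul_le_mul_of_nonneg_left (norm_linearizationError_le (η := η) (Q₀ := Q₀) (rew := rew)
      (nxt := nxt) hπ hR hL hL0 t ω) hh.le
    linarith

/-- The expectation of the averaged error in terms of the errors of the iterates. -/
theorem integral_norm_avgQLearning_sub_le (hη : IsStepSize η) (hηa : Antitone η)
    (hM : M.IsBoundedModel μ rew nxt) (hπ : M.IsOptimal πs) (hQ : ‖Q₀ - M.optQ‖ ≤ M.horizon)
    {L : ℝ} (hL : M.LipschitzCondition πs L) (hL0 : 0 ≤ L) (n : ℕ) :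
    ((n : ℝ) + 1) * ∫ ω, ‖M.avgQLearning η Q₀ rew nxt (n + 1) ω - M.optQ‖ ∂μ
      ≤ 6 * M.horizon + M.horizon * ((η 1)⁻¹ * M.horizon
          + (η (n + 1))⁻¹ * ∫ ω, ‖M.qError η Q₀ rew nxt (n + 1) ω‖ ∂μ
          + ∑ t ∈ Finset.range n, ((η (t + 2))⁻¹ - (η (t + 1))⁻¹)
            * ∫ ω, ‖M.qError η Q₀ rew nxt (t + 1) ω‖ ∂μ)
        + ∫ ω, ‖∑ t ∈ Finset.range (n + 1),
            (M.resolvent πs).mulVec (M.bellmanNoise rew nxt (t + 1) ω)‖ ∂μ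
        + ∫ ω, ‖∑ t ∈ Finset.range (n + 1),
            (M.resolvent πs).mulVec (M.transitionNoise η Q₀ rew nxt t ω)‖ ∂μ
        + M.γ * L * M.horizon
          * ∑ t ∈ Finset.range (n + 1), ∫ ω, ‖M.qError η Q₀ rew nxt t ω‖ ^ 2 ∂μ := by
  have hη' : ∀ t, 0 ≤ η t ∧ η t ≤ 1 := fun t => ⟨(hη.pos t).le, hη.le_one t⟩
  have hn : (0 : ℝ) < (n : ℝ) + 1 := by positivity
  have i1 := integrable_norm_qError hη' hM hπ hQ
  have i2 := integrable_norm_qError_sq hη' hM hπ hQ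
  have i3 := integrable_norm_sum_mulVec_bellmanNoise (η := η) hη' hM hπ hQ (n + 1)
    fun _ => M.resolvent πs
  have i4 := integrable_norm_sum_mulVec_transitionNoise hη' hM hπ hQ (n + 1)
    fun _ => M.resolvent πs
  have ia : Integrable (fun ω => 6 * M.horizon + M.horizon * ((η 1)⁻¹ * M.horizon)) μ :=
    integrable_const _
  have ib := (i1 (n + 1)).const_mul (M.horizon * (η (n + 1))⁻¹)
  have ic : Integrable (fun ω => ∑ t ∈ Finset.range n,
      M.horizon * ((η (t + 2))⁻¹ - (η (t + 1))⁻¹) * ‖M.qError η Q₀ rew nxt (t + 1) ω‖) μ :=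
    integrable_finsetSum _ fun t _ => (i1 (t + 1)).const_mul _
  have id : Integrable (fun ω => ∑ t ∈ Finset.range (n + 1),
      M.γ * L * M.horizon * ‖M.qError η Q₀ rew nxt t ω‖ ^ 2) μ :=
    integrable_finsetSum _ fun t _ => (i2 t).const_mul _
  have pointwise : ∀ ω, ((n : ℝ) + 1) * ‖M.avgQLearning η Q₀ rew nxt (n + 1) ω - M.optQ‖
      ≤ (6 * M.horizon + M.horizon * ((η 1)⁻¹ * M.horizon)
        + M.horizon * (η (n + 1))⁻¹ * ‖M.qError η Q₀ rew nxt (n + 1) ω‖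
        + ∑ t ∈ Finset.range n,
          M.horizon * ((η (t + 2))⁻¹ - (η (t + 1))⁻¹) * ‖M.qError η Q₀ rew nxt (t + 1) ω‖
        + ‖∑ t ∈ Finset.range (n + 1),
            (M.resolvent πs).mulVec (M.bellmanNoise rew nxt (t + 1) ω)‖
        + ‖∑ t ∈ Finset.range (n + 1),
            (M.resolvent πs).mulVec (M.transitionNoise η Q₀ rew nxt t ω)‖)
        + ∑ t ∈ Finset.range (n + 1),
          M.γ * L * M.horizon * ‖M.qError η Q₀ rew nxt t ω‖ ^ 2 := by
    intro ω
    have h1 := norm_sum_qError_le (Q₀ := Q₀) (rew := rew) (nxt := nxt) hη.pos hηa hπ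
      hM.rewardsInUnitInterval hL hL0 n ω
    have e1 : ((n : ℝ) + 1) * ‖M.avgQLearning η Q₀ rew nxt (n + 1) ω - M.optQ‖
        = ‖∑ t ∈ Finset.range (n + 1), M.qError η Q₀ rew nxt (t + 1) ω‖ := by
      rw [avgQLearning_sub_optQ (by omega), norm_smul, Real.norm_eq_abs, abs_inv]
      push_cast
      rw [abs_of_pos hn, ← mul_assoc, mul_inv_cancel₀ hn.ne', one_mul]
    -- The average runs over `1, …, n+1`, the summed recursion over `0, …, n`; exchanging the end
    -- terms costs at most `6h`.
    have e2 : ∑ t ∈ Finset.range (n + 1), M.qError η Q₀ rew nxt (t + 1) ω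
        = ∑ t ∈ Finset.range (n + 1), M.qError η Q₀ rew nxt t ω
          + (M.qError η Q₀ rew nxt (n + 1) ω - M.qError η Q₀ rew nxt 0 ω) := by
      rw [← Finset.sum_range_sub (fun t => M.qError η Q₀ rew nxt t ω), ← Finset.sum_add_distrib]
      exact Finset.sum_congr rfl fun t _ => by abel
    have h2 := norm_qError_le hη' hM hπ hQ (n + 1) ω
    have h3 := norm_qError_le hη' hM hπ hQ 0 ω
    have h4 : ‖M.qError η Q₀ rew nxt 0 ω‖ ≤ M.horizon := hQ
    have h5 : M.horizon * ((η 1)⁻¹ * ‖M.qError η Q₀ rew nxt 0 ω‖)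
        ≤ M.horizon * ((η 1)⁻¹ * M.horizon) := by
      have := M.horizon_pos
      have := hη.pos 1
      gcongr
    rw [e1, e2]
    refine (norm_add_le _ _).trans ?_
    have h6 := norm_sub_le (M.qError η Q₀ rew nxt (n + 1) ω) (M.qError η Q₀ rew nxt 0 ω)
    simp only [mul_assoc, ← Finset.mul_sum] at h1 ⊢
    linarith
  rw [← integral_const_mul]
  refine (integral_mono ((integrable_norm_avgQLearning_sub hη' hM hπ hQ (by omega)).const_mul _)
    (((((ia.add ib).add ic).add i3).add i4).add id) pointwise).trans_eq ?_
  rw [integral_add' (((((ia.add ib).add ic).add i3).add i4)) id,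
    integral_add' ((((ia.add ib).add ic).add i3)) i4, integral_add' ((ia.add ib).add ic) i3,
    integral_add' (ia.add ib) ic, integral_add' ia ib,
    integral_finsetSum _ fun t _ => (i1 (t + 1)).const_mul _,
    integral_finsetSum _ fun t _ => (i2 t).const_mul _]
  simp only [integral_const_mul, integral_const, probReal_univ, smul_eq_mul, one_mul, mul_assoc,
    ← Finset.mul_sum]
  ring

end DiscountedMDP

/-! ### Moments and the averaged error under polynomial step sizes -/

theorem log_two_mul_le {D : ℕ} (hD : 2 ≤ D) : Real.log (2 * D) ≤ 2 * Real.log D := by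
  have hD' : (2 : ℝ) ≤ D := by exact_mod_cast hD
  rw [Real.log_mul two_ne_zero (by positivity)]
  linarith [Real.log_le_log two_pos hD']

theorem one_le_log_two_mul {D : ℕ} (hD : 2 ≤ D) : 1 ≤ Real.log (2 * D) := by
  have hD' : (2 : ℝ) ≤ D := by exact_mod_cast hD
  rw [Real.le_log_iff_exp_le (by positivity)]
  linarith [Real.exp_one_lt_d9]

theorem polyStep_antitone {α : ℝ} (hα : 0 < α) : Antitone (polyStep α) := by
  refine antitone_nat_of_succ_le fun t => ?_
  cases t with
  | zero => rw [polyStep_zero]; exact polyStep_le_one hα 1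
  | succ t =>
    rw [polyStep_succ, polyStep_succ]
    push_cast
    exact Real.rpow_le_rpow_of_nonpos (by positivity) (by linarith) (by linarith)

namespace DiscountedMDP

variable {S A : Type*} [Fintype S] [Fintype A] [DecidableEq S] [DecidableEq A]
  [MeasurableSpace S] [MeasurableSingletonClass S] {M : DiscountedMDP S A}
  {Ω : Type*} [mΩ : MeasurableSpace Ω] {μ : Measure Ω} [IsProbabilityMeasure μ]
  {Q₀ : S × A → ℝ} {rew : ℕ → S × A → Ω → ℝ} {nxt : ℕ → S × A → Ω → S}
  {πs : S → PMF A}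

theorem one_div_horizon : 1 / M.horizon = 1 - M.γ := one_div_one_div _

section Poly

variable {α : ℝ} (hα₀ : 0 < α) (hα : α < 1) (hM : M.IsBoundedModel μ rew nxt)
  (hπ : M.IsOptimal πs) (hQ : ‖Q₀ - M.optQ‖ ≤ M.horizon) (hD : 2 ≤ Fintype.card (S × A))

include hα₀ hα hM hπ hQ hD

theorem integral_norm_qError_polyStep_sq_le (t : ℕ) :
    ∫ ω, ‖M.qError (polyStep α) Q₀ rew nxt t ω‖ ^ 2 ∂μ
      ≤ 490 * Real.log (2 * Fintype.card (S × A)) * M.horizon ^ 4 * (6 * polyStep α t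
        + 2 * min 1 ((2 * M.horizon) ^ (1 / (1 - α)) / t) ^ 2) := by
  have hη := isStepSize_polyStep hα₀ hα
  have hh := M.one_le_horizon
  have hℓ := one_le_log_two_mul hD
  set ℓ := Real.log (2 * Fintype.card (S × A)) with hℓdef
  have hK : 0 ≤ 490 * ℓ * M.horizon ^ 4 := by positivity
  have h24 : M.horizon ^ 2 ≤ M.horizon ^ 4 := pow_le_pow_right₀ hh (by norm_num)
  have h0 := integral_norm_sub_noiseAverage_sq_zero_le (η := polyStep α) hη hM hπ hQ
  have hy := le_of_polyStep_recursion hα₀ hα hh hK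
    (y := fun t => ∫ ω, ‖M.qError (polyStep α) Q₀ rew nxt t ω
      - M.noiseAverage (polyStep α) Q₀ rew nxt t ω‖ ^ 2 ∂μ)
    (h0.trans (by nlinarith [pow_pos M.horizon_pos 4])) (fun t => by
      rw [one_div_horizon]
      exact integral_norm_sub_noiseAverage_sq_le hη hM hπ hQ hD t) t
  have h1 := integral_norm_qError_sq_le hη hM hπ hQ hD t
  have h2 : 980 * ℓ * M.horizon ^ 2 * polyStep α t ≤ 980 * ℓ * M.horizon ^ 4 * polyStep α t := by
    have := (polyStep_pos (α := α) t).le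
    gcongr
  rw [← hℓdef] at h1
  linarith

/-- Uses `min(1, ρ)² ≤ ρ`, after which the transient sums to `τ` times a logarithm. The constant
`3025 = 55²` rounds up `6 · 490`. -/
theorem integral_norm_qError_polyStep_sq_succ_le (t : ℕ) :
    ∫ ω, ‖M.qError (polyStep α) Q₀ rew nxt (t + 1) ω‖ ^ 2 ∂μ
      ≤ 3025 * Real.log (2 * Fintype.card (S × A)) * M.horizon ^ 4 * (polyStep α (t + 1)
        + (2 * M.horizon) ^ (1 / (1 - α)) * (1 / ((t : ℝ) + 1))) := by
  refine (integral_norm_qError_polyStep_sq_le hα₀ hα hM hπ hQ hD (t + 1)).trans ?_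
  have hℓ := one_le_log_two_mul hD
  set ℓ := Real.log (2 * Fintype.card (S × A)) with hℓdef
  have hh := M.horizon_pos
  have hp := (polyStep_pos (α := α) (t + 1)).le
  have hτ : 0 ≤ (2 * M.horizon) ^ (1 / (1 - α)) / ((t + 1 : ℕ) : ℝ) := by positivity
  have h1 : min 1 ((2 * M.horizon) ^ (1 / (1 - α)) / ((t + 1 : ℕ) : ℝ)) ^ 2
      ≤ (2 * M.horizon) ^ (1 / (1 - α)) / ((t + 1 : ℕ) : ℝ) := by
    rw [sq]
    calc _ ≤ 1 * ((2 * M.horizon) ^ (1 / (1 - α)) / ((t + 1 : ℕ) : ℝ)) :=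
          mul_le_mul (min_le_left _ _) (min_le_right _ _) (le_min zero_le_one hτ) zero_le_one
      _ = _ := one_mul _
  have e : (2 * M.horizon) ^ (1 / (1 - α)) * (1 / ((t : ℝ) + 1))
      = (2 * M.horizon) ^ (1 / (1 - α)) / ((t + 1 : ℕ) : ℝ) := by push_cast; ring
  rw [e]
  set ρ := (2 * M.horizon) ^ (1 / (1 - α)) / ((t + 1 : ℕ) : ℝ)
  have h2 : 6 * polyStep α (t + 1) + 2 * min 1 ρ ^ 2 ≤ 6 * (polyStep α (t + 1) + ρ) := by linarith
  calc _ ≤ 490 * ℓ * M.horizon ^ 4 * (6 * (polyStep α (t + 1) + ρ)) :=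
        mul_le_mul_of_nonneg_left h2 (by positivity)
    _ ≤ _ := by
        have : 0 ≤ ℓ * M.horizon ^ 4 * (polyStep α (t + 1) + ρ) := by positivity
        linarith

/-- Cauchy–Schwarz applied to the second moment; as the transient there is controlled by a square,
its root is `τ/t` and not `√(τ/t)`. -/
theorem integral_norm_qError_polyStep_succ_le (t : ℕ) :
    ∫ ω, ‖M.qError (polyStep α) Q₀ rew nxt (t + 1) ω‖ ∂μ
      ≤ 55 * √(Real.log (2 * Fintype.card (S × A))) * M.horizon ^ 2
        * (((t : ℝ) + 1) ^ (-(α / 2))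
          + (2 * M.horizon) ^ (1 / (1 - α)) * (1 / ((t : ℝ) + 1))) := by
  have hη := isStepSize_polyStep hα₀ hα
  have hη' : ∀ t, 0 ≤ polyStep α t ∧ polyStep α t ≤ 1 := fun t => ⟨(hη.pos t).le, hη.le_one t⟩
  have h1 := sq_integral_le (integrable_norm_qError hη' hM hπ hQ (t + 1))
    (integrable_norm_qError_sq hη' hM hπ hQ (t + 1))
  have h2 := integral_norm_qError_polyStep_sq_le hα₀ hα hM hπ hQ hD (t + 1)
  have hℓ := one_le_log_two_mul hD
  set ℓ := Real.log (2 * Fintype.card (S × A)) with hℓdef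
  have hh := M.horizon_pos
  have ht : (0 : ℝ) < (t : ℝ) + 1 := by positivity
  have e : (2 * M.horizon) ^ (1 / (1 - α)) * (1 / ((t : ℝ) + 1))
      = (2 * M.horizon) ^ (1 / (1 - α)) / ((t + 1 : ℕ) : ℝ) := by push_cast; ring
  rw [e]
  set ρ := (2 * M.horizon) ^ (1 / (1 - α)) / ((t + 1 : ℕ) : ℝ) with hρ
  have hρ0 : 0 ≤ ρ := by positivity
  set σ := ((t : ℝ) + 1) ^ (-(α / 2)) with hσ
  have hσ0 : 0 ≤ σ := by positivity
  have hσ2 : polyStep α (t + 1) = σ ^ 2 := by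
    rw [polyStep_succ, hσ, ← Real.rpow_natCast, ← Real.rpow_mul ht.le]
    congr 1; push_cast; ring
  have hm : min 1 ρ ^ 2 ≤ ρ ^ 2 :=
    pow_le_pow_left₀ (le_min zero_le_one hρ0) (min_le_right _ _) 2
  rw [hσ2] at h2
  refine (le_abs_self _).trans (abs_le_of_sq_le_sq (h1.trans (h2.trans ?_)) (by positivity))
  have e2 : (55 * √ℓ * M.horizon ^ 2 * (σ + ρ)) ^ 2
      = 3025 * (√ℓ ^ 2 * M.horizon ^ 4 * (σ + ρ) ^ 2) := by ring
  rw [e2, Real.sq_sqrt (by linarith)]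
  have h3 : 6 * σ ^ 2 + 2 * min 1 ρ ^ 2 ≤ 6 * (σ + ρ) ^ 2 := by nlinarith [mul_nonneg hσ0 hρ0]
  have h4 := mul_le_mul_of_nonneg_left h3 (by positivity : 0 ≤ 490 * ℓ * M.horizon ^ 4)
  have : 0 ≤ ℓ * M.horizon ^ 4 * (σ + ρ) ^ 2 := by positivity
  linarith

/-- The bound for the averaged iterates before the terms are collected. -/
theorem integral_norm_avgQLearning_polyStep_le {L : ℝ} (hL : M.LipschitzCondition πs L)
    (hL0 : 0 ≤ L) {T : ℕ} (hT : 1 ≤ T) {ℓ B F : ℝ}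
    (hℓ : ℓ = Real.log (2 * Fintype.card (S × A))) (hB : B = 55 * √ℓ * M.horizon ^ 2)
    (hF : F = M.horizon ^ 2 + 3025 * ℓ * M.horizon ^ 4 * ((T : ℝ) ^ (1 - α) / (1 - α)
      + (2 * M.horizon) ^ (1 / (1 - α)) * (1 + Real.log T))) :
    (T : ℝ) * ∫ ω, ‖M.avgQLearning (polyStep α) Q₀ rew nxt T ω - M.optQ‖ ∂μ
      ≤ 3 * √(T * ‖(M.varQ μ rew nxt πs).diag‖ * ℓ) + 2 * M.horizon ^ 2 * ℓ + 6 * M.horizon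
        + M.horizon * (M.horizon + B * (4 * (T : ℝ) ^ (α / 2)
          + 2 * ((2 * M.horizon) ^ (1 / (1 - α)) * (1 + Real.log T))))
        + 8 * √(M.horizon ^ 2 * F * ℓ) + M.γ * L * M.horizon * F := by
  have hη := isStepSize_polyStep hα₀ hα
  have hη' : ∀ t, 0 ≤ polyStep α t ∧ polyStep α t ≤ 1 := fun t => ⟨(hη.pos t).le, hη.le_one t⟩
  have hcard : Nonempty (S × A) := Fintype.card_pos_iff.1 (by omega)
  have hh := M.horizon_pos
  have hh1 := M.one_le_horizon
  have hγ := M.γ_pos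
  have hβ : 0 < 1 - α := by linarith
  have hℓ1 : 1 ≤ ℓ := hℓ ▸ one_le_log_two_mul hD
  obtain ⟨n, rfl⟩ : ∃ n, T = n + 1 := ⟨T - 1, by omega⟩
  have hn : (0 : ℝ) < (n : ℝ) + 1 := by positivity
  have hcast : ((n + 1 : ℕ) : ℝ) = (n : ℝ) + 1 := by push_cast; ring
  have hlog : 0 ≤ Real.log ((n + 1 : ℕ) : ℝ) := Real.log_natCast_nonneg _
  have hsumdiv := sum_one_div_le (Nat.le_succ n)
  have main := integral_norm_avgQLearning_sub_le hη (polyStep_antitone hα₀) hM hπ hQ hL hL0 n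
  set τ := (2 * M.horizon) ^ (1 / (1 - α)) with hτ
  have hτ0 : 0 ≤ τ := by positivity
  have hB0 : 0 ≤ B := by rw [hB]; positivity
  have inv_eq : ∀ t : ℕ, (polyStep α (t + 1))⁻¹ = ((t : ℝ) + 1) ^ α := fun t => by
    rw [polyStep_succ, Real.rpow_neg (by positivity), inv_inv]
  have he : ∀ t, ∫ ω, ‖M.qError (polyStep α) Q₀ rew nxt (t + 1) ω‖ ∂μ
      ≤ B * (((t : ℝ) + 1) ^ (-(α / 2)) + τ * (1 / ((t : ℝ) + 1))) := fun t => by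
    rw [hB, hℓ]; exact integral_norm_qError_polyStep_succ_le hα₀ hα hM hπ hQ hD t
  have hf : ∑ t ∈ Finset.range (n + 1), ∫ ω, ‖M.qError (polyStep α) Q₀ rew nxt t ω‖ ^ 2 ∂μ
      ≤ F := by
    rw [Finset.sum_range_succ']
    have h0 : ∫ ω, ‖M.qError (polyStep α) Q₀ rew nxt 0 ω‖ ^ 2 ∂μ ≤ M.horizon ^ 2 := by
      have e : ∀ ω, ‖M.qError (polyStep α) Q₀ rew nxt 0 ω‖ = ‖Q₀ - M.optQ‖ := fun ω => rfl
      simp only [e, integral_const, probReal_univ, smul_eq_mul, one_mul]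
      exact pow_le_pow_left₀ (norm_nonneg _) hQ 2
    have h1 : ∑ t ∈ Finset.range n,
        ∫ ω, ‖M.qError (polyStep α) Q₀ rew nxt (t + 1) ω‖ ^ 2 ∂μ
        ≤ 3025 * ℓ * M.horizon ^ 4 * (((n + 1 : ℕ) : ℝ) ^ (1 - α) / (1 - α)
          + τ * (1 + Real.log ((n + 1 : ℕ) : ℝ))) := by
      calc _ ≤ ∑ t ∈ Finset.range n, 3025 * ℓ * M.horizon ^ 4
            * (polyStep α (t + 1) + τ * (1 / ((t : ℝ) + 1))) :=
            Finset.sum_le_sum fun t _ => by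
              rw [hℓ]; exact integral_norm_qError_polyStep_sq_succ_le hα₀ hα hM hπ hQ hD t
        _ = 3025 * ℓ * M.horizon ^ 4 * (∑ t ∈ Finset.range n, polyStep α (t + 1)
            + τ * ∑ t ∈ Finset.range n, 1 / ((t : ℝ) + 1)) := by
            rw [← Finset.mul_sum, Finset.sum_add_distrib, ← Finset.mul_sum]
        _ ≤ _ := by
            refine mul_le_mul_of_nonneg_left (add_le_add ((sum_polyStep_le hα₀ hα n).trans ?_)
              (mul_le_mul_of_nonneg_left hsumdiv hτ0)) (by positivity)
            refine div_le_div_of_nonneg_right ?_ hβ.le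
            exact Real.rpow_le_rpow (Nat.cast_nonneg n) (by rw [hcast]; linarith) hβ.le
    rw [hF]
    linarith
  have hFpos : 0 < F := by
    rw [hF]
    have : 0 ≤ ((n + 1 : ℕ) : ℝ) ^ (1 - α) / (1 - α) := by positivity
    positivity
  have hZ : ∫ ω, ‖∑ t ∈ Finset.range (n + 1),
      (M.resolvent πs).mulVec (M.bellmanNoise rew nxt (t + 1) ω)‖ ∂μ
      ≤ 3 * √(((n + 1 : ℕ) : ℝ) * ‖(M.varQ μ rew nxt πs).diag‖ * ℓ)
        + 2 * M.horizon ^ 2 * ℓ := by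
    rw [hℓ]
    refine integral_norm_sum_bellmanNoise_le hM hπ hD (n + 1) (fun _ => M.resolvent πs)
      (by positivity) (by positivity) (fun j _ i k => ?_) fun i => ?_
    · rw [sq]
      exact mul_le_mul_of_nonneg_right
        (Matrix.abs_apply_le_of_norm_mulVec_le (M.norm_resolvent_mulVec_le πs) i k) hh.le
    · rw [Finset.sum_const, Finset.card_range, nsmul_eq_mul]
      refine mul_le_mul_of_nonneg_left ?_ (Nat.cast_nonneg _)
      refine le_trans (le_of_eq ?_) ((le_abs_self _).trans
        (norm_le_pi_norm (M.varQ μ rew nxt πs).diag i))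
      simp only [Matrix.diag_apply, varQ, Matrix.mul_apply, Matrix.transpose_apply]
      refine Finset.sum_congr rfl fun k _ => ?_
      -- Off-diagonal covariances vanish, so the entry `(G Var(Z) Gᵀ)_{ii}` collapses to `∑_k
      -- G_{ik}² Var(Z)_{kk}`.
      rw [Finset.sum_eq_single k (fun l _ hl => by rw [hM.varZ_eq_zero hπ hl, mul_zero])
        (fun h => absurd (Finset.mem_univ k) h), resolvent]
      ring
  have hW : ∫ ω, ‖∑ t ∈ Finset.range (n + 1),
      (M.resolvent πs).mulVec (M.transitionNoise (polyStep α) Q₀ rew nxt t ω)‖ ∂μ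
      ≤ 8 * √(M.horizon ^ 2 * F * ℓ) := by
    rw [hℓ]
    refine integral_norm_sum_transitionNoise_le hη' hM hπ hQ (n + 1) (fun _ => M.resolvent πs)
      (β := fun _ => M.horizon) (fun _ => hh.le) (fun _ => M.norm_resolvent_mulVec_le πs)
      (by positivity) ?_
    rw [← Finset.mul_sum]
    exact mul_le_mul_of_nonneg_left hf (by positivity)
  -- `η_{n+1}⁻¹ = (n+1)^α` against the decay `(n+1)^{-α/2}` leaves `(n+1)^{α/2}`; against the
  -- transient `τ/(n+1)` it leaves at most `τ`.
  have hlast : (polyStep α (n + 1))⁻¹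
      * ∫ ω, ‖M.qError (polyStep α) Q₀ rew nxt (n + 1) ω‖ ∂μ
      ≤ B * (((n : ℝ) + 1) ^ (α / 2) + τ * 1) := by
    rw [inv_eq]
    refine (mul_le_mul_of_nonneg_left (he n) (by positivity)).trans ?_
    rw [mul_left_comm, mul_add, ← Real.rpow_add hn, show α + -(α / 2) = α / 2 by ring,
      mul_left_comm _ τ]
    refine mul_le_mul_of_nonneg_left (add_le_add le_rfl (mul_le_mul_of_nonneg_left ?_ hτ0)) hB0
    rw [mul_one_div, div_le_one hn]
    calc ((n : ℝ) + 1) ^ α ≤ ((n : ℝ) + 1) ^ (1 : ℝ) :=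
          Real.rpow_le_rpow_of_exponent_le (by linarith [Nat.cast_nonneg (α := ℝ) n]) hα.le
      _ = _ := Real.rpow_one _
  -- Against the transient the increments of `η⁻¹` are bounded by `1`; against the main decay they
  -- telescope.
  have hmid : ∑ t ∈ Finset.range n, ((polyStep α (t + 2))⁻¹ - (polyStep α (t + 1))⁻¹)
      * ∫ ω, ‖M.qError (polyStep α) Q₀ rew nxt (t + 1) ω‖ ∂μ
      ≤ B * (3 * ((n : ℝ) + 1) ^ (α / 2) + τ * (1 + Real.log ((n + 1 : ℕ) : ℝ))) := by
    calc _ ≤ ∑ t ∈ Finset.range n, B * ((((t : ℝ) + 2) ^ α - ((t : ℝ) + 1) ^ α)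
            * ((t : ℝ) + 1) ^ (-(α / 2)) + τ * (1 / ((t : ℝ) + 1))) := by
          refine Finset.sum_le_sum fun t _ => ?_
          rw [inv_eq t, inv_eq (t + 1)]
          have e2 : ((t + 1 : ℕ) : ℝ) + 1 = (t : ℝ) + 2 := by push_cast; ring
          rw [e2]
          have hd0 : 0 ≤ ((t : ℝ) + 2) ^ α - ((t : ℝ) + 1) ^ α :=
            sub_nonneg.2 (Real.rpow_le_rpow (by positivity) (by linarith) hα₀.le)
          have hd1 := rpow_add_two_sub_le_one hα₀ hα t
          refine (mul_le_mul_of_nonneg_left (he t) hd0).trans ?_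
          rw [mul_left_comm, mul_add]
          refine mul_le_mul_of_nonneg_left (add_le_add le_rfl ?_) hB0
          exact mul_le_of_le_one_left (by positivity) hd1
      _ = B * (∑ t ∈ Finset.range n, (((t : ℝ) + 2) ^ α - ((t : ℝ) + 1) ^ α)
            * ((t : ℝ) + 1) ^ (-(α / 2)) + τ * ∑ t ∈ Finset.range n, 1 / ((t : ℝ) + 1)) := by
          rw [← Finset.mul_sum, Finset.sum_add_distrib, ← Finset.mul_sum]
      _ ≤ _ := mul_le_mul_of_nonneg_left (add_le_add (sum_rpow_sub_mul_le hα₀ hα n)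
          (mul_le_mul_of_nonneg_left hsumdiv hτ0)) hB0
  have hη1 : (polyStep α 1)⁻¹ = 1 := by have := inv_eq 0; simpa using this
  rw [hη1, one_mul] at main
  have hfL := mul_le_mul_of_nonneg_left hf (by positivity : 0 ≤ M.γ * L * M.horizon)
  have hbd := mul_le_mul_of_nonneg_left (add_le_add (add_le_add (le_refl M.horizon) hlast) hmid)
    hh.le
  have hτB : 0 ≤ M.horizon * (B * (τ * Real.log ((n + 1 : ℕ) : ℝ))) := by positivity
  rw [hcast] at *
  have hB3 : M.horizon * (M.horizon + B * (((n : ℝ) + 1) ^ (α / 2) + τ * 1)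
      + B * (3 * ((n : ℝ) + 1) ^ (α / 2) + τ * (1 + Real.log ((n : ℝ) + 1))))
      + M.horizon * (B * (τ * Real.log ((n : ℝ) + 1)))
      = M.horizon * (M.horizon + B * (4 * ((n : ℝ) + 1) ^ (α / 2)
          + 2 * (τ * (1 + Real.log ((n : ℝ) + 1))))) := by ring
  linarith

end Poly

end DiscountedMDP

/-! ### Collecting terms for part (a) -/

/-- Each of the three summands of `F` contributes at most the square of one summand on the right,
since `ℓ`, `A₁` and `g` are at least `1`. -/
theorem sqrt_noise_terms_le {h g A₁ ℓ s w F : ℝ} (hh : 0 < h) (hA : 1 ≤ A₁) (hℓ : 1 ≤ ℓ)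
    (hg : 1 ≤ g) (hs : 0 ≤ s) (hw : w = s ^ 2)
    (hF : F = h ^ 2 + 3025 * ℓ * h ^ 4 * (w * A₁ + g)) :
    √(h ^ 2 * F * ℓ) ≤ h ^ 2 * ℓ + 55 * ℓ * h ^ 3 * A₁ * s + 55 * ℓ * h ^ 3 * g := by
  refine Real.sqrt_le_iff.2 ⟨by positivity, ?_⟩
  set x := h ^ 2 * ℓ with hx
  set y := 55 * ℓ * h ^ 3 * A₁ * s with hy
  set z := 55 * ℓ * h ^ 3 * g with hz
  have hx0 : 0 ≤ x := by positivity
  have hy0 : 0 ≤ y := by positivity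
  have hz0 : 0 ≤ z := by positivity
  have e1 : h ^ 2 * h ^ 2 * ℓ ≤ x ^ 2 := by
    rw [hx, mul_pow]
    have : ℓ ≤ ℓ ^ 2 := le_self_pow₀ hℓ two_ne_zero
    have := mul_le_mul_of_nonneg_left this (by positivity : 0 ≤ h ^ 4)
    linarith
  have e2 : h ^ 2 * (3025 * ℓ * h ^ 4 * (w * A₁)) * ℓ ≤ y ^ 2 := by
    rw [hy, hw]
    have : A₁ ≤ A₁ ^ 2 := le_self_pow₀ hA two_ne_zero
    have := mul_le_mul_of_nonneg_left this (by positivity : 0 ≤ 3025 * ℓ ^ 2 * h ^ 6 * s ^ 2)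
    linarith
  have e3 : h ^ 2 * (3025 * ℓ * h ^ 4 * g) * ℓ ≤ z ^ 2 := by
    rw [hz]
    have := le_self_pow₀ hg two_ne_zero
    have := mul_le_mul_of_nonneg_left this (by positivity : 0 ≤ 3025 * ℓ ^ 2 * h ^ 6)
    linarith
  have e4 : h ^ 2 * F * ℓ = h ^ 2 * h ^ 2 * ℓ + h ^ 2 * (3025 * ℓ * h ^ 4 * (w * A₁)) * ℓ
      + h ^ 2 * (3025 * ℓ * h ^ 4 * g) * ℓ := by rw [hF]; ring
  nlinarith [mul_nonneg hx0 hy0, mul_nonneg hx0 hz0, mul_nonneg hy0 hz0]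

/-- Everything is multiplied by `T`. In the application `H = h^{1/(1-α)}`, `c₀ = 2^{1/(1-α)}` (so
`c₀ H` is the burn-in time), `A₁ = 1/(1-α)`, `p = T^{α/2}`, `s = T^{(1-α)/2}`, and `Λ`, `Λ₀` are the
logarithmic factors with and without `ln D`. The two bracketed terms correspond to `1/T` and
`T^{-α}`. Of `221 = 4·55 + 1`, the last unit pays for the transition noise. -/
theorem collect_polyStep_terms {h H c₀ A₁ ℓ Λ Λ₀ L γ p s w F : ℝ} {q : ℕ} (hh : 1 ≤ h)
    (hH : h ^ 2 ≤ H) (hc : 1 ≤ c₀) (hA : 1 ≤ A₁) (hℓ : 1 ≤ ℓ) (hℓΛ : ℓ ≤ 2 * Λ) (hΛ : 1 ≤ Λ)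
    (hΛ₁ : 1 ≤ Λ₀) (hΛ₀ : Λ₀ ≤ Λ) (hL : 0 ≤ L) (hγ0 : 0 ≤ γ) (hγ1 : γ ≤ 1)
    (hs : 0 ≤ s) (hw : w = s ^ 2) (hq : ∀ A, 1 ≤ A → A * s ≤ p + A ^ q)
    (hF : F = h ^ 2 + 3025 * ℓ * h ^ 4 * (w * A₁ + c₀ * H * Λ₀)) :
    2 * h ^ 2 * ℓ + 6 * h + h * (h + 55 * √ℓ * h ^ 2 * (4 * p + 2 * (c₀ * H * Λ₀)))
        + 8 * √(h ^ 2 * F * ℓ) + γ * L * h * F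
      ≤ 221 * √ℓ * h ^ 3 * p + (28 + 2 * (880 * A₁) ^ q + 7150 * c₀ + 6050 * A₁) * Λ ^ (q + 2)
        * ((1 + L) * (h ^ 3 * H ^ 2) + γ * L * (h ^ 4 * H * w)) := by
  have hh0 : 0 < h := by linarith
  have hH1 : 1 ≤ H := le_trans (one_le_pow₀ hh) hH
  have hw0 : 0 ≤ w := by rw [hw]; positivity
  set r := √ℓ with hr
  have hr2 : r ^ 2 = ℓ := Real.sq_sqrt (by linarith)
  have hr1 : 1 ≤ r := Real.one_le_sqrt.2 hℓ
  have hrℓ : r ≤ ℓ := by nlinarith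
  set Λk := Λ ^ (q + 2) with hΛk
  set U := (1 + L) * (h ^ 3 * H ^ 2) with hU
  set V := γ * L * (h ^ 4 * H * w) with hV
  have mono : ∀ a b m : ℕ, a ≤ 3 → b ≤ 2 → m ≤ q + 2 →
      Λ ^ m * (h ^ a * H ^ b) ≤ Λk * (h ^ 3 * H ^ 2) := by
    intro a b m ha hb hm
    have h1 := pow_le_pow_right₀ hh ha
    have h2 := pow_le_pow_right₀ hH1 hb
    have h3 := pow_le_pow_right₀ hΛ hm
    gcongr
  have monoL : ∀ a b m : ℕ, a ≤ 3 → b ≤ 2 → m ≤ q + 2 →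
      Λ ^ m * (h ^ a * H ^ b) + L * (Λ ^ m * (h ^ a * H ^ b)) ≤ Λk * U := by
    intro a b m ha hb hm
    have := mono a b m ha hb hm
    have := mul_le_mul_of_nonneg_left this hL
    rw [hU]
    linarith
  have mono1 : ∀ a b m : ℕ, a ≤ 3 → b ≤ 2 → m ≤ q + 2 → Λ ^ m * (h ^ a * H ^ b) ≤ Λk * U := by
    intro a b m ha hb hm
    have := monoL a b m ha hb hm
    have : 0 ≤ L * (Λ ^ m * (h ^ a * H ^ b)) := by positivity
    linarith
  have mono2 : ∀ a b m : ℕ, a ≤ 3 → b ≤ 2 → m ≤ q + 2 →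
      γ * L * (Λ ^ m * (h ^ a * H ^ b)) ≤ Λk * U := by
    intro a b m ha hb hm
    have := monoL a b m ha hb hm
    have h0 : 0 ≤ Λ ^ m * (h ^ a * H ^ b) := by positivity
    have : γ * (L * (Λ ^ m * (h ^ a * H ^ b))) ≤ L * (Λ ^ m * (h ^ a * H ^ b)) :=
      mul_le_of_le_one_left (by positivity) hγ1
    linarith
  have t1 : 2 * h ^ 2 * ℓ ≤ 4 * (Λk * U) := by
    have := mono1 2 0 1 (by omega) (by omega) (by omega)
    have := mul_le_mul_of_nonneg_left hℓΛ (by positivity : 0 ≤ 2 * h ^ 2)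
    simp only [pow_one, pow_zero, mul_one] at *
    linarith
  have t2 : 6 * h ≤ 6 * (Λk * U) := by
    have := mono1 1 0 0 (by omega) (by omega) (by omega)
    simp only [pow_one, pow_zero, mul_one, one_mul] at this
    linarith
  have t3 : h ^ 2 ≤ Λk * U := by
    have := mono1 2 0 0 (by omega) (by omega) (by omega)
    simpa only [pow_zero, mul_one, one_mul] using this
  have hlΛ₀ : ℓ * Λ₀ ≤ 2 * Λ ^ 2 := by
    calc ℓ * Λ₀ ≤ (2 * Λ) * Λ := mul_le_mul hℓΛ hΛ₀ (by linarith) (by linarith)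
      _ = _ := by ring
  have t4' : ℓ * h ^ 3 * (c₀ * H * Λ₀) ≤ 2 * c₀ * (Λk * U) := by
    have h1 := mono1 3 1 2 (by omega) (by omega) (by omega)
    have h2 := mul_le_mul_of_nonneg_left hlΛ₀ (by positivity : 0 ≤ c₀ * h ^ 3 * H)
    have h3 := mul_le_mul_of_nonneg_left h1 (by positivity : 0 ≤ 2 * c₀)
    rw [pow_one] at h3
    linarith
  have t4 : 110 * r * h ^ 3 * (c₀ * H * Λ₀) ≤ 220 * c₀ * (Λk * U) := by
    have h1 := mul_le_mul_of_nonneg_right hrℓ (by positivity : 0 ≤ h ^ 3 * (c₀ * H * Λ₀))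
    linarith
  have t5 : h ^ 2 * ℓ ≤ 2 * (Λk * U) := by linarith
  -- The transition noise is of order `T^{(1-α)/2}` but carries `ℓ` instead of `√ℓ`; `hq` absorbs it
  -- into `√ℓ h³ T^{α/2}` plus a power of the logarithm.
  have t6 : 440 * ℓ * h ^ 3 * A₁ * s ≤ r * h ^ 3 * p + 2 * (880 * A₁) ^ q * (Λk * U) := by
    have h1 := hq (440 * r * A₁)
      (one_le_mul_of_one_le_of_one_le (by linarith) hA)
    have h2 := mul_le_mul_of_nonneg_left h1 (by positivity : 0 ≤ r * h ^ 3)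
    have h3 : (440 * r * A₁) ^ q ≤ (880 * A₁) ^ q * Λ ^ q := by
      rw [← mul_pow]
      refine pow_le_pow_left₀ (by positivity) ?_ q
      have : A₁ * r ≤ A₁ * (2 * Λ) :=
        mul_le_mul_of_nonneg_left (hrℓ.trans hℓΛ) (by linarith)
      linarith
    have h4 : r * (440 * r * A₁) ^ q ≤ (2 * Λ) * ((880 * A₁) ^ q * Λ ^ q) :=
      mul_le_mul (hrℓ.trans hℓΛ) h3 (by positivity) (by positivity)
    have h5 := mul_le_mul_of_nonneg_left h4 (by positivity : 0 ≤ h ^ 3)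
    have h6 := mul_le_mul_of_nonneg_left (mono1 3 0 (q + 1) (by omega) (by omega) (by omega))
      (by positivity : 0 ≤ 2 * (880 * A₁) ^ q)
    rw [pow_zero, mul_one, pow_succ] at h6
    have e : r * h ^ 3 * (440 * r * A₁ * s) = 440 * ℓ * h ^ 3 * A₁ * s := by rw [← hr2]; ring
    linarith
  have hg : 1 ≤ c₀ * H * Λ₀ :=
    one_le_mul_of_one_le_of_one_le (one_le_mul_of_one_le_of_one_le hc hH1) hΛ₁
  have t8 := sqrt_noise_terms_le hh0 hA hℓ hg hs hw hF
  have t9 : γ * L * h * h ^ 2 ≤ Λk * U := by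
    have := mono2 3 0 0 (by omega) (by omega) (by omega)
    simp only [pow_zero, mul_one, one_mul] at this
    linarith
  -- The fifth power of `h` from the quadratic error fits because `h² ≤ H`, which in the application
  -- means `1/(1-α) ≥ 2`.
  have h5H : h ^ 5 ≤ h ^ 3 * H := by
    have := mul_le_mul_of_nonneg_left hH (by positivity : 0 ≤ h ^ 3)
    linarith
  have t10 : γ * L * h * (3025 * ℓ * h ^ 4 * (w * A₁)) ≤ 6050 * A₁ * (Λk * V) := by
    have h1 : Λ ≤ Λk := le_self_pow₀ hΛ (by omega)
    have h2 : ℓ * h ^ 5 ≤ (2 * Λk) * (h ^ 4 * H) := by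
      refine mul_le_mul (by linarith) (h5H.trans ?_) (by positivity) (by positivity)
      have := mul_le_mul_of_nonneg_left hh (by positivity : 0 ≤ h ^ 3 * H)
      linarith
    have h3 := mul_le_mul_of_nonneg_left h2 (by positivity : 0 ≤ 3025 * A₁ * (γ * L) * w)
    rw [hV]
    linarith
  have t11 : γ * L * h * (3025 * ℓ * h ^ 4 * (c₀ * H * Λ₀)) ≤ 6050 * c₀ * (Λk * U) := by
    have h1 := mono2 3 2 2 (by omega) (by omega) (by omega)
    have h2 : (ℓ * Λ₀) * h ^ 5 ≤ (2 * Λ ^ 2) * (h ^ 3 * H) :=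
      mul_le_mul hlΛ₀ h5H (by positivity) (by positivity)
    have h3 := mul_le_mul_of_nonneg_left h2 (by positivity : 0 ≤ 3025 * c₀ * (γ * L) * H)
    have h4 := mul_le_mul_of_nonneg_left h1 (by positivity : 0 ≤ 6050 * c₀)
    linarith
  have hUV : 0 ≤ Λk * V := by positivity
  have hUU : 0 ≤ Λk * U := by positivity
  have rest : 0 ≤ (28 + 2 * (880 * A₁) ^ q + 7150 * c₀) * (Λk * V) := by positivity
  have rest2 : 0 ≤ 6050 * A₁ * (Λk * U) := by positivity
  have eF : γ * L * h * F = γ * L * h * h ^ 2 + γ * L * h * (3025 * ℓ * h ^ 4 * (w * A₁))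
      + γ * L * h * (3025 * ℓ * h ^ 4 * (c₀ * H * Λ₀)) := by rw [hF]; ring
  have eB : h * (h + 55 * r * h ^ 2 * (4 * p + 2 * (c₀ * H * Λ₀)))
      = h ^ 2 + 220 * (r * h ^ 3 * p) + 110 * r * h ^ 3 * (c₀ * H * Λ₀) := by ring
  rw [eF, eB]
  linarith

namespace DiscountedMDP

variable {S A : Type*} [Fintype S] [Fintype A] [DecidableEq S] [DecidableEq A]
  [MeasurableSpace S] [MeasurableSingletonClass S] {M : DiscountedMDP S A}
  {Ω : Type*} [mΩ : MeasurableSpace Ω] {μ : Measure Ω} [IsProbabilityMeasure μ]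
  {Q₀ : S × A → ℝ} {rew : ℕ → S × A → Ω → ℝ} {nxt : ℕ → S × A → Ω → S}
  {πs : S → PMF A}

/-- The bound for polynomial step sizes, for a bounded model. -/
theorem IsBoundedModel.integral_norm_avgQLearning_polyStep_le {α : ℝ} (hα₀ : 1 / 2 < α)
    (hα : α < 1) {q : ℕ} (hq : ∀ A T : ℝ, 1 ≤ A → 1 ≤ T →
      A * T ^ ((1 - α) / 2) ≤ T ^ (α / 2) + A ^ q)
    (hM : M.IsBoundedModel μ rew nxt) (hπ : M.IsOptimal πs)
    (hQ : ‖Q₀ - M.optQ‖ ≤ 1 / (1 - M.γ)) (hD : 2 ≤ Fintype.card (S × A)) {L : ℝ}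
    (hL : M.LipschitzCondition πs L) {T : ℕ} (hT : 1 ≤ T) :
    ∫ ω, ‖M.avgQLearning (polyStep α) Q₀ rew nxt T ω - M.optQ‖ ∂μ ≤
      442 * (√‖(M.varQ μ rew nxt πs).diag‖ * √(Real.log (Fintype.card (S × A)) / T)
          + √(Real.log (Fintype.card (S × A))) / (1 - M.γ) ^ 3
            * (1 / (T : ℝ) ^ (1 - α / 2)))
      + (28 + 2 * (880 * (1 / (1 - α))) ^ q + 7150 * 2 ^ (1 / (1 - α)) + 6050 * (1 / (1 - α)))
        * (1 + Real.log (Fintype.card (S × A)) + Real.log T) ^ (q + 2)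
        * ((1 + L) / (1 - M.γ) ^ (3 + 2 / (1 - α)) * (1 / T)
          + M.γ * L / (1 - M.γ) ^ (4 + 1 / (1 - α)) * (1 / (T : ℝ) ^ α)) := by
  have : Nonempty (S × A) := Fintype.card_pos_iff.1 (by omega)
  have hL0 := hL.nonneg
  have hα00 : 0 < α := by linarith
  have hβ : 0 < 1 - α := by linarith
  have hγ' := M.one_sub_γ_pos
  have hh := M.one_le_horizon
  have hT1 : (1 : ℝ) ≤ T := by exact_mod_cast hT
  have hT0 : (0 : ℝ) < T := by linarith
  have hp2 : 2 ≤ 1 / (1 - α) := by rw [le_div_iff₀ hβ]; linarith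
  have main := DiscountedMDP.integral_norm_avgQLearning_polyStep_le hα00 hα hM hπ hQ hD hL hL0 hT
    rfl rfl rfl
  have hℓ1 := one_le_log_two_mul hD
  have hℓ2 := log_two_mul_le hD
  set ℓ := Real.log (2 * Fintype.card (S × A)) with hℓdef
  set d := Real.log (Fintype.card (S × A)) with hd
  set h := M.horizon with hhdef
  set H := h ^ (1 / (1 - α)) with hH
  have hd0 : 0 ≤ d := by linarith
  have hlogT : 0 ≤ Real.log T := Real.log_nonneg hT1
  have hHh : h ^ 2 ≤ H := by
    rw [hH, ← Real.rpow_natCast]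
    exact Real.rpow_le_rpow_of_exponent_le hh (by exact_mod_cast hp2)
  have hτ : (2 * h) ^ (1 / (1 - α)) = 2 ^ (1 / (1 - α)) * H :=
    Real.mul_rpow zero_le_two (by linarith)
  have hs2 : (T : ℝ) ^ (1 - α) = ((T : ℝ) ^ ((1 - α) / 2)) ^ 2 := by
    rw [← Real.rpow_natCast, ← Real.rpow_mul hT0.le]; congr 1; push_cast; ring
  have collect := collect_polyStep_terms (h := h) (H := H) (c₀ := 2 ^ (1 / (1 - α)))
    (A₁ := 1 / (1 - α)) (ℓ := ℓ) (Λ := 1 + d + Real.log T) (Λ₀ := 1 + Real.log T) (L := L)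
    (γ := M.γ) (p := (T : ℝ) ^ (α / 2)) (s := (T : ℝ) ^ ((1 - α) / 2)) (w := (T : ℝ) ^ (1 - α))
    (q := q) hh hHh (Real.one_le_rpow one_le_two (by positivity)) (by linarith) hℓ1
    (by linarith) (by linarith) (by linarith) (by linarith) hL0 M.γ_pos.le M.γ_lt_one.le
    (by positivity) hs2 (fun A hA => hq A T hA hT1) rfl
  rw [hτ, div_eq_mul_one_div ((T : ℝ) ^ (1 - α))] at main
  set I := ∫ ω, ‖M.avgQLearning (polyStep α) Q₀ rew nxt T ω - M.optQ‖ ∂μ with hI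
  set v := ‖(M.varQ μ rew nxt πs).diag‖ with hv
  have hv0 : 0 ≤ v := norm_nonneg _
  have lead : √(T * v * ℓ) ≤ T * (2 * (√v * √(d / T))) := by
    refine Real.sqrt_le_iff.2 ⟨by positivity, ?_⟩
    have e : (T * (2 * (√v * √(d / T)))) ^ 2 = 4 * T ^ 2 * (√v ^ 2 * √(d / T) ^ 2) := by ring
    rw [e, Real.sq_sqrt hv0, Real.sq_sqrt (by positivity)]
    have e2 : 4 * (T : ℝ) ^ 2 * (v * (d / T)) = T * v * (4 * d) := by field_simp
    rw [e2]
    exact mul_le_mul_of_nonneg_left (by linarith) (by positivity)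
  have hsq : √ℓ ≤ 2 * √d := by
    refine Real.sqrt_le_iff.2 ⟨by positivity, ?_⟩
    rw [mul_pow, Real.sq_sqrt hd0]
    linarith
  have second : √ℓ * h ^ 3 * (T : ℝ) ^ (α / 2)
      ≤ T * (2 * (√d / (1 - M.γ) ^ 3 * (1 / (T : ℝ) ^ (1 - α / 2)))) := by
    have e1 : (T : ℝ) ^ (α / 2) = T * (1 / (T : ℝ) ^ (1 - α / 2)) := by
      rw [Real.rpow_sub hT0, Real.rpow_one]
      field_simp
    have e2 : h ^ 3 = 1 / (1 - M.γ) ^ 3 := by rw [hhdef, horizon, one_div_pow]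
    rw [e1, e2]
    have := mul_le_mul_of_nonneg_right hsq
      (by positivity : 0 ≤ 1 / (1 - M.γ) ^ 3 * (T * (1 / (T : ℝ) ^ (1 - α / 2))))
    calc _ = √ℓ * (1 / (1 - M.γ) ^ 3 * (T * (1 / (T : ℝ) ^ (1 - α / 2)))) := by ring
      _ ≤ _ := this
      _ = _ := by ring
  have hHeq : H = 1 / (1 - M.γ) ^ (1 / (1 - α)) := by
    rw [hH, hhdef, horizon, Real.div_rpow zero_le_one hγ'.le, Real.one_rpow]
  have third : (1 + L) * (h ^ 3 * H ^ 2)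
      = T * ((1 + L) / (1 - M.γ) ^ (3 + 2 / (1 - α)) * (1 / T)) := by
    have e : (1 - M.γ) ^ (3 + 2 / (1 - α))
        = (1 - M.γ) ^ 3 * ((1 - M.γ) ^ (1 / (1 - α))) ^ 2 := by
      rw [Real.rpow_add hγ', ← Real.rpow_natCast, ← Real.rpow_natCast, ← Real.rpow_mul hγ'.le]
      congr 2
      push_cast; ring
    rw [e, hHeq, hhdef, horizon]
    field_simp
  have fourth : M.γ * L * (h ^ 4 * H * (T : ℝ) ^ (1 - α))
      = T * (M.γ * L / (1 - M.γ) ^ (4 + 1 / (1 - α)) * (1 / (T : ℝ) ^ α)) := by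
    have e : (1 - M.γ) ^ (4 + 1 / (1 - α))
        = (1 - M.γ) ^ 4 * (1 - M.γ) ^ (1 / (1 - α)) := by
      rw [Real.rpow_add hγ', ← Real.rpow_natCast]
      norm_num
    rw [e, hHeq, hhdef, horizon, Real.rpow_sub hT0, Real.rpow_one]
    field_simp
  rw [third, fourth] at collect
  refine le_of_mul_le_mul_left ?_ hT0
  have pos1 : 0 ≤ T * (√v * √(d / T)) := by positivity
  linarith

end DiscountedMDP

/-! ### The rescaled linear step size: recursion and sums -/

section LinearStep

variable {γ : ℝ}

theorem linearStep_pos (hγ : γ < 1) (t : ℕ) : 0 < linearStep γ t := by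
  have : 0 < 1 - γ := by linarith
  unfold linearStep; positivity

/-- The reason for this step size: as `η_0 = 1`, the contraction factors multiply to the step
itself, `∏_{s=1}^t (1 - (1-γ) η_s) = η_t`. -/
theorem one_sub_mul_linearStep (hγ : γ < 1) (t : ℕ) :
    (1 - (1 - γ) * linearStep γ (t + 1)) * linearStep γ t = linearStep γ (t + 1) := by
  have : 0 < 1 - γ := by linarith
  have h1 : (0 : ℝ) < 1 + (1 - γ) * t := by positivity
  have h2 : (0 : ℝ) < 1 + (1 - γ) * (t + 1 : ℕ) := by positivity
  unfold linearStep
  field_simp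
  push_cast
  ring

theorem isStepSize_linearStep (hγ₀ : 0 < γ) (hγ : γ < 1) : IsStepSize (linearStep γ) where
  zero := by simp [linearStep]
  pos := linearStep_pos hγ
  le_one t := by
    have : 0 < 1 - γ := by linarith
    have h : (0 : ℝ) ≤ (1 - γ) * t := by positivity
    unfold linearStep
    rw [div_le_one (by linarith)]
    linarith
  mul_le t := by
    have h1 := one_sub_mul_linearStep hγ t
    have h2 := (linearStep_pos hγ t).le
    have h3 := (linearStep_pos hγ (t + 1)).le
    nlinarith [mul_nonneg (mul_nonneg hγ₀.le h3) h2]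

theorem linearStep_le (hγ₀ : 0 < γ) (hγ : γ < 1) (t : ℕ) :
    linearStep γ t ≤ 1 / (1 - γ) * (1 / ((t : ℝ) + 1)) := by
  have h : 0 < 1 - γ := by linarith
  unfold linearStep
  rw [one_div_mul_one_div]
  refine one_div_le_one_div_of_le (by positivity) ?_
  linarith

theorem mul_linearStep_le (hγ₀ : 0 < γ) (hγ : γ < 1) (t : ℕ) :
    (1 - γ) * linearStep γ t ≤ 1 / ((t : ℝ) + 1) := by
  have h : 0 < 1 - γ := by linarith
  have := mul_le_mul_of_nonneg_left (linearStep_le hγ₀ hγ t) h.le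
  rwa [← mul_assoc, mul_one_div_cancel h.ne', one_mul] at this

/-- The linear recursion behind the contraction, for the rescaled linear step size. -/
theorem le_of_linearStep_recursion {K : ℝ} (hγ : γ < 1) {y : ℕ → ℝ} (h0 : y 0 ≤ K)
    (hy : ∀ t, y (t + 1) ≤ (1 - (1 - γ) * linearStep γ (t + 1)) * y t
      + (1 - γ) * linearStep γ (t + 1) * (K * linearStep γ t)) (t : ℕ) :
    y t ≤ K * (1 + ∑ s ∈ Finset.range t, (1 - γ) * linearStep γ s) * linearStep γ t := by
  induction t with
  | zero => simpa [linearStep] using h0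
  | succ t ih =>
    have h1 := one_sub_mul_linearStep hγ t
    have hp := linearStep_pos hγ t
    have hx : 0 ≤ 1 - (1 - γ) * linearStep γ (t + 1) := by
      have := linearStep_pos hγ (t + 1)
      by_contra! hneg
      nlinarith
    refine (hy t).trans ?_
    have h2 := mul_le_mul_of_nonneg_left ih hx
    rw [Finset.sum_range_succ]
    -- Divided by the step size, the recursion loses its contraction factor: each step adds at most
    -- `K (1-γ) η_t`.
    calc _ ≤ (1 - (1 - γ) * linearStep γ (t + 1))
          * (K * (1 + ∑ s ∈ Finset.range t, (1 - γ) * linearStep γ s) * linearStep γ t)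
          + (1 - γ) * linearStep γ (t + 1) * (K * linearStep γ t) := by linarith
      _ = _ := by
        linear_combination (K * (1 + ∑ s ∈ Finset.range t, (1 - γ) * linearStep γ s)) * h1

/-- Telescopes: if `a`, `b` are the roots of `n` and `n + 1`, then `b - a = 1/(a+b) ≥ 1/(2b)`. -/
theorem sum_one_div_sqrt_le (n : ℕ) :
    ∑ t ∈ Finset.range n, 1 / √((t : ℝ) + 1) ≤ 2 * √n := by
  induction n with
  | zero => simp
  | succ n ih =>
    rw [Finset.sum_range_succ]
    push_cast
    have hn : (0 : ℝ) < (n : ℝ) + 1 := by positivity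
    set a := √(n : ℝ) with ha
    set b := √((n : ℝ) + 1) with hb
    have ha2 : a ^ 2 = n := Real.sq_sqrt (Nat.cast_nonneg n)
    have hb2 : b ^ 2 = n + 1 := Real.sq_sqrt hn.le
    have hb0 : 0 < b := Real.sqrt_pos.2 hn
    have h : 1 / b ≤ 2 * (b - a) := by
      rw [div_le_iff₀ hb0]
      nlinarith [sq_nonneg (a - b)]
    linarith

end LinearStep

/-! ### Nonnegative weight matrices and part (b) -/

/-- A nonnegative matrix all of whose row sums are at most `r`. -/
def HasRowSumLE {ι : Type*} [Fintype ι] (B : Matrix ι ι ℝ) (r : ℝ) : Prop :=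
  (∀ i k, 0 ≤ B i k) ∧ ∀ i, ∑ k, B i k ≤ r

namespace HasRowSumLE

variable {ι : Type*} [Fintype ι] {B B' : Matrix ι ι ℝ} {r r' : ℝ}

theorem apply_le (h : HasRowSumLE B r) (i k : ι) : B i k ≤ r :=
  (Finset.single_le_sum (fun k _ => h.1 i k) (Finset.mem_univ k)).trans (h.2 i)

theorem mul (h : HasRowSumLE B r) (h' : HasRowSumLE B' r') (hr : 0 ≤ r') :
    HasRowSumLE (B * B') (r * r') := by
  refine ⟨fun i k => Finset.sum_nonneg fun l _ => mul_nonneg (h.1 i l) (h'.1 l k), fun i => ?_⟩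
  simp only [Matrix.mul_apply]
  rw [Finset.sum_comm]
  calc ∑ l, ∑ k, B i l * B' l k = ∑ l, B i l * ∑ k, B' l k := by simp only [Finset.mul_sum]
    _ ≤ ∑ l, B i l * r' :=
      Finset.sum_le_sum fun l _ => mul_le_mul_of_nonneg_left (h'.2 l) (h.1 i l)
    _ = (∑ l, B i l) * r' := by rw [Finset.sum_mul]
    _ ≤ _ := mul_le_mul_of_nonneg_right (h.2 i) hr

theorem norm_mulVec_le (h : HasRowSumLE B r) (hr : 0 ≤ r) (x : ι → ℝ) :
    ‖B.mulVec x‖ ≤ r * ‖x‖ := by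
  refine (pi_norm_le_iff_of_nonneg (by positivity)).2 fun i => ?_
  refine (Finset.abs_sum_le_sum_abs _ _).trans ?_
  calc ∑ k, |B i k * x k| ≤ ∑ k, B i k * ‖x‖ := by
        refine Finset.sum_le_sum fun k _ => ?_
        rw [abs_mul, abs_of_nonneg (h.1 i k)]
        exact mul_le_mul_of_nonneg_left (norm_le_pi_norm x k) (h.1 i k)
    _ = (∑ k, B i k) * ‖x‖ := by rw [Finset.sum_mul]
    _ ≤ _ := mul_le_mul_of_nonneg_right (h.2 i) (norm_nonneg _)

/-- Each entry is itself at most `r`, so the squares in a row sum to at most `r²`. -/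
theorem sum_sq_mul_le (h : HasRowSumLE B r) {σ : ι → ℝ} {V : ℝ} (hσ : ∀ k, σ k ≤ V)
    (hV : 0 ≤ V) (i : ι) : ∑ k, B i k ^ 2 * σ k ≤ r ^ 2 * V := by
  have hr : 0 ≤ r := (h.1 i i).trans (h.apply_le i i)
  calc ∑ k, B i k ^ 2 * σ k ≤ ∑ k, B i k * (r * V) := by
        refine Finset.sum_le_sum fun k _ => ?_
        have h1 := mul_le_mul_of_nonneg_left (hσ k) (sq_nonneg (B i k))
        have h2 := mul_le_mul_of_nonneg_left (h.apply_le i k) (mul_nonneg (h.1 i k) hV)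
        linarith
    _ = (∑ k, B i k) * (r * V) := by rw [Finset.sum_mul]
    _ ≤ r * (r * V) := mul_le_mul_of_nonneg_right (h.2 i) (by positivity)
    _ = _ := by ring

end HasRowSumLE

theorem apply_self_le_matrixInftyNorm {ι : Type*} [Fintype ι] (B : Matrix ι ι ℝ) (i : ι) :
    B i i ≤ matrixInftyNorm B := by
  have h := norm_le_pi_norm (fun i => ∑ j, |B i j|) i
  refine ((le_abs_self _).trans ?_).trans ((le_abs_self _).trans h)
  exact Finset.single_le_sum (f := fun j => |B i j|) (fun j _ => abs_nonneg _)
    (Finset.mem_univ i)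

namespace DiscountedMDP

variable {S A : Type*} [Fintype S] [Fintype A] [DecidableEq S] [DecidableEq A]

/-- The matrix `I - η_{t+1} (I - γ P^π)` of the linearized recursion. -/
noncomputable def stepMatrix (M : DiscountedMDP S A) (π : S → PMF A) (η : ℕ → ℝ) (t : ℕ) :
    Matrix (S × A) (S × A) ℝ := 1 - η (t + 1) • (1 - M.γ • M.transition π)

/-- The influence of the initial value on the `t`-th iterate of the linearized recursion. -/
noncomputable def initialWeight (M : DiscountedMDP S A) (π : S → PMF A) (η : ℕ → ℝ) :
    ℕ → Matrix (S × A) (S × A) ℝ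
  | 0 => 1
  | t + 1 => M.stepMatrix π η t * initialWeight M π η t

/-- The influence of the noise of iteration `j + 1` on the `t`-th iterate of the linearized
recursion. -/
noncomputable def noiseWeight (M : DiscountedMDP S A) (π : S → PMF A) (η : ℕ → ℝ) :
    ℕ → ℕ → Matrix (S × A) (S × A) ℝ
  | 0, _ => 0
  | t + 1, j => if j = t then η (t + 1) • 1 else M.stepMatrix π η t * noiseWeight M π η t j

section Weights

variable (M : DiscountedMDP S A) (π : S → PMF A) {η : ℕ → ℝ}

theorem hasRowSumLE_stepMatrix {t : ℕ} (h0 : 0 ≤ η (t + 1)) (h1 : η (t + 1) ≤ 1) :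
    HasRowSumLE (M.stepMatrix π η t) (1 - (1 - M.γ) * η (t + 1)) := by
  have hγ := M.γ_pos
  have hP : ∀ i k, 0 ≤ M.transition π i k := fun i k =>
    mul_nonneg ENNReal.toReal_nonneg ENNReal.toReal_nonneg
  have e : ∀ i k, M.stepMatrix π η t i k = (1 - η (t + 1)) * (1 : Matrix (S × A) (S × A) ℝ) i k
      + η (t + 1) * M.γ * M.transition π i k := fun i k => by
    simp only [stepMatrix, Matrix.sub_apply, Matrix.smul_apply, smul_eq_mul]
    ring
  constructor
  · intro i k
    rw [e]
    have h2 : 0 ≤ (1 : Matrix (S × A) (S × A) ℝ) i k := by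
      rw [Matrix.one_apply]; split_ifs <;> simp
    have := mul_nonneg (by linarith : 0 ≤ 1 - η (t + 1)) h2
    have := mul_nonneg (mul_nonneg h0 hγ.le) (hP i k)
    linarith
  · intro i
    have h2 : ∑ k, M.transition π i k = 1 := by
      have := congrFun (M.transition_mulVec π (fun _ => 1)) i
      simpa [Matrix.mulVec, dotProduct, next, policyValue, PMF.sum_toReal] using this
    have h3 : ∑ k, (1 : Matrix (S × A) (S × A) ℝ) i k = 1 := by simp [Matrix.one_apply]
    simp only [e, Finset.sum_add_distrib, ← Finset.mul_sum, h2, h3]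
    linarith

theorem hasRowSumLE_initialWeight (t : ℕ) :
    HasRowSumLE (M.initialWeight π (linearStep M.γ) t) (linearStep M.γ t) := by
  have hη := isStepSize_linearStep M.γ_pos M.γ_lt_one
  induction t with
  | zero =>
    rw [hη.zero]
    refine ⟨fun i k => ?_, fun i => ?_⟩
    · simp only [initialWeight, Matrix.one_apply]; split_ifs <;> simp
    · simp [initialWeight, Matrix.one_apply]
  | succ t ih =>
    rw [← one_sub_mul_linearStep M.γ_lt_one]
    exact (M.hasRowSumLE_stepMatrix π (hη.pos _).le (hη.le_one _)).mul ih (hη.pos _).le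

/-- For `j < t` the noise enters with weight `η_{j+1}` and is then contracted by factors whose
product is `η_t / η_{j+1}`, so the bound does not depend on `j`: the iterate treats all past noises
alike. -/
theorem hasRowSumLE_noiseWeight (t j : ℕ) :
    HasRowSumLE (M.noiseWeight π (linearStep M.γ) t j) (linearStep M.γ t) := by
  have hη := isStepSize_linearStep M.γ_pos M.γ_lt_one
  induction t with
  | zero => exact ⟨fun i k => by simp [noiseWeight], fun i => by simp [noiseWeight, hη.zero]⟩
  | succ t ih =>
    simp only [noiseWeight]
    split_ifs
    · have h0 := (hη.pos (t + 1)).le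
      refine ⟨fun i k => ?_, fun i => ?_⟩
      · simp only [Matrix.smul_apply, Matrix.one_apply]; split_ifs <;> simp [h0]
      · simp [Matrix.smul_apply, Matrix.one_apply]
    · rw [← one_sub_mul_linearStep M.γ_lt_one]
      exact (M.hasRowSumLE_stepMatrix π (hη.pos _).le (hη.le_one _)).mul ih (hη.pos _).le

theorem eq_sum_noiseWeight_mulVec {x e : ℕ → S × A → ℝ}
    (hx : ∀ t, x (t + 1) = (M.stepMatrix π η t).mulVec (x t) + η (t + 1) • e t) (t : ℕ) :
    x t = (M.initialWeight π η t).mulVec (x 0)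
      + ∑ j ∈ Finset.range t, (M.noiseWeight π η t j).mulVec (e j) := by
  induction t with
  | zero => simp [initialWeight]
  | succ t ih =>
    rw [hx t, Finset.sum_range_succ]
    have h1 : ∑ j ∈ Finset.range t, (M.noiseWeight π η (t + 1) j).mulVec (e j)
        = (M.stepMatrix π η t).mulVec
          (∑ j ∈ Finset.range t, (M.noiseWeight π η t j).mulVec (e j)) := by
      rw [Matrix.mulVec_sum]
      refine Finset.sum_congr rfl fun j hj => ?_
      have : j ≠ t := (Finset.mem_range.1 hj).ne
      simp only [noiseWeight, this, if_false, Matrix.mulVec_mulVec]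
    have h2 : (M.noiseWeight π η (t + 1) t).mulVec (e t) = η (t + 1) • e t := by
      simp [noiseWeight, Matrix.smul_mulVec]
    rw [h1, h2]
    conv_lhs => rw [ih]
    rw [Matrix.mulVec_add, Matrix.mulVec_mulVec, initialWeight, add_assoc]

end Weights

variable [MeasurableSpace S] [MeasurableSingletonClass S] {M : DiscountedMDP S A}
  {Ω : Type*} [mΩ : MeasurableSpace Ω] {μ : Measure Ω} [IsProbabilityMeasure μ]
  {Q₀ : S × A → ℝ} {rew : ℕ → S × A → Ω → ℝ} {nxt : ℕ → S × A → Ω → S}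
  {πs : S → PMF A}

section Linear

variable (hM : M.IsBoundedModel μ rew nxt)
  (hπ : M.IsOptimal πs) (hQ : ‖Q₀ - M.optQ‖ ≤ M.horizon) (hD : 2 ≤ Fintype.card (S × A))

include hM hπ hQ hD

/-- There is no burn-in; the only loss is the factor `1 + ln T` that bounds `∑ (1-γ) η_s`. -/
theorem integral_norm_qError_linearStep_sq_le {t T : ℕ} (ht : t ≤ T) :
    ∫ ω, ‖M.qError (linearStep M.γ) Q₀ rew nxt t ω‖ ^ 2 ∂μ
      ≤ 2940 * Real.log (2 * Fintype.card (S × A)) * M.horizon ^ 4 * (1 + Real.log T)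
        * linearStep M.γ t := by
  have hη := isStepSize_linearStep M.γ_pos M.γ_lt_one
  have hh := M.one_le_horizon
  have hℓ := one_le_log_two_mul hD
  set ℓ := Real.log (2 * Fintype.card (S × A)) with hℓdef
  have hK : 0 ≤ 490 * ℓ * M.horizon ^ 4 := by positivity
  have h24 : M.horizon ^ 2 ≤ M.horizon ^ 4 := pow_le_pow_right₀ hh (by norm_num)
  have h0 := integral_norm_sub_noiseAverage_sq_zero_le (η := linearStep M.γ) hη hM hπ hQ
  have hy := le_of_linearStep_recursion M.γ_lt_one
    (y := fun t => ∫ ω, ‖M.qError (linearStep M.γ) Q₀ rew nxt t ω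
      - M.noiseAverage (linearStep M.γ) Q₀ rew nxt t ω‖ ^ 2 ∂μ) (K := 490 * ℓ * M.horizon ^ 4)
    (h0.trans (by nlinarith [pow_pos M.horizon_pos 4]))
    (fun t => integral_norm_sub_noiseAverage_sq_le hη hM hπ hQ hD t) t
  have h1 := integral_norm_qError_sq_le hη hM hπ hQ hD t
  have hp := hη.pos t
  have h2 : 980 * ℓ * M.horizon ^ 2 * linearStep M.γ t
      ≤ 980 * ℓ * M.horizon ^ 4 * linearStep M.γ t := by gcongr
  have h3 : ∑ s ∈ Finset.range t, (1 - M.γ) * linearStep M.γ s ≤ 1 + Real.log T :=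
    (Finset.sum_le_sum fun s _ => mul_linearStep_le M.γ_pos M.γ_lt_one s).trans
      (sum_one_div_le ht)
  have h4 := mul_le_mul_of_nonneg_right (mul_le_mul_of_nonneg_left
    (add_le_add_right h3 1) hK) hp.le
  rw [← hℓdef] at h1
  have h5 : 0 ≤ 490 * ℓ * M.horizon ^ 4 * Real.log T * linearStep M.γ t := by
    have := Real.log_natCast_nonneg T
    positivity
  linarith

/-- `η_j ≤ h/(j+1)` costs the fifth power of `h` and a second logarithm. -/
theorem sum_integral_norm_qError_linearStep_sq_le {t T : ℕ} (ht : t ≤ T) :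
    ∑ j ∈ Finset.range t, ∫ ω, ‖M.qError (linearStep M.γ) Q₀ rew nxt j ω‖ ^ 2 ∂μ
      ≤ 2940 * Real.log (2 * Fintype.card (S × A)) * M.horizon ^ 5 * (1 + Real.log T) ^ 2 := by
  have hℓ := one_le_log_two_mul hD
  set ℓ := Real.log (2 * Fintype.card (S × A)) with hℓdef
  have hlog := Real.log_natCast_nonneg T
  have hh := M.horizon_pos
  calc _ ≤ ∑ j ∈ Finset.range t, 2940 * ℓ * M.horizon ^ 5 * (1 + Real.log T)
        * (1 / ((j : ℝ) + 1)) := by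
        refine Finset.sum_le_sum fun j hj => ?_
        refine (integral_norm_qError_linearStep_sq_le hM hπ hQ hD
          ((Finset.mem_range.1 hj).le.trans ht)).trans ?_
        have := mul_le_mul_of_nonneg_left (linearStep_le M.γ_pos M.γ_lt_one j)
          (by positivity : 0 ≤ 2940 * ℓ * M.horizon ^ 4 * (1 + Real.log T))
        refine this.trans_eq ?_
        change _ * (M.horizon * _) = _
        ring
    _ ≤ 2940 * ℓ * M.horizon ^ 5 * (1 + Real.log T) * (1 + Real.log T) := by
        rw [← Finset.mul_sum]
        exact mul_le_mul_of_nonneg_left (sum_one_div_le ht) (by positivity)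
    _ = _ := by ring

/-- The bound for the last iterate under the rescaled linear step size. -/
theorem integral_norm_qError_linearStep_le {L : ℝ} (hL : M.LipschitzCondition πs L) (hL0 : 0 ≤ L)
    {t T : ℕ} (ht : t + 1 ≤ T) {ℓ F V : ℝ} (hℓ : ℓ = Real.log (2 * Fintype.card (S × A)))
    (hF : F = 2940 * ℓ * M.horizon ^ 5 * (1 + Real.log T) ^ 2)
    (hV : V = matrixInftyNorm (M.varZ μ rew nxt)) :
    ∫ ω, ‖M.qError (linearStep M.γ) Q₀ rew nxt (t + 1) ω‖ ∂μ
      ≤ 3 * M.horizon * √(V * ℓ) * (1 / √((t : ℝ) + 1))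
        + M.horizon * (3 * M.horizon * ℓ + 8 * (F * ℓ) + L * F) * (1 / ((t : ℝ) + 1)) := by
  have hη := isStepSize_linearStep M.γ_pos M.γ_lt_one
  have hη' : ∀ t, 0 ≤ linearStep M.γ t ∧ linearStep M.γ t ≤ 1 := fun t =>
    ⟨(hη.pos t).le, hη.le_one t⟩
  have hcard : Nonempty (S × A) := Fintype.card_pos_iff.1 (by omega)
  have hR := hM.rewardsInUnitInterval
  have hh := M.horizon_pos
  have hh1 := M.one_le_horizon
  have hγ := M.γ_pos
  have hγ1 := M.γ_lt_one
  have hℓ1 : 1 ≤ ℓ := hℓ ▸ one_le_log_two_mul hD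
  have hlog := Real.log_natCast_nonneg T
  have hF1 : 1 ≤ F := by
    rw [hF]
    refine one_le_mul_of_one_le_of_one_le (one_le_mul_of_one_le_of_one_le (by linarith)
      (one_le_pow₀ hh1)) (one_le_pow₀ (by linarith))
  have hV0 : 0 ≤ V := hV ▸ norm_nonneg _
  set e := linearStep M.γ (t + 1) with he
  have he0 : 0 < e := hη.pos _
  have hten : (0 : ℝ) < (t : ℝ) + 1 := by positivity
  have hele : e ≤ M.horizon * (1 / ((t : ℝ) + 1)) := by
    refine (linearStep_le hγ hγ1 (t + 1)).trans (mul_le_mul_of_nonneg_left ?_ hh.le)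
    refine one_div_le_one_div_of_le hten ?_
    push_cast; linarith
  have hsum := sum_integral_norm_qError_linearStep_sq_le hM hπ hQ hD ht
  rw [← hℓ, ← hF] at hsum
  set B := M.noiseWeight πs (linearStep M.γ) (t + 1) with hB
  have hBr : ∀ j, HasRowSumLE (B j) e := M.hasRowSumLE_noiseWeight πs (t + 1)
  have hBn : ∀ j x, ‖(B j).mulVec x‖ ≤ e * ‖x‖ := fun j => (hBr j).norm_mulVec_le he0.le
  have hZ : ∫ ω, ‖∑ j ∈ Finset.range (t + 1), (B j).mulVec (M.bellmanNoise rew nxt (j + 1) ω)‖ ∂μ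
      ≤ 3 * √(((t + 1 : ℕ) : ℝ) * (e ^ 2 * V) * ℓ) + 2 * (e * M.horizon) * ℓ := by
    rw [hℓ]
    refine integral_norm_sum_bellmanNoise_le hM hπ hD (t + 1) B (by positivity) (by positivity)
      (fun j _ i k => ?_) fun i => ?_
    · rw [abs_of_nonneg ((hBr j).1 i k)]
      exact mul_le_mul_of_nonneg_right ((hBr j).apply_le i k) hh.le
    · calc _ ≤ ∑ _j ∈ Finset.range (t + 1), e ^ 2 * V :=
            Finset.sum_le_sum fun j _ => (hBr j).sum_sq_mul_le
              (σ := fun k => M.varZ μ rew nxt k k)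
              (fun k => hV ▸ apply_self_le_matrixInftyNorm _ k) hV0 i
        _ = _ := by rw [Finset.sum_const, Finset.card_range, nsmul_eq_mul]
  have hW : ∫ ω, ‖∑ j ∈ Finset.range (t + 1),
      (B j).mulVec (M.transitionNoise (linearStep M.γ) Q₀ rew nxt j ω)‖ ∂μ
      ≤ 8 * √(e ^ 2 * F * ℓ) := by
    rw [hℓ]
    refine integral_norm_sum_transitionNoise_le hη' hM hπ hQ (t + 1) B (β := fun _ => e)
      (fun _ => he0.le) hBn (by positivity) ?_
    rw [← Finset.mul_sum]
    exact mul_le_mul_of_nonneg_left hsum (by positivity)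
  have i1 := integrable_norm_qError hη' hM hπ hQ (t + 1)
  have i2 := integrable_norm_qError_sq hη' hM hπ hQ
  have i3 := integrable_norm_sum_mulVec_bellmanNoise (Q₀ := Q₀) hη' hM hπ hQ (t + 1) B
  have i4 := integrable_norm_sum_mulVec_transitionNoise hη' hM hπ hQ (t + 1) B
  have i0 : Integrable (fun _ : Ω => e * M.horizon) μ := integrable_const _
  have i5 : Integrable (fun ω => ∑ j ∈ Finset.range (t + 1),
      e * L * ‖M.qError (linearStep M.γ) Q₀ rew nxt j ω‖ ^ 2) μ :=
    integrable_finsetSum _ fun j _ => (i2 j).const_mul _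
  have pointwise : ∀ ω, ‖M.qError (linearStep M.γ) Q₀ rew nxt (t + 1) ω‖
      ≤ ((e * M.horizon
        + ‖∑ j ∈ Finset.range (t + 1), (B j).mulVec (M.bellmanNoise rew nxt (j + 1) ω)‖)
        + ‖∑ j ∈ Finset.range (t + 1),
            (B j).mulVec (M.transitionNoise (linearStep M.γ) Q₀ rew nxt j ω)‖)
        + ∑ j ∈ Finset.range (t + 1),
          e * L * ‖M.qError (linearStep M.γ) Q₀ rew nxt j ω‖ ^ 2 := by
    intro ω
    have hrec := M.eq_sum_noiseWeight_mulVec πs (η := linearStep M.γ)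
      (x := fun t => M.qError (linearStep M.γ) Q₀ rew nxt t ω)
      (e := fun j => M.bellmanNoise rew nxt (j + 1) ω
        + M.γ • M.transitionNoise (linearStep M.γ) Q₀ rew nxt j ω
        + M.γ • M.linearizationError (linearStep M.γ) Q₀ rew nxt πs j ω)
      (fun t => by
        rw [qError_succ_eq hπ hR]
        simp only [stepMatrix, Matrix.sub_mulVec, Matrix.one_mulVec, Matrix.smul_mulVec])
      (t + 1)
    simp only [Matrix.mulVec_add, Matrix.mulVec_smul, Finset.sum_add_distrib,
      ← Finset.smul_sum, ← add_assoc] at hrec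
    rw [hrec]
    refine (norm_add_le _ _).trans (add_le_add ((norm_add_le _ _).trans (add_le_add
      ((norm_add_le _ _).trans (add_le_add ?_ le_rfl)) ?_)) ?_)
    · refine ((M.hasRowSumLE_initialWeight πs (t + 1)).norm_mulVec_le he0.le _).trans ?_
      exact mul_le_mul_of_nonneg_left hQ he0.le
    · rw [norm_smul, Real.norm_eq_abs, abs_of_pos hγ]
      exact mul_le_of_le_one_left (norm_nonneg _) hγ1.le
    · rw [norm_smul, Real.norm_eq_abs, abs_of_pos hγ]
      refine (mul_le_of_le_one_left (norm_nonneg _) hγ1.le).trans ((norm_sum_le _ _).trans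
        (Finset.sum_le_sum fun j _ => (hBn j _).trans ?_))
      have := mul_le_mul_of_nonneg_left (norm_linearizationError_le (η := linearStep M.γ)
        (Q₀ := Q₀) (rew := rew) (nxt := nxt) hπ hR hL hL0 j ω) he0.le
      linarith
  have total : ∫ ω, ‖M.qError (linearStep M.γ) Q₀ rew nxt (t + 1) ω‖ ∂μ
      ≤ e * M.horizon + (3 * √(((t + 1 : ℕ) : ℝ) * (e ^ 2 * V) * ℓ) + 2 * (e * M.horizon) * ℓ)
        + 8 * √(e ^ 2 * F * ℓ) + e * L * F := by
    refine (integral_mono i1 (((i0.add i3).add i4).add i5) pointwise).trans ?_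
    rw [integral_add' ((i0.add i3).add i4) i5, integral_add' (i0.add i3) i4, integral_add' i0 i3,
      integral_finsetSum _ fun j _ => (i2 j).const_mul _]
    simp only [integral_const_mul, integral_const, probReal_univ, smul_eq_mul, one_mul,
      ← Finset.mul_sum]
    have := mul_le_mul_of_nonneg_left hsum (by positivity : 0 ≤ e * L)
    linarith
  -- `t + 1` noises with weights of row sum `e ≤ h/(t+1)` give a variance of order `h² V/(t+1)`.
  have s1 : √(((t + 1 : ℕ) : ℝ) * (e ^ 2 * V) * ℓ)
      ≤ M.horizon * √(V * ℓ) * (1 / √((t : ℝ) + 1)) := by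
    have hsq := Real.sq_sqrt hten.le
    have hsp := Real.sqrt_pos.2 hten
    refine Real.sqrt_le_iff.2 ⟨by positivity, ?_⟩
    rw [mul_pow, mul_pow, Real.sq_sqrt (by positivity), one_div_pow, hsq]
    push_cast
    have h1 : e ^ 2 ≤ (M.horizon * (1 / ((t : ℝ) + 1))) ^ 2 := pow_le_pow_left₀ he0.le hele 2
    calc ((t : ℝ) + 1) * (e ^ 2 * V) * ℓ = e ^ 2 * (((t : ℝ) + 1) * V * ℓ) := by ring
      _ ≤ (M.horizon * (1 / ((t : ℝ) + 1))) ^ 2 * (((t : ℝ) + 1) * V * ℓ) :=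
          mul_le_mul_of_nonneg_right h1 (by positivity)
      _ = _ := by field_simp
  -- Since `F ℓ ≥ 1`, the root may be dropped; the term is already of order `1/t`.
  have s2 : √(e ^ 2 * F * ℓ) ≤ e * (F * ℓ) := by
    refine Real.sqrt_le_iff.2 ⟨by positivity, ?_⟩
    have hFℓ : 1 ≤ F * ℓ := one_le_mul_of_one_le_of_one_le hF1 hℓ1
    rw [mul_pow, mul_assoc]
    exact mul_le_mul_of_nonneg_left (le_self_pow₀ hFℓ two_ne_zero) (by positivity)
  have s3 : e * (3 * M.horizon * ℓ + 8 * (F * ℓ) + L * F)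
      ≤ M.horizon * (1 / ((t : ℝ) + 1)) * (3 * M.horizon * ℓ + 8 * (F * ℓ) + L * F) :=
    mul_le_mul_of_nonneg_right hele (by positivity)
  have s4 : e * M.horizon ≤ e * M.horizon * ℓ :=
    le_mul_of_one_le_right (by positivity) hℓ1
  linarith

end Linear

/-- The bound for the rescaled linear step size, for a bounded model. -/
theorem IsBoundedModel.integral_norm_avgQLearning_linearStep_le
    (hM : M.IsBoundedModel μ rew nxt) (hπ : M.IsOptimal πs)
    (hQ : ‖Q₀ - M.optQ‖ ≤ 1 / (1 - M.γ)) (hD : 2 ≤ Fintype.card (S × A)) {L : ℝ}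
    (hL : M.LipschitzCondition πs L) {T : ℕ} (hT : 1 ≤ T) :
    ∫ ω, ‖M.avgQLearning (linearStep M.γ) Q₀ rew nxt T ω - M.optQ‖ ∂μ ≤
      442 * (√(matrixInftyNorm (M.varZ μ rew nxt) / (1 - M.γ) ^ 2)
          * √(Real.log (Fintype.card (S × A)) / T))
      + 100000 * (1 + Real.log (Fintype.card (S × A)) + Real.log T) ^ 5
        * ((1 + L) / (1 - M.γ) ^ 6 * (1 / T)) := by
  have hη := isStepSize_linearStep M.γ_pos M.γ_lt_one
  have hη' : ∀ t, 0 ≤ linearStep M.γ t ∧ linearStep M.γ t ≤ 1 := fun t =>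
    ⟨(hη.pos t).le, hη.le_one t⟩
  have hcard : Nonempty (S × A) := Fintype.card_pos_iff.1 (by omega)
  have hL0 := hL.nonneg
  have hh := M.one_le_horizon
  have hh0 := M.horizon_pos
  have hT1 : (1 : ℝ) ≤ T := by exact_mod_cast hT
  have hT0 : (0 : ℝ) < T := by linarith
  have hlog : 0 ≤ Real.log T := Real.log_nonneg hT1
  have hℓ1 := one_le_log_two_mul hD
  have hℓ2 := log_two_mul_le hD
  have hstep := fun (t : ℕ) (ht : t + 1 ≤ T) =>
    integral_norm_qError_linearStep_le hM hπ hQ hD hL hL0 ht rfl rfl rfl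
  set ℓ := Real.log (2 * Fintype.card (S × A)) with hℓdef
  set d := Real.log (Fintype.card (S × A)) with hd
  set h := M.horizon with hhdef
  set V := matrixInftyNorm (M.varZ μ rew nxt) with hVdef
  have hV0 : 0 ≤ V := norm_nonneg _
  have hd0 : 0 ≤ d := by linarith
  set Λ₀ := 1 + Real.log T with hΛ₀
  set Λ := 1 + d + Real.log T with hΛ
  have hΛ1 : 1 ≤ Λ := by linarith
  have hΛ₀1 : 1 ≤ Λ₀ := by linarith
  have hΛΛ : Λ₀ ≤ Λ := by linarith
  have hℓΛ : ℓ ≤ 2 * Λ := by linarith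
  set F := 2940 * ℓ * h ^ 5 * Λ₀ ^ 2 with hF
  have i1 := integrable_norm_qError hη' hM hπ hQ
  -- The triangle inequality is enough, because the rate `t^{-1/2}` of a single iterate sums to
  -- `2√T`.
  have havg : (T : ℝ) * ∫ ω, ‖M.avgQLearning (linearStep M.γ) Q₀ rew nxt T ω - M.optQ‖ ∂μ
      ≤ ∑ t ∈ Finset.range T, ∫ ω, ‖M.qError (linearStep M.γ) Q₀ rew nxt (t + 1) ω‖ ∂μ := by
    rw [← integral_const_mul, ← integral_finsetSum _ fun t _ => i1 (t + 1)]
    refine integral_mono ((integrable_norm_avgQLearning_sub hη' hM hπ hQ hT).const_mul _)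
      (integrable_finsetSum _ fun t _ => i1 (t + 1)) fun ω => ?_
    simp only
    rw [avgQLearning_sub_optQ hT, norm_smul, Real.norm_eq_abs, abs_inv, abs_of_pos hT0,
      ← mul_assoc, mul_inv_cancel₀ hT0.ne', one_mul]
    exact norm_sum_le _ _
  set R := h * (3 * h * ℓ + 8 * (F * ℓ) + L * F) with hR
  have hR0 : 0 ≤ R := by positivity
  have hsum : ∑ t ∈ Finset.range T, ∫ ω, ‖M.qError (linearStep M.γ) Q₀ rew nxt (t + 1) ω‖ ∂μ
      ≤ 3 * h * √(V * ℓ) * (2 * √T) + R * Λ₀ := by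
    calc _ ≤ ∑ t ∈ Finset.range T, (3 * h * √(V * ℓ) * (1 / √((t : ℝ) + 1))
          + R * (1 / ((t : ℝ) + 1))) :=
          Finset.sum_le_sum fun t ht => hstep t (Finset.mem_range.1 ht)
      _ = 3 * h * √(V * ℓ) * ∑ t ∈ Finset.range T, 1 / √((t : ℝ) + 1)
          + R * ∑ t ∈ Finset.range T, 1 / ((t : ℝ) + 1) := by
          rw [Finset.sum_add_distrib, ← Finset.mul_sum, ← Finset.mul_sum]
      _ ≤ _ := add_le_add (mul_le_mul_of_nonneg_left (sum_one_div_sqrt_le T) (by positivity))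
          (mul_le_mul_of_nonneg_left (sum_one_div_le le_rfl) hR0)
  have lead : h * √(V * ℓ) * √T ≤ T * (2 * (√(V / (1 - M.γ) ^ 2) * √(d / T))) := by
    have e0 : V / (1 - M.γ) ^ 2 = h ^ 2 * V := by
      rw [hhdef, horizon, one_div_pow]; ring
    have e1 : √(h ^ 2 * V) = h * √V := by
      rw [Real.sqrt_mul (sq_nonneg h), Real.sqrt_sq hh0.le]
    rw [e0, e1]
    have e2 : √(V * ℓ) * √T ≤ T * (2 * (√V * √(d / T))) := by
      rw [← Real.sqrt_mul (by positivity)]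
      refine Real.sqrt_le_iff.2 ⟨by positivity, ?_⟩
      have e : (T * (2 * (√V * √(d / T)))) ^ 2 = 4 * T ^ 2 * (√V ^ 2 * √(d / T) ^ 2) := by ring
      rw [e, Real.sq_sqrt hV0, Real.sq_sqrt (by positivity)]
      have e3 : 4 * (T : ℝ) ^ 2 * (V * (d / T)) = V * (4 * d) * T := by field_simp
      rw [e3]
      have : ℓ ≤ 4 * d := by linarith
      gcongr
    have := mul_le_mul_of_nonneg_left e2 hh0.le
    linarith
  have hFle : F ≤ 5880 * (Λ ^ 3 * h ^ 5) := by
    have h1 : Λ₀ ^ 2 ≤ Λ ^ 2 := pow_le_pow_left₀ (by linarith) hΛΛ 2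
    have h2 : ℓ * Λ₀ ^ 2 ≤ 2 * Λ * Λ ^ 2 := mul_le_mul hℓΛ h1 (by positivity) (by positivity)
    have := mul_le_mul_of_nonneg_left h2 (by positivity : 0 ≤ 2940 * h ^ 5)
    rw [hF]
    linarith
  -- The sixth power of `h` is the fifth from `F` times the one from `η_t ≤ h/(t+1)`; `100000`
  -- covers `6 + 94080`.
  have rest : R * Λ₀ ≤ 100000 * Λ ^ 5 * (T * ((1 + L) / (1 - M.γ) ^ 6 * (1 / T))) := by
    have e0 : T * ((1 + L) / (1 - M.γ) ^ 6 * (1 / T)) = (1 + L) * h ^ 6 := by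
      rw [hhdef, horizon, one_div_pow]; field_simp
    rw [e0]
    have r1 : h * (3 * h * ℓ) * Λ₀ ≤ 6 * (Λ ^ 5 * h ^ 6) := by
      have a1 : ℓ * Λ₀ ≤ 2 * Λ * Λ := mul_le_mul hℓΛ hΛΛ (by linarith) (by linarith)
      have a2 : Λ ^ 2 * h ^ 2 ≤ Λ ^ 5 * h ^ 6 := by
        have := pow_le_pow_right₀ hΛ1 (show 2 ≤ 5 by norm_num)
        have := pow_le_pow_right₀ hh (show 2 ≤ 6 by norm_num)
        gcongr
      have := mul_le_mul_of_nonneg_left a1 (by positivity : 0 ≤ 3 * h ^ 2)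
      linarith
    have r2 : h * (8 * (F * ℓ)) * Λ₀ ≤ 94080 * (Λ ^ 5 * h ^ 6) := by
      have a1 : ℓ * Λ₀ ≤ 2 * Λ * Λ := mul_le_mul hℓΛ hΛΛ (by linarith) (by linarith)
      have a2 : F * (ℓ * Λ₀) ≤ 5880 * (Λ ^ 3 * h ^ 5) * (2 * Λ * Λ) :=
        mul_le_mul hFle a1 (by positivity) (by positivity)
      have := mul_le_mul_of_nonneg_left a2 (by positivity : 0 ≤ 8 * h)
      linarith
    have r3 : h * (L * F) * Λ₀ ≤ 5880 * (L * (Λ ^ 5 * h ^ 6)) := by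
      have a2 : F * Λ₀ ≤ 5880 * (Λ ^ 3 * h ^ 5) * Λ :=
        mul_le_mul hFle hΛΛ (by linarith) (by positivity)
      have a3 := mul_le_mul_of_nonneg_left a2 (by positivity : 0 ≤ h * L)
      have a4 : L * (Λ ^ 4 * h ^ 6) ≤ L * (Λ ^ 5 * h ^ 6) := by
        have := pow_le_pow_right₀ hΛ1 (show 4 ≤ 5 by norm_num)
        gcongr
      linarith
    have p1 : 0 ≤ Λ ^ 5 * h ^ 6 := by positivity
    have p2 : 0 ≤ L * (Λ ^ 5 * h ^ 6) := by positivity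
    rw [hR]
    linarith
  refine le_of_mul_le_mul_left ?_ hT0
  have pos1 : 0 ≤ T * (√(V / (1 - M.γ) ^ 2) * √(d / T)) := by positivity
  linarith

end DiscountedMDP

/-! ### Reduction to everywhere bounded observations, and the theorem -/

namespace DiscountedMDP

variable {S A : Type*} [Fintype S] [Fintype A] [DecidableEq S] [DecidableEq A]
  {M : DiscountedMDP S A} {Ω : Type*} [MeasurableSpace Ω] {μ : Measure Ω}
  {rew rew' : ℕ → S × A → Ω → ℝ} {nxt nxt' : ℕ → S × A → Ω → S}

theorem qLearning_congr {ω : Ω} (h : ∀ t i, rew t i ω = rew' t i ω)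
    (h' : ∀ t i, nxt t i ω = nxt' t i ω) (η : ℕ → ℝ) (Q₀ : S × A → ℝ) (t : ℕ) :
    M.qLearning η Q₀ rew nxt t ω = M.qLearning η Q₀ rew' nxt' t ω := by
  induction t with
  | zero => rfl
  | succ t ih =>
    ext i
    simp only [qLearning, ih, h, h']

theorem avgQLearning_congr_ae (h : ∀ᵐ ω ∂μ, ∀ t i, rew t i ω = rew' t i ω)
    (h' : ∀ᵐ ω ∂μ, ∀ t i, nxt t i ω = nxt' t i ω) (η : ℕ → ℝ) (Q₀ : S × A → ℝ) (T : ℕ) :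
    M.avgQLearning η Q₀ rew nxt T =ᵐ[μ] M.avgQLearning η Q₀ rew' nxt' T := by
  filter_upwards [h, h'] with ω h h'
  simp only [avgQLearning, qLearning_congr h h']

theorem varZ_congr_ae (h : ∀ᵐ ω ∂μ, ∀ t i, rew t i ω = rew' t i ω)
    (h' : ∀ᵐ ω ∂μ, ∀ t i, nxt t i ω = nxt' t i ω) :
    M.varZ μ rew nxt = M.varZ μ rew' nxt' := by
  ext i j
  refine integral_congr_ae ?_
  filter_upwards [h, h'] with ω h h'
  simp only [bellmanNoise, h, h']

variable [MeasurableSpace S] [MeasurableSingletonClass S]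

/-- The observations of a generative model with rewards in `[0, 1]` can be modified on a null set
so that they are measurable and the rewards lie in `[0, 1]` everywhere. -/
theorem IsGenerativeModel.exists_isBoundedModel [IsProbabilityMeasure μ]
    (hG : M.IsGenerativeModel μ rew nxt) (hR : M.RewardsInUnitInterval) :
    ∃ (rew' : ℕ → S × A → Ω → ℝ) (nxt' : ℕ → S × A → Ω → S), M.IsBoundedModel μ rew' nxt' ∧
      (∀ᵐ ω ∂μ, ∀ t i, rew t i ω = rew' t i ω) ∧ ∀ᵐ ω ∂μ, ∀ t i, nxt t i ω = nxt' t i ω := by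
  let g : ℕ → S × A → Ω → ℝ × S := fun t i => (hG.law t i).aemeasurable.mk _
  have hg : ∀ t i, Measurable (g t i) := fun t i => (hG.law t i).aemeasurable.measurable_mk
  have hmk : ∀ t i, ∀ᵐ ω ∂μ, (rew t i ω, nxt t i ω) = g t i ω := fun t i =>
    (hG.law t i).aemeasurable.ae_eq_mk
  have hmem : ∀ t i, ∀ᵐ ω ∂μ, rew t i ω ∈ Set.Icc (0 : ℝ) 1 := fun t i => by
    have h : ∀ᵐ p ∂((M.R i : Measure ℝ).prod (M.P i).toMeasure), p.1 ∈ Set.Icc (0 : ℝ) 1 :=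
      Measure.quasiMeasurePreserving_fst.ae (hR i)
    rw [← (hG.law t i).map_eq] at h
    exact ae_of_ae_map (hG.law t i).aemeasurable h
  -- Clipping the measurable version of the reward to `[0, 1]` changes nothing almost surely.
  have hae : ∀ t i, ∀ᵐ ω ∂μ, rew t i ω = max 0 (min 1 (g t i ω).1) ∧ nxt t i ω = (g t i ω).2 :=
    fun t i => by
      filter_upwards [hmk t i, hmem t i] with ω h1 h2
      rw [← h1]
      exact ⟨by rw [min_eq_right h2.2, max_eq_right h2.1], rfl⟩
  have hae' : ∀ t i, (fun ω => (rew t i ω, nxt t i ω))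
      =ᵐ[μ] fun ω => (max 0 (min 1 (g t i ω).1), (g t i ω).2) := fun t i => by
    filter_upwards [hae t i] with ω h
    rw [h.1, h.2]
  have hm : ∀ t i, Measurable fun ω => max 0 (min 1 (g t i ω).1) := fun t i =>
    measurable_const.max (measurable_const.min (hg t i).fst)
  refine ⟨fun t i ω => max 0 (min 1 (g t i ω).1), fun t i ω => (g t i ω).2,
    ⟨⟨fun t i => ⟨((hm t i).prodMk (hg t i).snd).aemeasurable, ?_⟩,
      hG.indep.congr fun p => hae' p.1 p.2⟩, hm, fun t i => (hg t i).snd,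
      fun t i ω => ⟨le_max_left _ _, max_le zero_le_one (min_le_left _ _)⟩⟩, ?_, ?_⟩
  · rw [← Measure.map_congr (hae' t i), (hG.law t i).map_eq]
  · exact ae_all_iff.2 fun t => ae_all_iff.2 fun i => (hae t i).mono fun _ h => h.1
  · exact ae_all_iff.2 fun t => ae_all_iff.2 fun i => (hae t i).mono fun _ h => h.2

end DiscountedMDP

theorem theorem4 :
    ∃ (C₀ : ℝ) (D₀ : ℕ),
      -- polynomial step size
      (∀ α : ℝ, 1 / 2 < α → α < 1 → ∃ (C : ℝ) (k : ℕ),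
        ∀ (S : Type u) (A : Type v) [Fintype S] [Fintype A] [DecidableEq S] [DecidableEq A]
          [MeasurableSpace S] [MeasurableSingletonClass S]
          (M : DiscountedMDP S A) (πs : S → PMF A) (L : ℝ) (Q₀ : S × A → ℝ)
          (Ω : Type w) [MeasurableSpace Ω] (μ : MeasureTheory.Measure Ω)
          [MeasureTheory.IsProbabilityMeasure μ]
          (rew : ℕ → S × A → Ω → ℝ) (nxt : ℕ → S × A → Ω → S) (T : ℕ),
          D₀ ≤ Fintype.card (S × A) →
          M.RewardsInUnitInterval →
          M.IsOptimal πs →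
          M.LipschitzCondition πs L →
          ‖Q₀ - M.optQ‖ ≤ 1 / (1 - M.γ) →
          M.IsGenerativeModel μ rew nxt →
          1 ≤ T →
          MeasureTheory.Integrable
              (fun ω => ‖M.avgQLearning (polyStep α) Q₀ rew nxt T ω - M.optQ‖) μ ∧
            ∫ ω, ‖M.avgQLearning (polyStep α) Q₀ rew nxt T ω - M.optQ‖ ∂μ ≤
              C₀ * (√‖(M.varQ μ rew nxt πs).diag‖ * √(Real.log (Fintype.card (S × A)) / T)
                  + √(Real.log (Fintype.card (S × A))) / (1 - M.γ) ^ 3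
                    * (1 / (T : ℝ) ^ (1 - α / 2)))
              + C * (1 + Real.log (Fintype.card (S × A)) + Real.log T) ^ k
                * ((1 + L) / (1 - M.γ) ^ (3 + 2 / (1 - α)) * (1 / T)
                  + M.γ * L / (1 - M.γ) ^ (4 + 1 / (1 - α)) * (1 / (T : ℝ) ^ α))) ∧
      -- linearly rescaled step size
      (∃ (C : ℝ) (k : ℕ),
        ∀ (S : Type u) (A : Type v) [Fintype S] [Fintype A] [DecidableEq S] [DecidableEq A]
          [MeasurableSpace S] [MeasurableSingletonClass S]
          (M : DiscountedMDP S A) (πs : S → PMF A) (L : ℝ) (Q₀ : S × A → ℝ)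
          (Ω : Type w) [MeasurableSpace Ω] (μ : MeasureTheory.Measure Ω)
          [MeasureTheory.IsProbabilityMeasure μ]
          (rew : ℕ → S × A → Ω → ℝ) (nxt : ℕ → S × A → Ω → S) (T : ℕ),
          D₀ ≤ Fintype.card (S × A) →
          M.RewardsInUnitInterval →
          M.IsOptimal πs →
          M.LipschitzCondition πs L →
          ‖Q₀ - M.optQ‖ ≤ 1 / (1 - M.γ) →
          M.IsGenerativeModel μ rew nxt →
          1 ≤ T →
          MeasureTheory.Integrable
              (fun ω => ‖M.avgQLearning (linearStep M.γ) Q₀ rew nxt T ω - M.optQ‖) μ ∧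
            ∫ ω, ‖M.avgQLearning (linearStep M.γ) Q₀ rew nxt T ω - M.optQ‖ ∂μ ≤
              C₀ * (√(matrixInftyNorm (M.varZ μ rew nxt) / (1 - M.γ) ^ 2)
                  * √(Real.log (Fintype.card (S × A)) / T))
              + C * (1 + Real.log (Fintype.card (S × A)) + Real.log T) ^ k
                * ((1 + L) / (1 - M.γ) ^ 6 * (1 / T))) := by
  -- `442 = 2·221`, the `2` coming from `√ln(2D) ≤ 2√(ln D)`. The requirement `D ≥ 2` yields `1 ≤
  -- ln(2D) ≤ 2 ln D`.
  refine ⟨442, 2, fun α hα₀ hα => ?_, 100000, 5, ?_⟩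
  · obtain ⟨q, hq⟩ := exists_mul_rpow_le hα₀ hα
    refine ⟨28 + 2 * (880 * (1 / (1 - α))) ^ q + 7150 * 2 ^ (1 / (1 - α)) + 6050 * (1 / (1 - α)),
      q + 2, ?_⟩
    intro S A _ _ _ _ _ _ M πs L Q₀ Ω _ μ _ rew nxt T hD hR hπ hL hQ hG hT
    obtain ⟨rew', nxt', hM, hr, hn⟩ := hG.exists_isBoundedModel hR
    have : Nonempty (S × A) := Fintype.card_pos_iff.1 (by omega)
    have hη := isStepSize_polyStep (by linarith : 0 < α) hα
    have hae : (fun ω => ‖M.avgQLearning (polyStep α) Q₀ rew nxt T ω - M.optQ‖)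
        =ᵐ[μ] fun ω => ‖M.avgQLearning (polyStep α) Q₀ rew' nxt' T ω - M.optQ‖ := by
      filter_upwards [M.avgQLearning_congr_ae hr hn (polyStep α) Q₀ T] with ω h
      rw [h]
    rw [integral_congr_ae hae, DiscountedMDP.varQ, M.varZ_congr_ae hr hn]
    exact ⟨(integrable_congr hae).2 (DiscountedMDP.integrable_norm_avgQLearning_sub
        (fun t => ⟨(hη.pos t).le, hη.le_one t⟩) hM hπ hQ hT),
      hM.integral_norm_avgQLearning_polyStep_le hα₀ hα hq hπ hQ hD hL hT⟩
  · intro S A _ _ _ _ _ _ M πs L Q₀ Ω _ μ _ rew nxt T hD hR hπ hL hQ hG hT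
    obtain ⟨rew', nxt', hM, hr, hn⟩ := hG.exists_isBoundedModel hR
    have : Nonempty (S × A) := Fintype.card_pos_iff.1 (by omega)
    have hη := isStepSize_linearStep M.γ_pos M.γ_lt_one
    have hae : (fun ω => ‖M.avgQLearning (linearStep M.γ) Q₀ rew nxt T ω - M.optQ‖)
        =ᵐ[μ] fun ω => ‖M.avgQLearning (linearStep M.γ) Q₀ rew' nxt' T ω - M.optQ‖ := by
      filter_upwards [M.avgQLearning_congr_ae hr hn (linearStep M.γ) Q₀ T] with ω h
      rw [h]
    rw [integral_congr_ae hae, M.varZ_congr_ae hr hn]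
    exact ⟨(integrable_congr hae).2 (DiscountedMDP.integrable_norm_avgQLearning_sub
        (fun t => ⟨(hη.pos t).le, hη.le_one t⟩) hM hπ hQ hT),
      hM.integral_norm_avgQLearning_linearStep_le hπ hQ hD hL hT⟩
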